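/- Let $n,p,r$ be integers with $1\le r\le n-1$, let $\mu\in\mathbb{R}^p$, and let $\Sigma$ be a symmetric positive semidefinite $p\times p$ matrix of rank $r$, with Moore–Penrose pseudoinverse $\Sigma^+$. Let $X_1,\dots,X_n$ be independent with law $N_p(\mu,\Sigma)$, let $\bar X=\frac1n\sum_i X_i$ and let $S=\frac1n\sum_{i=1}^n (X_i-\bar X)(X_i-\bar X)^t$ be the sample covariance matrix. Almost surely $S$ has rank $r$; let $S=O_1LO_1^t$ be a reduced spectral decomposition, where $O_1$ is $p\times r$ with $O_1^tO_1=I_r$ and $L=\mathrm{diag}(l_1,\dots,l_r)$, $l_1\ge\dots\ge l_r>0$, holds the nonzero eigenvalues of $S$. Consider the orthogonally invariant estimator $\hat\Sigma=O_1\Psi O_1^t$ with $\Psi=\mathrm{diag}(\psi_1,\dots,\psi_r)$, where each $\psi_k=\psi_k(l_1,\dots,l_r)$ is a real function that is continuous on $\{l_1\ge\dots\ge l_r>0\}$ and twice differentiable on $\{l_1>\dots>l_r>0\}$ (for example, twice differentiable on $(0,\infty)^r$). Define \[\psi^*_k=\left[\frac{n-r-2}{n}\frac{\psi_k}{l_k}+\frac4n\frac{\partial\psi_k}{\partial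 l_k}+\frac2n\sum_{b\ne k}\frac{\psi_k-\psi_b}{l_k-l_b}-2\right]\psi_k\] and, for $\varphi=(\varphi_1,\dots,\varphi_r)$, \[U(\varphi)=p+\frac{n-r-2}{n}\sum_{k=1}^r\frac{\varphi_k}{l_k}+\frac2n\sum_{k=1}^r\frac{\partial\varphi_k}{\partial l_k}+\frac1n\sum_{k\ne b}\frac{\varphi_k-\varphi_b}{l_k-l_b},\] where the last sum runs over ordered pairs of distinct indices. Assume that \[E|U(\psi^*)|<\infty,\quad E|U(\psi)|<\infty,\quad E\sum_{k=1}^r\left|\frac{\psi^*_k}{l_k}\right|^2<\infty,\quad E\sum_{k=1}^r\left|\frac{\psi_k}{l_k}\right|^2<\infty .\] Then the loss $\mathrm{tr}\big([\hat\Sigma\Sigma^+-I_p]^2\big)$ is integrable and \[E\,\mathrm{tr}\big([\hat\Sigma\Sigma^+-I_p]^2\big)=E\left[p+\frac{n-r-2}{n}\sum_{k=1}^r\frac{\psi^*_k}{l_k}+\frac2n\sum_{k=1}^r\frac{\partial\psi^*_k}{\partial l_k}+\frac1n\sum_{k\ne b}\frac{\psi^*_k-\psi^*_b}{l_k-l_b}\right].\]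 -/

import Mathlib

open MeasureTheory ProbabilityTheory Matrix

noncomputable section

/-! ### The Moore-Penrose pseudoinverse of a real matrix -/

/-- The four Penrose equations: `B` is the Moore-Penrose pseudoinverse of `A`. -/
structure IsMoorePenroseInverse {m n : Type*} [Fintype m] [Fintype n]
    (A : Matrix m n ℝ) (B : Matrix n m ℝ) : Prop where
  mul_mul_self : A * B * A = A
  self_mul_mul : B * A * B = B
  symm_left : (A * B)ᵀ = A * B
  symm_right : (B * A)ᵀ = B * A

/-- The Penrose equations have at most one solution. -/
theorem IsMoorePenroseInverse.unique {m n : Type*} [Fintype m] [Fintype n]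
    {A : Matrix m n ℝ} {B C : Matrix n m ℝ}
    (hB : IsMoorePenroseInverse A B) (hC : IsMoorePenroseInverse A C) : B = C := by
  have h1 : A * B = A * C := by
    have e : (A * B)ᵀ = (A * C * (A * B))ᵀ := by
      rw [← Matrix.mul_assoc, hC.mul_mul_self]
    rw [transpose_mul (A * C), hB.symm_left, hC.symm_left, ← Matrix.mul_assoc,
      hB.mul_mul_self] at e
    exact e
  have h2 : B * A = C * A := by
    have e : (B * A)ᵀ = (B * A * (C * A))ᵀ := by
      rw [Matrix.mul_assoc B, ← Matrix.mul_assoc A, hC.mul_mul_self]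
    rw [transpose_mul (B * A), hB.symm_right, hC.symm_right, Matrix.mul_assoc C,
      ← Matrix.mul_assoc A, hB.mul_mul_self] at e
    exact e
  calc B = B * A * B := hB.self_mul_mul.symm
    _ = C * A * C := by rw [h2, Matrix.mul_assoc, h1, ← Matrix.mul_assoc]
    _ = C := hC.self_mul_mul

/-- A real symmetric matrix has a symmetric matrix solving the Penrose equations. -/
theorem exists_moorePenroseInverse_of_symm {n : Type*} [Fintype n]
    {A : Matrix n n ℝ} (hA : A.IsHermitian) :
    ∃ B : Matrix n n ℝ, IsMoorePenroseInverse A B ∧ Bᵀ = B := by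
  classical
  set U : Matrix n n ℝ := (hA.eigenvectorUnitary : Matrix n n ℝ) with hU
  set d : n → ℝ := hA.eigenvalues with hd
  have hUU : Uᵀ * U = 1 := by
    have h := (Matrix.mem_unitaryGroup_iff').1 hA.eigenvectorUnitary.2
    rwa [star_eq_conjTranspose, conjTranspose_eq_transpose_of_trivial] at h
  have hs : A = U * diagonal d * Uᵀ := by
    have h := hA.spectral_theorem
    rw [Unitary.conjStarAlgAut_apply] at h
    rw [star_eq_conjTranspose, conjTranspose_eq_transpose_of_trivial] at h
    exact h
  have key : ∀ a b : n → ℝ, (U * diagonal a * Uᵀ) * (U * diagonal b * Uᵀ) =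
      U * diagonal (fun i => a i * b i) * Uᵀ := by
    intro a b
    calc (U * diagonal a * Uᵀ) * (U * diagonal b * Uᵀ)
        = U * diagonal a * (Uᵀ * U) * diagonal b * Uᵀ := by simp only [Matrix.mul_assoc]
      _ = _ := by rw [hUU, Matrix.mul_one, Matrix.mul_assoc U, diagonal_mul_diagonal]
  have ksymm : ∀ a : n → ℝ, (U * diagonal a * Uᵀ)ᵀ = U * diagonal a * Uᵀ := by
    intro a
    simp [transpose_mul, Matrix.mul_assoc]
  refine ⟨U * diagonal (fun i => (d i)⁻¹) * Uᵀ, ⟨?_, ?_, ?_, ?_⟩, ksymm _⟩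
  · rw [hs, key, key]
    congr 3
    funext i
    exact mul_inv_mul_cancel (d i)
  · rw [hs, key, key]
    congr 3
    funext i
    by_cases h : d i = 0 <;> simp [h]
  · rw [hs, key, ksymm]
  · rw [hs, key, ksymm]

/-- Every real matrix has a Moore-Penrose pseudoinverse. -/
theorem exists_moorePenroseInverse {m n : Type*} [Fintype m] [Fintype n]
    (A : Matrix m n ℝ) : ∃ B : Matrix n m ℝ, IsMoorePenroseInverse A B := by
  classical
  have hG : (Aᵀ * A).IsHermitian := by
    have h := isHermitian_conjTranspose_mul_self A
    rwa [conjTranspose_eq_transpose_of_trivial] at h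
  obtain ⟨C, hC, hCs⟩ := exists_moorePenroseInverse_of_symm hG
  have h0 : A * (C * (Aᵀ * A) - 1) = 0 := by
    have h1 : Aᵀ * A * (C * (Aᵀ * A) - 1) = 0 := by
      rw [Matrix.mul_sub, ← Matrix.mul_assoc, hC.mul_mul_self, Matrix.mul_one, sub_self]
    have h2 : (A * (C * (Aᵀ * A) - 1))ᴴ * (A * (C * (Aᵀ * A) - 1)) = 0 := by
      rw [conjTranspose_eq_transpose_of_trivial, transpose_mul, Matrix.mul_assoc,
        ← Matrix.mul_assoc Aᵀ, h1, Matrix.mul_zero]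
    exact conjTranspose_mul_self_eq_zero.1 h2
  refine ⟨C * Aᵀ, ⟨?_, ?_, ?_, ?_⟩⟩
  · rw [Matrix.mul_sub, Matrix.mul_one, sub_eq_zero] at h0
    simpa only [Matrix.mul_assoc] using h0
  · calc C * Aᵀ * A * (C * Aᵀ) = C * (Aᵀ * A) * C * Aᵀ := by simp only [Matrix.mul_assoc]
      _ = C * Aᵀ := by rw [hC.self_mul_mul]
  · simp only [transpose_mul, transpose_transpose, hCs, Matrix.mul_assoc]
  · simpa only [Matrix.mul_assoc] using hC.symm_right

/-- The Moore-Penrose pseudoinverse `A⁺` of a real matrix. -/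
def moorePenroseInverse {m n : Type*} [Fintype m] [Fintype n]
    (A : Matrix m n ℝ) : Matrix n m ℝ :=
  Classical.choose (exists_moorePenroseInverse A)

/-- The pseudoinverse solves the Penrose equations. -/
theorem moorePenroseInverse_spec {m n : Type*} [Fintype m] [Fintype n]
    (A : Matrix m n ℝ) : IsMoorePenroseInverse A (moorePenroseInverse A) :=
  Classical.choose_spec (exists_moorePenroseInverse A)

/-! ### The sample covariance matrix and its reduced spectral decomposition -/

/-- The sample mean of the rows of an `n × p` data matrix. -/
def sampleMean {n p : ℕ} (X : Matrix (Fin n) (Fin p) ℝ) : Fin p → ℝ :=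
  fun j => (1 / (n : ℝ)) * ∑ i, X i j

/-- The sample covariance matrix `(X - 1 X̄ᵗ)ᵗ (X - 1 X̄ᵗ) / n`. -/
def sampleCov {n p : ℕ} (X : Matrix (Fin n) (Fin p) ℝ) : Matrix (Fin p) (Fin p) ℝ :=
  (1 / (n : ℝ)) • ((X - Matrix.of fun _ j => sampleMean X j)ᵀ *
    (X - Matrix.of fun _ j => sampleMean X j))

/-- `S = O diag(l) Oᵗ` with `O` a `p × r` semi-orthogonal matrix and
`l 0 ≥ l 1 ≥ ⋯ > 0` (the nonzero eigenvalues of `S`, in decreasing order). -/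
structure IsReducedSpectralDecomposition {p r : ℕ} (S : Matrix (Fin p) (Fin p) ℝ)
    (O : Matrix (Fin p) (Fin r) ℝ) (l : Fin r → ℝ) : Prop where
  semiorthogonal : Oᵀ * O = 1
  eq_mul : S = O * diagonal l * Oᵀ
  antitone : Antitone l
  pos : ∀ k, 0 < l k

/-! ### Functions of the eigenvalues -/

/-- Vectors `l 0 > l 1 > ⋯ > 0` of distinct ordered positive eigenvalues. -/
def strictChamber (r : ℕ) : Set (Fin r → ℝ) := {l | StrictAnti l ∧ ∀ k, 0 < l k}

/-- Vectors `l 0 ≥ l 1 ≥ ⋯ > 0` of ordered positive eigenvalues. -/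
def weakChamber (r : ℕ) : Set (Fin r → ℝ) := {l | Antitone l ∧ ∀ k, 0 < l k}

/-- Twice (Fréchet) differentiable on `U`; used for open `U` only. -/
def TwiceDifferentiableOn {r : ℕ} (f : (Fin r → ℝ) → ℝ) (U : Set (Fin r → ℝ)) : Prop :=
  DifferentiableOn ℝ f U ∧ DifferentiableOn ℝ (fderiv ℝ f) U

/-- The partial derivative `∂f/∂l_k` at `l`. -/
def partialDeriv {r : ℕ} (k : Fin r) (f : (Fin r → ℝ) → ℝ) (l : Fin r → ℝ) : ℝ :=
  deriv (fun t : ℝ => f (Function.update l k t)) (l k)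

/-- `ψ*_k = [(n-r-2)/n ψ_k/l_k + 4/n ∂ψ_k/∂l_k + 2/n ∑_{b≠k} (ψ_k-ψ_b)/(l_k-l_b) - 2] ψ_k`. -/
def psiStar {r : ℕ} (n : ℕ) (ψ : Fin r → (Fin r → ℝ) → ℝ) (k : Fin r) (l : Fin r → ℝ) : ℝ :=
  (((n : ℝ) - r - 2) / n * (ψ k l / l k)
    + 4 / (n : ℝ) * partialDeriv k (ψ k) l
    + 2 / (n : ℝ) * ∑ b ∈ Finset.univ.erase k, (ψ k l - ψ b l) / (l k - l b)
    - 2) * ψ k l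

/-- `p + (n-r-2)/n ∑ φ_k/l_k + 2/n ∑ ∂φ_k/∂l_k + 1/n ∑_{k≠b} (φ_k-φ_b)/(l_k-l_b)`. -/
def riskExpr {r : ℕ} (n p : ℕ) (φ : Fin r → (Fin r → ℝ) → ℝ) (l : Fin r → ℝ) : ℝ :=
  (p : ℝ)
    + ((n : ℝ) - r - 2) / n * ∑ k, φ k l / l k
    + 2 / (n : ℝ) * ∑ k, partialDeriv k (φ k) l
    + 1 / (n : ℝ) * ∑ k, ∑ b ∈ Finset.univ.erase k, (φ k l - φ b l) / (l k - l b)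

/-- The orthogonally invariant estimator `O diag(ψ_1(l), …, ψ_r(l)) Oᵗ`. -/
def invariantEstimator {p r : ℕ} (ψ : Fin r → (Fin r → ℝ) → ℝ)
    (O : Matrix (Fin p) (Fin r) ℝ) (l : Fin r → ℝ) : Matrix (Fin p) (Fin p) ℝ :=
  O * diagonal (fun k => ψ k l) * Oᵀ

/-- The invariant squared loss `tr[(Ŝ Σ⁺ - I)²]`. -/
def invariantLoss {p : ℕ} (Shat Sig : Matrix (Fin p) (Fin p) ℝ) : ℝ :=
  ((Shat * moorePenroseInverse Sig - 1) ^ 2).trace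

end

/-! The unknown covariance is removed from the risk by two integrations by parts. Write Σ = Q D Qᵗ
with QᵗQ = I_r and D = diag(w²). Up to a null set X_i = μ + Q diag(w) z_i with z standard normal, so
the sample covariance is Q S Qᵗ, where S is the r × r covariance of the scaled array
(`sampleCov_eq`). Almost every S has r distinct positive eigenvalues (`ae_isSimpleSpectrum`). Then
O₁ = QH with H orthogonal, and with K = HΨHᵗ the loss is p − 2 tr(D⁻¹K) + tr(D⁻¹KD⁻¹K).

Let Y be the centred scaled data, so that nS = YᵗY, and let K_φ be the spectral function of S with
values φ_k(l). Stein's identity for the field Y K_κ A K_φ, with column a divided by w_a, is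
`integral_spectralDiv`; its divergence follows from first order perturbation of eigenvalues and
spectral projections. Two choices matter. With A = 1, first factor φ/l and second factor 1, it says
that n E tr(D⁻¹K_φ) is the expectation of the operator `steinOp` (`integral_steinOp`). With A = D⁻¹,
first factor ψ/l and second factor ψ, it says that n E tr(D⁻¹KD⁻¹K) = E ∑ (HᵗD⁻¹H)_kk n(ψ*_k + 2ψ_k)
(`integral_quadWeight`). The terms 2ψ_k cancel the cross term of the loss, leaving p + E
tr(D⁻¹K_{ψ*}), and the first identity for ψ* finishes (`integral_loss`).

The difficulty is to justify this under weak hypotheses: ψ* is only differentiable inside the open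
chamber l_1 > … > l_r > 0, may blow up at its walls, and only the total divergence is known to be
integrable. The fields are therefore cut off by a function of a logarithmic energy W, which tends to
infinity at the walls and at infinity. The cutoff at level M leaves an error ∑ φ_k ∂_k(cutoff), of
size |φ_k/l_k| · |l_k ∂_kW| / M on {M < W < 2M}. Since ∑ (φ_k/l_k)² is integrable, it suffices that
the expectation of ∑ (l_k ∂_kW)² over {W < 2M} be O(M²). This is
`exists_integral_ramp_mul_energyQuad_le`. It comes from testing the compactly supported first
identity with a truncation of −l_k² ∂_kW, whose image under the Stein operator is bounded by a
multiple of 1 + ∑ l_k, because the double poles at the walls cancel. A weighted arithmetic-geometric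
inequality then sends the error to zero (`tendsto_cutoff_error`).

In the second identity the error involves ψ²/l, which is not known to be square integrable. A
further cutoff in ∑ (l_k + 1/l_k) makes ψ bounded, by continuity of ψ where eigenvalues meet. To
remove it, E ∑ ψ_k² must be finite. This follows from the identity itself: tr(D⁻¹KD⁻¹K) dominates a
multiple of ∑ ψ_k², so the truncated second moments g satisfy g(R) ≤ a + (b/R) g(2R) as well as g(R)
= O(R²), which forces them to be bounded. -/

noncomputable section

open Filter Topology

/-! ### A smooth plateau function -/

/-- A smooth function equal to `1` on `(-∞, 1]` and to `0` on `[2, ∞)`. -/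
def plateau (t : ℝ) : ℝ := Real.smoothTransition (2 - t)

theorem plateau_contDiff : ContDiff ℝ 1 plateau :=
  Real.smoothTransition.contDiff.comp (contDiff_const.sub contDiff_id)

theorem plateau_nonneg (t : ℝ) : 0 ≤ plateau t := Real.smoothTransition.nonneg _

theorem plateau_le_one (t : ℝ) : plateau t ≤ 1 := Real.smoothTransition.le_one _

theorem plateau_eq_one {t : ℝ} (h : t ≤ 1) : plateau t = 1 :=
  Real.smoothTransition.one_of_one_le (by linarith)

theorem plateau_eq_zero {t : ℝ} (h : 2 ≤ t) : plateau t = 0 :=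
  Real.smoothTransition.zero_of_nonpos (by linarith)

theorem plateau_differentiable : Differentiable ℝ plateau :=
  plateau_contDiff.differentiable one_ne_zero

theorem continuous_deriv_plateau : Continuous (deriv plateau) :=
  plateau_contDiff.continuous_deriv le_rfl

/-- Each such point is a global maximum, which covers the endpoint t = 1 too. -/
theorem deriv_plateau_eq_zero_of_le {t : ℝ} (h : t ≤ 1) : deriv plateau t = 0 := by
  refine IsLocalMax.deriv_eq_zero (Filter.Eventually.of_forall fun s => ?_)
  rw [plateau_eq_one h]
  exact plateau_le_one s

theorem deriv_plateau_eq_zero_of_ge {t : ℝ} (h : 2 ≤ t) : deriv plateau t = 0 := by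
  refine IsLocalMin.deriv_eq_zero (Filter.Eventually.of_forall fun s => ?_)
  rw [plateau_eq_zero h]
  exact plateau_nonneg s

theorem exists_abs_deriv_plateau_le : ∃ C : ℝ, 0 < C ∧ ∀ t, |deriv plateau t| ≤ C := by
  obtain ⟨C, hC⟩ := (isCompact_Icc (a := (1 : ℝ)) (b := 2)).exists_bound_of_continuousOn
    continuous_deriv_plateau.continuousOn
  refine ⟨max C 1, by positivity, fun t => ?_⟩
  rcases le_total t 1 with h | h
  · rw [deriv_plateau_eq_zero_of_le h]; simp
  rcases le_total t 2 with h' | h'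
  · exact (hC t ⟨h, h'⟩).trans (le_max_left _ _)
  · rw [deriv_plateau_eq_zero_of_ge h']; simp

/-! ### The divergence theorem on the whole space and the Gaussian measure -/

section Divergence

variable {ι : Type*} [Fintype ι]

/-- A differentiable compactly supported vector field with integrable divergence has divergence
of integral zero. -/
theorem integral_divergence_eq_zero_of_bounded_support [DecidableEq ι]
    (f : ι → (ι → ℝ) → ℝ) (f' : ι → (ι → ℝ) → (ι → ℝ) →L[ℝ] ℝ)
    (hf : ∀ i x, HasFDerivAt (f i) (f' i x) x) {R : ℝ} (hR : 0 < R)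
    (hsupp : ∀ x i, R ≤ |x i| → ∀ j, f j x = 0)
    (hint : Integrable (fun x => ∑ i, f' i x (Pi.single i 1)) (volume : Measure (ι → ℝ))) :
    ∫ x, ∑ i, f' i x (Pi.single i 1) = 0 := by
  rcases isEmpty_or_nonempty ι with hι | hι
  · simp
  obtain ⟨N, hN⟩ : ∃ N, Fintype.card ι = N + 1 :=
    ⟨Fintype.card ι - 1, (Nat.succ_pred_eq_of_pos Fintype.card_pos).symm⟩
  let e : ι ≃ Fin (N + 1) := (Fintype.equivFin ι).trans (finCongr hN)
  let eL : (ι → ℝ) ≃L[ℝ] (Fin (N + 1) → ℝ) :=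
    (LinearEquiv.funCongrLeft ℝ ℝ e.symm).toContinuousLinearEquiv
  have heL : ∀ x j, eL x j = x (e.symm j) := fun x j => rfl
  have heLs : ∀ y i, eL.symm y i = y (e i) := by
    intro y i
    have := heL (eL.symm y) (e i)
    rw [eL.apply_symm_apply] at this
    simpa using this.symm
  have hmp : MeasurePreserving eL volume volume := by
    have := volume_measurePreserving_piCongrLeft (fun _ : Fin (N + 1) => ℝ) e
    convert this using 1
    ext x j
    obtain ⟨i, rfl⟩ := e.surjective j
    rw [MeasurableEquiv.piCongrLeft_apply_apply, heL]
    simp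
  have hsingle : ∀ j, eL.symm (Pi.single j 1) = Pi.single (e.symm j) 1 := by
    intro j
    ext i
    rw [heLs]
    by_cases h : i = e.symm j
    · subst h; simp
    · have : e i ≠ j := fun h' => h (by simp [← h'])
      simp [h, this]
  have key := integral_divergence_of_hasFDerivAt_off_countable_of_equiv (E := ℝ) eL
    (by
      intro x y
      refine ⟨fun h i => ?_, fun h j => ?_⟩
      · simpa [heL] using h (e i)
      · rw [heL, heL]; exact h _)
    hmp (fun j => f (e.symm j)) (fun j => f' (e.symm j)) ∅ Set.countable_empty
    (fun _ => -R) (fun _ => R) (fun _ => by simp [hR.le])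
    (fun j x _ => (hf _ x).continuousAt.continuousWithinAt)
    (fun x _ j => hf _ x) (fun x => ∑ i, f' i x (Pi.single i 1))
    (by
      intro x
      rw [← e.symm.sum_comp]
      exact Finset.sum_congr rfl fun j _ => by rw [hsingle])
    hint.integrableOn
  have hzero : ∀ x ∉ Set.Icc (fun _ : ι => -R) (fun _ => R), ∑ i, f' i x (Pi.single i 1) = 0 := by
    intro x hx
    obtain ⟨i, hi⟩ : ∃ i, R < |x i| := by
      by_contra! h
      exact hx ⟨fun i => (abs_le.1 (h i)).1, fun i => (abs_le.1 (h i)).2⟩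
    refine Finset.sum_eq_zero fun j _ => ?_
    have hev : f j =ᶠ[𝓝 x] fun _ => 0 := by
      have : ∀ᶠ y in 𝓝 x, R < |y i| :=
        ((continuous_apply i).abs.tendsto x).eventually (lt_mem_nhds hi)
      exact this.mono fun y hy => hsupp y i hy.le j
    have h0 : HasFDerivAt (f j) (0 : (ι → ℝ) →L[ℝ] ℝ) x :=
      (hasFDerivAt_const (0 : ℝ) x).congr_of_eventuallyEq hev
    rw [(hf j x).unique h0]; rfl
  rw [setIntegral_eq_integral_of_forall_compl_eq_zero hzero] at key
  rw [key]
  refine Finset.sum_eq_zero fun j _ => ?_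
  have h1 : ∀ c : ℝ, |c| = R → ∀ x, f (e.symm j) (eL.symm (j.insertNth c x)) = 0 := by
    intro c hc x
    refine hsupp _ (e.symm j) ?_ _
    rw [heLs]
    simp [hc]
  have h2 : eL (fun _ => R) j = R := rfl
  have h3 : eL (fun _ => -R) j = -R := rfl
  simp only [h2, h3]
  rw [integral_congr_ae (Filter.Eventually.of_forall (h1 R (abs_of_pos hR))),
    integral_congr_ae (Filter.Eventually.of_forall (h1 (-R) (by rw [abs_neg, abs_of_pos hR])))]
  simp

/-- A differentiable integrable vector field with integrable divergence has divergence
of integral zero. -/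
theorem integral_divergence_eq_zero [DecidableEq ι]
    (f : ι → (ι → ℝ) → ℝ) (f' : ι → (ι → ℝ) → (ι → ℝ) →L[ℝ] ℝ)
    (hf : ∀ i x, HasFDerivAt (f i) (f' i x) x) (hfi : ∀ i, Integrable (f i))
    (hint : Integrable (fun x => ∑ i, f' i x (Pi.single i 1)) (volume : Measure (ι → ℝ))) :
    ∫ x, ∑ i, f' i x (Pi.single i 1) = 0 := by
  obtain ⟨C, hC0, hC⟩ := exists_abs_deriv_plateau_le
  let q : (ι → ℝ) → ℝ := fun x => ∑ i, x i ^ 2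
  let q' : (ι → ℝ) → (ι → ℝ) →L[ℝ] ℝ := fun x =>
    ∑ i, (2 * x i) • (ContinuousLinearMap.proj i : (ι → ℝ) →L[ℝ] ℝ)
  have hq : ∀ x, HasFDerivAt q (q' x) x := by
    intro x
    refine HasFDerivAt.fun_sum fun i _ => ?_
    have h := ((ContinuousLinearMap.proj i : (ι → ℝ) →L[ℝ] ℝ).hasFDerivAt (x := x)).pow 2
    simpa using h
  have hq1 : ∀ x i, q' x (Pi.single i 1) = 2 * x i := by
    intro x i
    simp [q', Pi.single_apply]
  have hqi : ∀ x i, x i ^ 2 ≤ q x := fun x i =>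
    Finset.single_le_sum (f := fun i => x i ^ 2) (fun j _ => sq_nonneg _) (Finset.mem_univ i)
  -- The cutoff is 1 on the ball of radius m + 1 and 0 outside the ball of radius √2 (m + 1), so its
  -- gradient is O(1/m). The error term, gradient against the integrable field, then tends to zero.
  let c : ℕ → (ι → ℝ) → ℝ := fun m x => plateau (q x / ((m : ℝ) + 1) ^ 2)
  let c' : ℕ → (ι → ℝ) → (ι → ℝ) →L[ℝ] ℝ := fun m x =>
    deriv plateau (q x / ((m : ℝ) + 1) ^ 2) • ((((m : ℝ) + 1) ^ 2)⁻¹ • q' x)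
  have hc : ∀ m x, HasFDerivAt (c m) (c' m x) x := by
    intro m x
    have h1 := (plateau_differentiable (q x / ((m : ℝ) + 1) ^ 2)).hasDerivAt
    have h2 : HasFDerivAt (fun x => q x / ((m : ℝ) + 1) ^ 2) ((((m : ℝ) + 1) ^ 2)⁻¹ • q' x) x := by
      simp only [div_eq_inv_mul]
      exact (hq x).const_mul _
    exact HasDerivAt.comp_hasFDerivAt (h₂ := plateau) x h1 h2
  have hcont : ∀ m, Continuous (c m) := fun m =>
    continuous_iff_continuousAt.2 fun x => (hc m x).continuousAt
  have hqc : Continuous q := continuous_iff_continuousAt.2 fun x => (hq x).continuousAt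
  have hgrad : ∀ m x i, |c' m x (Pi.single i 1)| ≤ 4 * C / ((m : ℝ) + 1) := by
    intro m x i
    have hm : (0 : ℝ) < (m : ℝ) + 1 := by positivity
    have e1 : c' m x (Pi.single i 1) =
        deriv plateau (q x / ((m : ℝ) + 1) ^ 2) * ((((m : ℝ) + 1) ^ 2)⁻¹ * (2 * x i)) := by
      simp [c', hq1]
    rw [e1]
    rcases le_total 2 (q x / ((m : ℝ) + 1) ^ 2) with h | h
    · rw [deriv_plateau_eq_zero_of_ge h]; simp; positivity
    · have h1 : |x i| ≤ 2 * ((m : ℝ) + 1) := by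
        rw [div_le_iff₀ (by positivity)] at h
        refine abs_le_of_sq_le_sq (((hqi x i).trans h).trans ?_) (by positivity)
        nlinarith
      rw [abs_mul, abs_mul, abs_of_nonneg (inv_nonneg.2 (sq_nonneg ((m : ℝ) + 1))), abs_mul,
        abs_two]
      calc |deriv plateau (q x / ((m : ℝ) + 1) ^ 2)| * ((((m : ℝ) + 1) ^ 2)⁻¹ * (2 * |x i|))
          ≤ C * ((((m : ℝ) + 1) ^ 2)⁻¹ * (2 * (2 * ((m : ℝ) + 1)))) := by
            gcongr; exact hC _
        _ = 4 * C / ((m : ℝ) + 1) := by field_simp; ring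
  have hlim : ∀ x, Tendsto (fun m => c m x) atTop (𝓝 1) := by
    intro x
    refine tendsto_const_nhds.congr' ?_
    filter_upwards [eventually_ge_atTop (Nat.ceil (q x))] with m hm
    refine (plateau_eq_one ?_).symm
    have h1 : q x ≤ m := (Nat.le_ceil _).trans (by exact_mod_cast hm)
    rw [div_le_one (by positivity)]
    nlinarith [(Nat.cast_nonneg m : (0 : ℝ) ≤ m)]
  have hc01 : ∀ m x, |c m x| ≤ 1 := fun m x => by
    rw [abs_of_nonneg (plateau_nonneg _)]; exact plateau_le_one _
  have hderiv : ∀ m i x, HasFDerivAt (fun x => c m x * f i x)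
      (c m x • f' i x + f i x • c' m x) x := fun m i x => (hc m x).mul (hf i x)
  let D : (ι → ℝ) → ℝ := fun x => ∑ i, f' i x (Pi.single i 1)
  let G : ℕ → (ι → ℝ) → ℝ := fun m x => ∑ i, f i x * c' m x (Pi.single i 1)
  have hsplit : ∀ m x, ∑ i, (c m x • f' i x + f i x • c' m x) (Pi.single i 1) =
      c m x * D x + G m x := by
    intro m x
    simp [D, G, Finset.sum_add_distrib, Finset.mul_sum]
  have hGm : ∀ m, AEStronglyMeasurable (G m) := by
    intro m
    refine Finset.aestronglyMeasurable_fun_sum _ fun i _ => (hfi i).1.mul ?_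
    have : (fun x => c' m x (Pi.single i 1)) = fun x =>
        deriv plateau (q x / ((m : ℝ) + 1) ^ 2) * ((((m : ℝ) + 1) ^ 2)⁻¹ * (2 * x i)) := by
      ext x; simp [c', hq1]
    rw [this]
    exact Continuous.aestronglyMeasurable
      ((continuous_deriv_plateau.comp (hqc.div_const _)).mul (by fun_prop))
  have hGb : ∀ m x, ‖G m x‖ ≤ 4 * C / ((m : ℝ) + 1) * ∑ i, |f i x| := by
    intro m x
    rw [Finset.mul_sum]
    refine (norm_sum_le _ _).trans (Finset.sum_le_sum fun i _ => ?_)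
    rw [norm_mul, mul_comm, Real.norm_eq_abs, Real.norm_eq_abs]
    exact mul_le_mul_of_nonneg_right (hgrad m x i) (abs_nonneg _)
  have hsumi : Integrable (fun x => ∑ i, |f i x|) (volume : Measure (ι → ℝ)) :=
    integrable_finsetSum _ fun i _ => (hfi i).abs
  have hGi : ∀ m, Integrable (G m) := fun m =>
    (hsumi.const_mul _).mono' (hGm m) (Filter.Eventually.of_forall (hGb m))
  have hcD : ∀ m, Integrable (fun x => c m x * D x) := fun m =>
    hint.bdd_mul (hcont m).aestronglyMeasurable (Filter.Eventually.of_forall (hc01 m))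
  have hzero : ∀ m, ∫ x, c m x * D x + G m x = 0 := by
    intro m
    have := integral_divergence_eq_zero_of_bounded_support (fun i x => c m x * f i x)
      (fun i x => c m x • f' i x + f i x • c' m x) (fun i x => hderiv m i x)
      (R := 2 * ((m : ℝ) + 1)) (by positivity)
      (by
        intro x i hx j
        have h2 : c m x = 0 := by
          refine plateau_eq_zero ?_
          rw [le_div_iff₀ (by positivity)]
          refine le_trans ?_ (hqi x i)
          rw [← sq_abs (x i)]
          have : (0 : ℝ) < (m : ℝ) + 1 := by positivity
          nlinarith
        rw [h2, zero_mul])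
      (by simp only [hsplit]; exact (hcD m).add (hGi m))
    simpa only [hsplit] using this
  have hz : ∀ m, ∫ x, c m x * D x = - ∫ x, G m x := by
    intro m
    have := hzero m
    rw [integral_add (hcD m) (hGi m)] at this
    linarith
  have l1 : Tendsto (fun m => ∫ x, c m x * D x) atTop (𝓝 (∫ x, D x)) := by
    refine tendsto_integral_of_dominated_convergence (fun x => ‖D x‖) (fun m => (hcD m).1)
      hint.norm (fun m => Filter.Eventually.of_forall fun x => ?_)
      (Filter.Eventually.of_forall fun x => ?_)
    · rw [norm_mul]
      exact mul_le_of_le_one_left (norm_nonneg _) (hc01 m x)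
    · simpa using (hlim x).mul_const (D x)
  have l2 : Tendsto (fun m => ∫ x, G m x) atTop (𝓝 0) := by
    refine squeeze_zero_norm (a := fun m : ℕ => 4 * C / ((m : ℝ) + 1) * ∫ x, ∑ i, |f i x|)
      (fun m => ?_) ?_
    · rw [← integral_const_mul]
      exact norm_integral_le_of_norm_le (hsumi.const_mul _) (Filter.Eventually.of_forall (hGb m))
    · have : Tendsto (fun m : ℕ => 4 * C / ((m : ℝ) + 1)) atTop (𝓝 0) :=
        tendsto_const_nhds.div_atTop
          (tendsto_natCast_atTop_atTop.atTop_add tendsto_const_nhds)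
      simpa using this.mul_const (∫ x, ∑ i, |f i x|)
  have l3 : Tendsto (fun m => ∫ x, c m x * D x) atTop (𝓝 0) := by
    simp only [hz]; simpa using l2.neg
  exact tendsto_nhds_unique l1 l3

/-- The standard Gaussian measure on `ι → ℝ`. -/
def stdGaussianPi (ι : Type*) [Fintype ι] : Measure (ι → ℝ) :=
  Measure.pi fun _ => gaussianReal 0 1

instance (ι : Type*) [Fintype ι] : IsProbabilityMeasure (stdGaussianPi ι) := by
  unfold stdGaussianPi; infer_instance

/-- The density of `stdGaussianPi`. -/
def gaussianDensity (z : ι → ℝ) : ℝ := ∏ i, gaussianPDFReal 0 1 (z i)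

theorem gaussianDensity_pos (z : ι → ℝ) : 0 < gaussianDensity z :=
  Finset.prod_pos fun _ _ => gaussianPDFReal_pos _ _ _ one_ne_zero

theorem measurable_gaussianDensity : Measurable (gaussianDensity : (ι → ℝ) → ℝ) :=
  Finset.measurable_prod _ fun i _ => (measurable_gaussianPDFReal 0 1).comp (measurable_pi_apply i)

theorem stdGaussianPi_eq_withDensity :
    stdGaussianPi ι = (volume : Measure (ι → ℝ)).withDensity
      (fun z => ENNReal.ofReal (gaussianDensity z)) := by
  refine Measure.pi_eq fun s hs => ?_
  rw [withDensity_apply _ (MeasurableSet.univ_pi hs), volume_pi, Measure.restrict_pi_pi]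
  rw [← ofReal_integral_eq_lintegral_ofReal]
  · unfold gaussianDensity
    rw [integral_fintype_prod_eq_prod, ENNReal.ofReal_prod_of_nonneg]
    · refine Finset.prod_congr rfl fun i _ => ?_
      rw [gaussianReal_apply_eq_integral _ one_ne_zero]
    · intro i _
      exact integral_nonneg fun x => gaussianPDFReal_nonneg _ _ _
  · exact Integrable.fintype_prod fun i => (integrable_gaussianPDFReal 0 1).restrict
  · exact Filter.Eventually.of_forall fun z => (gaussianDensity_pos z).le

theorem integral_stdGaussianPi (f : (ι → ℝ) → ℝ) :
    ∫ z, f z ∂(stdGaussianPi ι) = ∫ z, gaussianDensity z * f z := by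
  rw [stdGaussianPi_eq_withDensity, integral_withDensity_eq_integral_toReal_smul
    measurable_gaussianDensity.ennreal_ofReal (by simp)]
  simp [ENNReal.toReal_ofReal (gaussianDensity_pos _).le]

theorem integrable_stdGaussianPi_iff (f : (ι → ℝ) → ℝ) :
    Integrable f (stdGaussianPi ι) ↔ Integrable (fun z => gaussianDensity z * f z) := by
  rw [stdGaussianPi_eq_withDensity, integrable_withDensity_iff_integrable_smul'
    measurable_gaussianDensity.ennreal_ofReal (by simp)]
  simp [ENNReal.toReal_ofReal (gaussianDensity_pos _).le]

theorem hasFDerivAt_gaussianDensity (z : ι → ℝ) :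
    HasFDerivAt gaussianDensity
      (∑ i, (-(z i * gaussianDensity z)) • (ContinuousLinearMap.proj i : (ι → ℝ) →L[ℝ] ℝ)) z := by
  classical
  have h1 : ∀ t : ℝ, HasDerivAt (gaussianPDFReal 0 1) (-t * gaussianPDFReal 0 1 t) t := by
    intro t
    have h : HasDerivAt (fun x : ℝ => -(x - 0) ^ 2 / (2 * ((1 : NNReal) : ℝ))) (-t) t := by
      have := (((hasDerivAt_id t).sub_const 0).pow 2).neg.div_const (2 * ((1 : NNReal) : ℝ))
      convert! this using 1
      simp; ring
    have := (h.exp).const_mul ((Real.sqrt (2 * Real.pi * (1 : NNReal)))⁻¹)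
    unfold gaussianPDFReal
    convert! this using 1
    ring
  have h2 : ∀ i ∈ (Finset.univ : Finset ι), HasFDerivAt (fun z : ι → ℝ => gaussianPDFReal 0 1 (z i))
      ((-(z i) * gaussianPDFReal 0 1 (z i)) • (ContinuousLinearMap.proj i : (ι → ℝ) →L[ℝ] ℝ)) z :=
    fun i _ => HasDerivAt.comp_hasFDerivAt (h₂ := gaussianPDFReal 0 1) z (h1 (z i))
      (ContinuousLinearMap.proj i : (ι → ℝ) →L[ℝ] ℝ).hasFDerivAt
  have h3 := HasFDerivAt.finsetProd h2
  unfold gaussianDensity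
  convert! h3 using 1
  refine Finset.sum_congr rfl fun i hi => ?_
  rw [smul_smul, ← Finset.mul_prod_erase _ _ hi]
  congr 1
  ring

/-- **Stein's identity** for vector fields that are merely differentiable. -/
theorem integral_stein [DecidableEq ι]
    (f : ι → (ι → ℝ) → ℝ) (f' : ι → (ι → ℝ) → (ι → ℝ) →L[ℝ] ℝ)
    (hf : ∀ i x, HasFDerivAt (f i) (f' i x) x) {B : ℝ} (hB : ∀ i x, |f i x| ≤ B)
    (hint : Integrable (fun x => ∑ i, f' i x (Pi.single i 1)) (stdGaussianPi ι)) :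
    ∫ x, ∑ i, f' i x (Pi.single i 1) ∂(stdGaussianPi ι) =
      ∫ x, ∑ i, x i * f i x ∂(stdGaussianPi ι) := by
  have hcont : ∀ i, Continuous (f i) := fun i =>
    continuous_iff_continuousAt.2 fun x => (hf i x).continuousAt
  have hfi : ∀ i, Integrable (f i) (stdGaussianPi ι) := fun i =>
    Integrable.of_bound (hcont i).aestronglyMeasurable B (Filter.Eventually.of_forall (hB i))
  have hxi : ∀ i, Integrable (fun x : ι → ℝ => x i) (stdGaussianPi ι) := fun i =>
    integrable_eval (i := i) (X := fun _ => ℝ) (IsGaussian.integrable_id)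
  have hxf : Integrable (fun x => ∑ i, x i * f i x) (stdGaussianPi ι) :=
    integrable_finsetSum _ fun i _ =>
      (hxi i).mul_bdd (hcont i).aestronglyMeasurable (Filter.Eventually.of_forall (hB i))
  let g' : ι → (ι → ℝ) → (ι → ℝ) →L[ℝ] ℝ := fun i x => gaussianDensity x • f' i x + f i x •
    ∑ j, (-(x j * gaussianDensity x)) • (ContinuousLinearMap.proj j : (ι → ℝ) →L[ℝ] ℝ)
  have e : ∀ x, ∑ i, g' i x (Pi.single i 1) = gaussianDensity x *
      (∑ i, f' i x (Pi.single i 1) - ∑ i, x i * f i x) := by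
    intro x
    simp only [g', ← Finset.sum_sub_distrib, Finset.mul_sum]
    refine Finset.sum_congr rfl fun i _ => ?_
    simp [Pi.single_apply]
    ring
  -- Since the density ρ satisfies ∇ρ = −xρ, the field ρf has divergence ρ (div f − x·f).
  -- Boundedness of f makes both ρf and ρ x·f integrable.
  have h := integral_divergence_eq_zero (fun i x => gaussianDensity x * f i x) g'
    (fun i x => (hasFDerivAt_gaussianDensity x).mul (hf i x))
    (fun i => (integrable_stdGaussianPi_iff _).1 (hfi i))
    (by
      simp only [e]
      exact (integrable_stdGaussianPi_iff _).1 (hint.sub hxf))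
  simp only [e] at h
  rw [← integral_stdGaussianPi, integral_sub hint hxf] at h
  linarith

end Divergence

end

noncomputable section

open Filter Topology

/-! ### Spectral frames of matrices with distinct positive eigenvalues -/

section Frames

variable {r : ℕ}

/-- `S = H diag(l) Hᵗ` with `H` orthogonal and `l 0 > l 1 > ⋯ > 0`. -/
structure IsSpectralFrame (S H : Matrix (Fin r) (Fin r) ℝ) (l : Fin r → ℝ) : Prop where
  orth : Hᵀ * H = 1
  eq_mul : S = H * diagonal l * Hᵀ
  mem : l ∈ strictChamber r

/-- `S` is symmetric with distinct positive eigenvalues. -/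
def IsSimpleSpectrum (S : Matrix (Fin r) (Fin r) ℝ) : Prop := ∃ H l, IsSpectralFrame S H l

/-- The rank one projection onto the `k`-th column of an orthogonal matrix. -/
def colProj (H : Matrix (Fin r) (Fin r) ℝ) (k : Fin r) : Matrix (Fin r) (Fin r) ℝ :=
  vecMulVec (fun a => H a k) (fun a => H a k)

theorem colProj_apply (H : Matrix (Fin r) (Fin r) ℝ) (k a c : Fin r) :
    colProj H k a c = H a k * H c k := rfl

theorem strictChamber_ne {l : Fin r → ℝ} (hl : l ∈ strictChamber r) {k b : Fin r} (h : k ≠ b) :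
    l k ≠ l b := fun e => h (hl.1.injective e)

theorem mul_diagonal_mul_transpose_apply {m : ℕ} (H : Matrix (Fin m) (Fin r) ℝ) (d : Fin r → ℝ)
    (a c : Fin m) : (H * diagonal d * Hᵀ) a c = ∑ k, d k * (H a k * H c k) := by
  rw [mul_apply]
  refine Finset.sum_congr rfl fun k _ => ?_
  rw [mul_diagonal, transpose_apply]; ring

theorem mul_diagonal_mul_transpose_eq_sum (H : Matrix (Fin r) (Fin r) ℝ) (d : Fin r → ℝ) :
    H * diagonal d * Hᵀ = ∑ k, d k • colProj H k := by
  ext a c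
  rw [mul_diagonal_mul_transpose_apply, Matrix.sum_apply]
  rfl

theorem smul_one_sub_frame {H : Matrix (Fin r) (Fin r) ℝ} (hH : Hᵀ * H = 1) (d : Fin r → ℝ)
    (t : ℝ) : t • (1 : Matrix (Fin r) (Fin r) ℝ) - H * diagonal d * Hᵀ =
      H * diagonal (fun b => t - d b) * Hᵀ := by
  have h1 : H * Hᵀ = 1 := mul_eq_one_comm.1 hH
  have h2 : diagonal (fun b => t - d b) = t • (1 : Matrix (Fin r) (Fin r) ℝ) - diagonal d := by
    ext i j
    by_cases h : i = j <;> simp [h, one_apply]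
  rw [h2, Matrix.mul_sub, Matrix.sub_mul, Matrix.mul_smul, Matrix.mul_one, Matrix.smul_mul, h1]

theorem det_frame {H : Matrix (Fin r) (Fin r) ℝ} (hH : Hᵀ * H = 1) (d : Fin r → ℝ) :
    (H * diagonal d * Hᵀ).det = ∏ b, d b := by
  have h1 : H * Hᵀ = 1 := mul_eq_one_comm.1 hH
  have h2 : H.det * Hᵀ.det = 1 := by rw [← det_mul, h1, det_one]
  rw [det_mul, det_mul, det_diagonal, mul_right_comm, h2, one_mul]

/-- For orthogonal H the adjugate is det H · Hᵗ, and the two determinant factors multiply to 1. -/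
theorem adjugate_frame {H : Matrix (Fin r) (Fin r) ℝ} (hH : Hᵀ * H = 1) (d : Fin r → ℝ) :
    (H * diagonal d * Hᵀ).adjugate = H * (diagonal d).adjugate * Hᵀ := by
  have h1 : H * Hᵀ = 1 := mul_eq_one_comm.1 hH
  have e1 : H.adjugate = H.det • Hᵀ := by
    calc H.adjugate = (Hᵀ * H) * H.adjugate := by rw [hH, Matrix.one_mul]
      _ = H.det • Hᵀ := by rw [Matrix.mul_assoc, mul_adjugate, Matrix.mul_smul, Matrix.mul_one]
  have e2 : Hᵀ.adjugate = H.det • H := by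
    rw [← adjugate_transpose, e1, transpose_smul, transpose_transpose]
  have h2 : H.det * H.det = 1 := by
    have : H.det * Hᵀ.det = 1 := by rw [← det_mul, h1, det_one]
    rwa [det_transpose] at this
  rw [adjugate_mul_distrib, adjugate_mul_distrib, e1, e2]
  simp only [Matrix.smul_mul, Matrix.mul_smul, smul_smul, h2, one_smul, Matrix.mul_assoc]

namespace IsSpectralFrame

variable {S H : Matrix (Fin r) (Fin r) ℝ} {l : Fin r → ℝ}

theorem det_sub (h : IsSpectralFrame S H l) (t : ℝ) :
    (t • (1 : Matrix (Fin r) (Fin r) ℝ) - S).det = ∏ b, (t - l b) := by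
  rw [h.eq_mul, smul_one_sub_frame h.orth, det_frame h.orth]

/-- In the eigenbasis the adjugate of l_k − S is diagonal, with b-th entry ∏_{c≠b} (l_k − l_c),
which vanishes unless b = k. The right side contains no eigenvector, so the projection depends on S
alone and is as smooth as the eigenvalues. -/
theorem colProj_eq_adjugate (h : IsSpectralFrame S H l) (k : Fin r) :
    colProj H k = (∏ b ∈ Finset.univ.erase k, (l k - l b))⁻¹ •
      (l k • (1 : Matrix (Fin r) (Fin r) ℝ) - S).adjugate := by
  rw [h.eq_mul, smul_one_sub_frame h.orth, adjugate_frame h.orth, adjugate_diagonal]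
  have hne : (∏ b ∈ Finset.univ.erase k, (l k - l b)) ≠ 0 :=
    Finset.prod_ne_zero_iff.2 fun b hb =>
      sub_ne_zero.2 (strictChamber_ne h.mem (Finset.ne_of_mem_erase hb).symm)
  ext a c
  rw [Matrix.smul_apply, mul_diagonal_mul_transpose_apply, Finset.sum_eq_single k, colProj_apply,
    smul_eq_mul, ← mul_assoc, inv_mul_cancel₀ hne, one_mul]
  · intro b _ hb
    rw [Finset.prod_eq_zero (i := k) (by simp [hb.symm]) (by simp), zero_mul]
  · simp

/-- Both tuples enumerate the roots of the characteristic polynomial, and a strictly decreasing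
tuple is determined by its range. -/
theorem unique_eigenvalues {H' : Matrix (Fin r) (Fin r) ℝ} {l' : Fin r → ℝ}
    (h : IsSpectralFrame S H l) (h' : IsSpectralFrame S H' l') : l' = l := by
  refine (StrictAnti.range_inj h'.mem.1 h.mem.1).1 (Set.Subset.antisymm ?_ ?_)
  · rintro _ ⟨k, rfl⟩
    have e : ∏ b, (l' k - l b) = 0 := by
      rw [← h.det_sub, h'.det_sub]
      exact Finset.prod_eq_zero (Finset.mem_univ k) (sub_self _)
    obtain ⟨b, -, hb⟩ := Finset.prod_eq_zero_iff.1 e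
    exact ⟨b, (sub_eq_zero.1 hb).symm⟩
  · rintro _ ⟨k, rfl⟩
    have e : ∏ b, (l k - l' b) = 0 := by
      rw [← h'.det_sub, h.det_sub]
      exact Finset.prod_eq_zero (Finset.mem_univ k) (sub_self _)
    obtain ⟨b, -, hb⟩ := Finset.prod_eq_zero_iff.1 e
    exact ⟨b, (sub_eq_zero.1 hb).symm⟩

theorem unique_colProj {H' : Matrix (Fin r) (Fin r) ℝ} {l' : Fin r → ℝ}
    (h : IsSpectralFrame S H l) (h' : IsSpectralFrame S H' l') (k : Fin r) :
    colProj H' k = colProj H k := by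
  rw [h'.colProj_eq_adjugate, h.colProj_eq_adjugate, h.unique_eigenvalues h']

end IsSpectralFrame

open Classical in
/-- The ordered eigenvalues of a matrix with simple positive spectrum (otherwise `0`). -/
def eigs (S : Matrix (Fin r) (Fin r) ℝ) : Fin r → ℝ :=
  if h : IsSimpleSpectrum S then h.choose_spec.choose else 0

open Classical in
/-- The `k`-th spectral projection of a matrix with simple positive spectrum (otherwise `0`). -/
def eigenProj (S : Matrix (Fin r) (Fin r) ℝ) (k : Fin r) : Matrix (Fin r) (Fin r) ℝ :=
  if h : IsSimpleSpectrum S then colProj h.choose k else 0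

theorem IsSpectralFrame.eigs_eq {S H : Matrix (Fin r) (Fin r) ℝ} {l : Fin r → ℝ}
    (h : IsSpectralFrame S H l) : eigs S = l := by
  have hs : IsSimpleSpectrum S := ⟨H, l, h⟩
  rw [eigs, dif_pos hs]
  exact h.unique_eigenvalues hs.choose_spec.choose_spec

theorem IsSpectralFrame.eigenProj_eq {S H : Matrix (Fin r) (Fin r) ℝ} {l : Fin r → ℝ}
    (h : IsSpectralFrame S H l) (k : Fin r) : eigenProj S k = colProj H k := by
  have hs : IsSimpleSpectrum S := ⟨H, l, h⟩
  rw [eigenProj, dif_pos hs]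
  exact h.unique_colProj hs.choose_spec.choose_spec k

theorem eigs_of_not {S : Matrix (Fin r) (Fin r) ℝ} (h : ¬ IsSimpleSpectrum S) : eigs S = 0 :=
  dif_neg h

theorem eigenProj_of_not {S : Matrix (Fin r) (Fin r) ℝ} (h : ¬ IsSimpleSpectrum S) (k : Fin r) :
    eigenProj S k = 0 := by
  rw [eigenProj, dif_neg h]

/-- The spectral function `∑ d_k P_k`. -/
def spectralSum (S : Matrix (Fin r) (Fin r) ℝ) (d : Fin r → ℝ) : Matrix (Fin r) (Fin r) ℝ :=
  ∑ k, d k • eigenProj S k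

theorem IsSpectralFrame.spectralSum_eq {S H : Matrix (Fin r) (Fin r) ℝ} {l : Fin r → ℝ}
    (h : IsSpectralFrame S H l) (d : Fin r → ℝ) : spectralSum S d = H * diagonal d * Hᵀ := by
  rw [mul_diagonal_mul_transpose_eq_sum, spectralSum]
  simp only [h.eigenProj_eq]

theorem colProj_mul_colProj {H : Matrix (Fin r) (Fin r) ℝ} (hH : Hᵀ * H = 1) (k b : Fin r) :
    colProj H k * colProj H b = if k = b then colProj H k else 0 := by
  have e : (∑ x, H x k * H x b) = if k = b then 1 else 0 := by
    have := congrFun (congrFun hH k) b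
    rw [mul_apply, one_apply] at this
    simpa [transpose_apply] using this
  ext a c
  rw [mul_apply]
  simp only [colProj_apply]
  calc ∑ j, H a k * H j k * (H j b * H c b) = H a k * H c b * ∑ x, H x k * H x b := by
        rw [Finset.mul_sum]; exact Finset.sum_congr rfl fun j _ => by ring
    _ = _ := by
        rw [e]
        by_cases h : k = b
        · subst h; simp [colProj_apply]
        · simp [h]

section Simple

variable {S : Matrix (Fin r) (Fin r) ℝ}

theorem IsSimpleSpectrum.eigs_mem (h : IsSimpleSpectrum S) : eigs S ∈ strictChamber r := by
  obtain ⟨H, l, hf⟩ := h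
  rw [hf.eigs_eq]; exact hf.mem

/-- The default value `0` of `eigs` has a coordinate that is not positive, so it lies outside the
chamber. -/
theorem isSimpleSpectrum_iff_eigs_mem [NeZero r] : IsSimpleSpectrum S ↔ eigs S ∈ strictChamber r := by
  refine ⟨fun h => h.eigs_mem, fun h => ?_⟩
  by_contra hn
  rw [eigs_of_not hn] at h
  exact lt_irrefl _ (h.2 0)

theorem IsSimpleSpectrum.eigenProj_mul (h : IsSimpleSpectrum S) (k b : Fin r) :
    eigenProj S k * eigenProj S b = if k = b then eigenProj S k else 0 := by
  obtain ⟨H, l, hf⟩ := h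
  rw [hf.eigenProj_eq, hf.eigenProj_eq, colProj_mul_colProj hf.orth]

theorem IsSimpleSpectrum.eigenProj_mul_self (h : IsSimpleSpectrum S) (k : Fin r) :
    eigenProj S k * eigenProj S k = eigenProj S k := by rw [h.eigenProj_mul, if_pos rfl]

theorem IsSimpleSpectrum.eigenProj_mul_ne (h : IsSimpleSpectrum S) {k b : Fin r} (hkb : k ≠ b) :
    eigenProj S k * eigenProj S b = 0 := by rw [h.eigenProj_mul, if_neg hkb]

theorem IsSimpleSpectrum.sum_eigenProj (h : IsSimpleSpectrum S) : ∑ k, eigenProj S k = 1 := by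
  obtain ⟨H, l, hf⟩ := h
  have := mul_diagonal_mul_transpose_eq_sum H (fun _ => 1)
  rw [diagonal_one, Matrix.mul_one, mul_eq_one_comm.1 hf.orth] at this
  simp only [hf.eigenProj_eq]
  simpa using this.symm

theorem IsSimpleSpectrum.eq_sum (h : IsSimpleSpectrum S) : S = spectralSum S (eigs S) := by
  obtain ⟨H, l, hf⟩ := h
  rw [hf.spectralSum_eq, hf.eigs_eq]
  exact hf.eq_mul

theorem eigenProj_transpose (S : Matrix (Fin r) (Fin r) ℝ) (k : Fin r) :
    (eigenProj S k)ᵀ = eigenProj S k := by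
  by_cases h : IsSimpleSpectrum S
  · obtain ⟨H, l, hf⟩ := h
    rw [hf.eigenProj_eq]
    ext a c
    rw [transpose_apply, colProj_apply, colProj_apply, mul_comm]
  · rw [eigenProj_of_not h, transpose_zero]

theorem IsSimpleSpectrum.trace_eigenProj (h : IsSimpleSpectrum S) (k : Fin r) :
    (eigenProj S k).trace = 1 := by
  obtain ⟨H, l, hf⟩ := h
  rw [hf.eigenProj_eq]
  have := congrFun (congrFun hf.orth k) k
  rw [mul_apply, one_apply_eq] at this
  simpa [trace, colProj_apply, transpose_apply] using this

theorem eigenProj_diag_nonneg (S : Matrix (Fin r) (Fin r) ℝ) (k a : Fin r) :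
    0 ≤ eigenProj S k a a := by
  by_cases h : IsSimpleSpectrum S
  · obtain ⟨H, l, hf⟩ := h
    rw [hf.eigenProj_eq, colProj_apply]
    exact mul_self_nonneg _
  · rw [eigenProj_of_not h]; simp

/-- The diagonal entries are nonnegative with sum 1, and an off-diagonal entry xy is bounded by (x²
+ y²)/2. -/
theorem abs_eigenProj_le_one (S : Matrix (Fin r) (Fin r) ℝ) (k a c : Fin r) :
    |eigenProj S k a c| ≤ 1 := by
  by_cases h : IsSimpleSpectrum S
  · have hd : ∀ a, eigenProj S k a a ≤ 1 := by
      intro a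
      rw [← h.trace_eigenProj k]
      exact Finset.single_le_sum (f := fun a => eigenProj S k a a)
        (fun b _ => eigenProj_diag_nonneg S k b) (Finset.mem_univ a)
    obtain ⟨H, l, hf⟩ := h
    have ha := hd a
    have hc := hd c
    rw [hf.eigenProj_eq, colProj_apply] at ha hc ⊢
    exact abs_le.2 ⟨by nlinarith [sq_nonneg (H a k + H c k)], by nlinarith [sq_nonneg (H a k - H c k)]⟩
  · rw [eigenProj_of_not h]; simp

theorem IsSimpleSpectrum.mul_eigenProj (h : IsSimpleSpectrum S) (k : Fin r) :
    S * eigenProj S k = eigs S k • eigenProj S k := by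
  have e : S * eigenProj S k = ∑ b, (eigs S b • eigenProj S b) * eigenProj S k := by
    rw [← Finset.sum_mul]
    exact congrArg (· * eigenProj S k) h.eq_sum
  rw [e, Finset.sum_eq_single k]
  · rw [Matrix.smul_mul, h.eigenProj_mul_self]
  · intro b _ hb
    rw [Matrix.smul_mul, h.eigenProj_mul_ne hb, smul_zero]
  · simp

theorem IsSimpleSpectrum.transpose_eq (h : IsSimpleSpectrum S) : Sᵀ = S := by
  obtain ⟨H, l, hf⟩ := h
  rw [hf.eq_mul]
  simp [transpose_mul, Matrix.mul_assoc]

theorem IsSimpleSpectrum.eigenProj_mul_self_left (h : IsSimpleSpectrum S) (k : Fin r) :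
    eigenProj S k * S = eigs S k • eigenProj S k := by
  have := congrArg transpose (h.mul_eigenProj k)
  rwa [transpose_mul, transpose_smul, eigenProj_transpose, h.transpose_eq] at this

theorem IsSimpleSpectrum.trace_eq (h : IsSimpleSpectrum S) : S.trace = ∑ k, eigs S k := by
  have e : S.trace = ∑ k, (eigs S k • eigenProj S k).trace := by
    rw [← trace_sum]
    exact congrArg trace h.eq_sum
  rw [e]
  refine Finset.sum_congr rfl fun k _ => ?_
  rw [trace_smul, h.trace_eigenProj, smul_eq_mul, mul_one]

end Simple

/-- The set of matrices with simple spectrum in a compact set is closed. -/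
theorem isClosed_setOf_eigs_mem [NeZero r] {K : Set (Fin r → ℝ)} (hK : IsCompact K)
    (hKs : K ⊆ strictChamber r) : IsClosed {S : Matrix (Fin r) (Fin r) ℝ | eigs S ∈ K} := by
  have hO : IsCompact {H : Matrix (Fin r) (Fin r) ℝ | Hᵀ * H = 1} := by
    have hb : IsCompact (Set.univ.pi fun _ : Fin r => Set.univ.pi fun _ : Fin r =>
        Set.Icc (-1 : ℝ) 1) :=
      isCompact_univ_pi fun _ => isCompact_univ_pi fun _ => isCompact_Icc
    refine IsCompact.of_isClosed_subset hb (isClosed_eq (by fun_prop) continuous_const) ?_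
    intro H hH a _ k _
    have e : ∑ x, H x k * H x k = 1 := by
      have := congrFun (congrFun hH k) k
      rw [mul_apply, one_apply_eq] at this
      simpa [transpose_apply] using this
    have h2 : H a k * H a k ≤ 1 := by
      rw [← e]
      exact Finset.single_le_sum (f := fun x => H x k * H x k)
        (fun b _ => mul_self_nonneg _) (Finset.mem_univ a)
    exact ⟨by nlinarith, by nlinarith⟩
  -- The set is the continuous image of O(r) × K under (H, l) ↦ H diag(l) Hᵗ, hence compact.
  have himg := (hO.prod hK).image (f := fun q : Matrix (Fin r) (Fin r) ℝ × (Fin r → ℝ) =>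
    q.1 * diagonal q.2 * q.1ᵀ) (by fun_prop)
  convert himg.isClosed using 1
  ext S
  constructor
  · intro hS
    have hs : IsSimpleSpectrum S := isSimpleSpectrum_iff_eigs_mem.2 (hKs hS)
    obtain ⟨H, l, hf⟩ := hs
    rw [Set.mem_ofPred_eq, hf.eigs_eq] at hS
    exact ⟨(H, l), ⟨hf.orth, hS⟩, hf.eq_mul.symm⟩
  · rintro ⟨⟨H, l⟩, ⟨hH, hl⟩, rfl⟩
    have hf : IsSpectralFrame (H * diagonal l * Hᵀ) H l := ⟨hH, rfl, hKs hl⟩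
    rw [Set.mem_ofPred_eq, hf.eigs_eq]
    exact hl

/-- A symmetric matrix with `r` distinct positive roots of its characteristic polynomial
has a spectral frame. -/
theorem exists_isSpectralFrame_of_det {S : Matrix (Fin r) (Fin r) ℝ} (hS : Sᵀ = S)
    {t : Fin r → ℝ} (ht : t ∈ strictChamber r)
    (hdet : ∀ k, (t k • (1 : Matrix (Fin r) (Fin r) ℝ) - S).det = 0) :
    ∃ H, IsSpectralFrame S H t := by
  have hv : ∀ k, ∃ v : Fin r → ℝ, v ⬝ᵥ v = 1 ∧ S *ᵥ v = t k • v := by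
    intro k
    obtain ⟨v, hv0, hv⟩ := exists_mulVec_eq_zero_iff.2 (hdet k)
    have hpos : 0 < v ⬝ᵥ v := by
      refine lt_of_le_of_ne ?_ (Ne.symm fun h => hv0 (dotProduct_self_eq_zero.1 h))
      exact Finset.sum_nonneg fun i _ => mul_self_nonneg _
    refine ⟨(Real.sqrt (v ⬝ᵥ v))⁻¹ • v, ?_, ?_⟩
    · rw [smul_dotProduct, dotProduct_smul, smul_eq_mul, smul_eq_mul, ← mul_assoc, ← mul_inv,
        Real.mul_self_sqrt hpos.le, inv_mul_cancel₀ hpos.ne']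
    · rw [sub_mulVec, smul_mulVec, one_mulVec, sub_eq_zero] at hv
      rw [mulVec_smul, ← hv, smul_comm]
  choose v hv1 hv2 using hv
  have horth : ∀ k b, k ≠ b → v k ⬝ᵥ v b = 0 := by
    intro k b hkb
    have e1 : v k ⬝ᵥ (S *ᵥ v b) = t b * (v k ⬝ᵥ v b) := by
      rw [hv2, dotProduct_smul, smul_eq_mul]
    have e2 : v k ⬝ᵥ (S *ᵥ v b) = t k * (v k ⬝ᵥ v b) := by
      rw [dotProduct_mulVec, ← mulVec_transpose, hS, hv2, smul_dotProduct, smul_eq_mul]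
    have e3 : (t k - t b) * (v k ⬝ᵥ v b) = 0 := by linarith
    exact (mul_eq_zero.1 e3).resolve_left (sub_ne_zero.2 (strictChamber_ne ht hkb))
  let H : Matrix (Fin r) (Fin r) ℝ := of fun a k => v k a
  have hH : Hᵀ * H = 1 := by
    ext k b
    have : (Hᵀ * H) k b = v k ⬝ᵥ v b := rfl
    rw [this, one_apply]
    split_ifs with h
    · rw [h, hv1]
    · exact horth k b h
  refine ⟨H, hH, ?_, ht⟩
  have h1 : S * H = H * diagonal t := by
    ext a k
    rw [mul_diagonal]
    have := congrFun (hv2 k) a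
    rw [mul_comm]
    exact this
  rw [← h1, Matrix.mul_assoc, mul_eq_one_comm.1 hH, Matrix.mul_one]

end Frames

/-! ### Differentiability of simple eigenvalues and of their spectral projections -/

section Perturbation

variable {r : ℕ} {V : Type*} [NormedAddCommGroup V] [NormedSpace ℝ V]

theorem differentiableAt_prod {ι : Type*} {u : Finset ι} {f : ι → V → ℝ} {z : V}
    (hf : ∀ i ∈ u, DifferentiableAt ℝ (f i) z) : DifferentiableAt ℝ (fun z => ∏ i ∈ u, f i z) z := by
  classical
  exact (HasFDerivAt.finsetProd fun i hi => (hf i hi).hasFDerivAt).differentiableAt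

theorem differentiableAt_det {m : ℕ} {M : V → Matrix (Fin m) (Fin m) ℝ} {z : V}
    (hM : ∀ a c, DifferentiableAt ℝ (fun z => M z a c) z) :
    DifferentiableAt ℝ (fun z => (M z).det) z := by
  simp only [det_apply']
  refine DifferentiableAt.fun_sum fun σ _ => ?_
  exact (differentiableAt_prod fun i _ => hM _ _).const_mul _

theorem contDiffAt_det {m : ℕ} {M : V → Matrix (Fin m) (Fin m) ℝ} {z : V}
    (hM : ∀ a c, ContDiffAt ℝ 1 (fun z => M z a c) z) :
    ContDiffAt ℝ 1 (fun z => (M z).det) z := by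
  simp only [det_apply']
  refine ContDiffAt.sum fun σ _ => ?_
  exact contDiffAt_const.mul (contDiffAt_prod fun i _ => hM _ _)

variable [CompleteSpace V]

/-- Simple eigenvalues depend differentiably on parameters. -/
theorem exists_differentiable_eigenvalues {S : V → Matrix (Fin r) (Fin r) ℝ}
    (hS : ∀ a c, ContDiff ℝ 1 (fun z => S z a c)) (hsymm : ∀ z, (S z)ᵀ = S z)
    {z : V} (hz : IsSimpleSpectrum (S z)) :
    ∃ t : V → Fin r → ℝ, DifferentiableAt ℝ t z ∧ ∀ᶠ y in 𝓝 z, ∃ H, IsSpectralFrame (S y) H (t y) := by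
  obtain ⟨H, l, hf⟩ := hz
  -- The implicit function theorem is applied to the characteristic polynomial det(t − S(z)), once
  -- at each root l_k.
  let f : V × ℝ → ℝ := fun q => (q.2 • (1 : Matrix (Fin r) (Fin r) ℝ) - S q.1).det
  have hfc : ∀ u, ContDiffAt ℝ 1 f u := by
    intro u
    refine contDiffAt_det fun a c => ?_
    simp only [Matrix.sub_apply, Matrix.smul_apply, smul_eq_mul]
    exact (contDiffAt_snd.mul contDiffAt_const).sub (((hS a c).contDiffAt).comp u contDiffAt_fst)
  have hinv : ∀ k, (fderiv ℝ f (z, l k) ∘L .inr ℝ V ℝ).IsInvertible := by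
    intro k
    have h1 : HasFDerivAt (fun t : ℝ => f (z, t)) (fderiv ℝ f (z, l k) ∘L .inr ℝ V ℝ) (l k) := by
      have hg : HasFDerivAt f (fderiv ℝ f (z, l k)) (z, l k) :=
        ((hfc (z, l k)).differentiableAt one_ne_zero).hasFDerivAt
      exact HasFDerivAt.comp (l k) hg (hasFDerivAt_prodMk_right z (l k))
    -- The derivative in t at a simple root is the product of the gaps to the other roots, hence
    -- nonzero.
    have h2 : HasDerivAt (fun t : ℝ => f (z, t)) (∏ b ∈ Finset.univ.erase k, (l k - l b)) (l k) := by
      have : (fun t : ℝ => f (z, t)) = fun t => ∏ b, (t - l b) := by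
        ext t; exact hf.det_sub t
      rw [this]
      have h3 := HasDerivAt.fun_finsetProd (u := Finset.univ) (f := fun b (t : ℝ) => t - l b)
        (f' := fun _ => 1) (x := l k) (fun b _ => (hasDerivAt_id (l k)).sub_const (l b))
      convert! h3 using 1
      rw [Finset.sum_eq_single k]
      · simp
      · intro b _ hb
        rw [Finset.prod_eq_zero (i := k) (by simp [hb.symm]) (sub_self _), zero_smul]
      · simp
    have hne : (∏ b ∈ Finset.univ.erase k, (l k - l b)) ≠ 0 :=
      Finset.prod_ne_zero_iff.2 fun b hb =>
        sub_ne_zero.2 (strictChamber_ne hf.mem (Finset.ne_of_mem_erase hb).symm)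
    have h3 := h1.unique h2.hasFDerivAt
    rw [h3]
    refine ⟨ContinuousLinearEquiv.unitsEquivAut ℝ (Units.mk0 _ hne), ?_⟩
    ext
    simp
  let t : V → Fin r → ℝ := fun y k => (hfc (z, l k)).implicitFunction one_ne_zero (hinv k) y
  have ht0 : t z = l := by
    ext k
    exact (hfc (z, l k)).implicitFunction_apply_self one_ne_zero (hinv k)
  have htd : DifferentiableAt ℝ t z := differentiableAt_pi.2 fun k =>
    ((hfc (z, l k)).hasStrictFDerivAt_implicitFunction one_ne_zero (hinv k)).differentiableAt
  refine ⟨t, htd, ?_⟩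
  have hev1 : ∀ᶠ y in 𝓝 z, ∀ k, f (y, t y k) = 0 := by
    refine eventually_all.2 fun k => ?_
    have := (hfc (z, l k)).eventually_apply_implicitFunction one_ne_zero (hinv k)
    filter_upwards [this] with y hy
    refine hy.trans ?_
    change (l k • (1 : Matrix (Fin r) (Fin r) ℝ) - S z).det = 0
    rw [hf.det_sub]
    exact Finset.prod_eq_zero (Finset.mem_univ k) (sub_self _)
  have hcont : ∀ k, ContinuousAt (fun y => t y k) z := fun k =>
    (continuous_apply k).continuousAt.comp htd.continuousAt
  -- By continuity the implicit roots stay positive and ordered near z. They are then r distinct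
  -- roots of a polynomial of degree r, that is, the whole ordered spectrum.
  have hev2 : ∀ᶠ y in 𝓝 z, ∀ k, 0 < t y k := eventually_all.2 fun k =>
    (hcont k).eventually (lt_mem_nhds (by simpa only [ht0] using hf.mem.2 k))
  have hev3 : ∀ᶠ y in 𝓝 z, ∀ k b, k < b → t y b < t y k := by
    refine eventually_all.2 fun k => eventually_all.2 fun b => ?_
    by_cases hkb : k < b
    · have := (hcont b).eventually_lt (hcont k) (by simpa only [ht0] using hf.mem.1 hkb)
      exact this.mono fun y hy _ => hy
    · exact Eventually.of_forall fun y h => absurd h hkb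
  filter_upwards [hev1, hev2, hev3] with y h1 h2 h3
  exact exists_isSpectralFrame_of_det (hsymm y) ⟨fun k b hkb => h3 k b hkb, h2⟩ h1

theorem eventually_isSimpleSpectrum {S : V → Matrix (Fin r) (Fin r) ℝ}
    (hS : ∀ a c, ContDiff ℝ 1 (fun z => S z a c)) (hsymm : ∀ z, (S z)ᵀ = S z)
    {z : V} (hz : IsSimpleSpectrum (S z)) :
    ∀ᶠ y in 𝓝 z, IsSimpleSpectrum (S y) := by
  obtain ⟨t, -, ht⟩ := exists_differentiable_eigenvalues hS hsymm hz
  exact ht.mono fun y ⟨H, hH⟩ => ⟨H, _, hH⟩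

theorem differentiableAt_eigs {S : V → Matrix (Fin r) (Fin r) ℝ}
    (hS : ∀ a c, ContDiff ℝ 1 (fun z => S z a c)) (hsymm : ∀ z, (S z)ᵀ = S z)
    {z : V} (hz : IsSimpleSpectrum (S z)) :
    DifferentiableAt ℝ (fun y => eigs (S y)) z := by
  obtain ⟨t, htd, ht⟩ := exists_differentiable_eigenvalues hS hsymm hz
  exact htd.congr_of_eventuallyEq (ht.mono fun y ⟨H, hH⟩ => hH.eigs_eq)

/-- By `colProj_eq_adjugate` the projection is a rational function of the eigenvalues and the
entries, with a denominator made of eigenvalue gaps. -/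
theorem differentiableAt_eigenProj {S : V → Matrix (Fin r) (Fin r) ℝ}
    (hS : ∀ a c, ContDiff ℝ 1 (fun z => S z a c)) (hsymm : ∀ z, (S z)ᵀ = S z)
    {z : V} (hz : IsSimpleSpectrum (S z))
    (k a c : Fin r) :
    DifferentiableAt ℝ (fun y => eigenProj (S y) k a c) z := by
  have hd := differentiableAt_pi.1 (differentiableAt_eigs hS hsymm hz)
  have hev := eventually_isSimpleSpectrum hS hsymm hz
  have : (fun y => eigenProj (S y) k a c) =ᶠ[𝓝 z] fun y =>
      (∏ b ∈ Finset.univ.erase k, (eigs (S y) k - eigs (S y) b))⁻¹ *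
        (eigs (S y) k • (1 : Matrix (Fin r) (Fin r) ℝ) - S y).adjugate a c := by
    filter_upwards [hev] with y hy
    obtain ⟨H, l, hf⟩ := hy
    rw [hf.eigenProj_eq, hf.colProj_eq_adjugate, hf.eigs_eq, Matrix.smul_apply, smul_eq_mul]
  refine DifferentiableAt.congr_of_eventuallyEq ?_ this
  refine DifferentiableAt.mul (DifferentiableAt.inv ?_ ?_) ?_
  · exact differentiableAt_prod fun b _ => (hd k).fun_sub (hd b)
  · exact Finset.prod_ne_zero_iff.2 fun b hb =>
      sub_ne_zero.2 (strictChamber_ne hz.eigs_mem (Finset.ne_of_mem_erase hb).symm)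
  · simp only [adjugate_apply]
    refine differentiableAt_det fun i j => ?_
    by_cases hi : i = c
    · subst hi
      simp
    · simp only [updateRow_ne hi, Matrix.sub_apply, Matrix.smul_apply, smul_eq_mul]
      exact ((hd k).mul_const _).sub ((hS i j).differentiable one_ne_zero z)

end Perturbation

end

noncomputable section

open Filter Topology

/-! ### Entrywise derivatives of matrix-valued curves -/

section EntryDeriv

/-- Entrywise derivative of a matrix-valued curve. -/
def HasEntryDerivAt {m n : Type*} (M : ℝ → Matrix m n ℝ) (M' : Matrix m n ℝ) (t : ℝ) : Prop :=
  ∀ i j, HasDerivAt (fun s => M s i j) (M' i j) t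

variable {l m n : Type*} {t : ℝ}

theorem HasEntryDerivAt.mul [Fintype m] {M : ℝ → Matrix l m ℝ} {N : ℝ → Matrix m n ℝ}
    {M' : Matrix l m ℝ} {N' : Matrix m n ℝ}
    (hM : HasEntryDerivAt M M' t) (hN : HasEntryDerivAt N N' t) :
    HasEntryDerivAt (fun s => M s * N s) (M' * N t + M t * N') t := by
  intro i j
  have h : HasDerivAt (fun s => ∑ k, M s i k * N s k j)
      (∑ k, (M' i k * N t k j + M t i k * N' k j)) t :=
    HasDerivAt.fun_sum fun k _ => (hM i k).mul (hN k j)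
  rw [Finset.sum_add_distrib] at h
  exact h

theorem HasEntryDerivAt.transpose {M : ℝ → Matrix l m ℝ} {M' : Matrix l m ℝ}
    (hM : HasEntryDerivAt M M' t) : HasEntryDerivAt (fun s => (M s)ᵀ) M'ᵀ t :=
  fun i j => hM j i

theorem hasEntryDerivAt_const (M : Matrix l m ℝ) : HasEntryDerivAt (fun _ => M) 0 t :=
  fun _ _ => hasDerivAt_const _ _

theorem HasEntryDerivAt.smul {c : ℝ → ℝ} {c' : ℝ} {M : ℝ → Matrix l m ℝ} {M' : Matrix l m ℝ}
    (hc : HasDerivAt c c' t) (hM : HasEntryDerivAt M M' t) :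
    HasEntryDerivAt (fun s => c s • M s) (c' • M t + c t • M') t :=
  fun i j => hc.mul (hM i j)

theorem HasEntryDerivAt.sum {ι : Type*} {u : Finset ι} {M : ι → ℝ → Matrix l m ℝ}
    {M' : ι → Matrix l m ℝ} (hM : ∀ k ∈ u, HasEntryDerivAt (M k) (M' k) t) :
    HasEntryDerivAt (fun s => ∑ k ∈ u, M k s) (∑ k ∈ u, M' k) t := by
  intro i j
  simp only [Matrix.sum_apply]
  exact HasDerivAt.fun_sum fun k hk => hM k hk i j

theorem HasEntryDerivAt.unique {M : ℝ → Matrix l m ℝ} {M' N' : Matrix l m ℝ}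
    (hM : HasEntryDerivAt M M' t) (hN : HasEntryDerivAt M N' t) : M' = N' := by
  ext i j
  exact (hM i j).unique (hN i j)

theorem HasEntryDerivAt.congr {M N : ℝ → Matrix l m ℝ} {M' : Matrix l m ℝ}
    (hM : HasEntryDerivAt M M' t) (h : ∀ᶠ s in 𝓝 t, N s = M s) : HasEntryDerivAt N M' t :=
  fun i j => (hM i j).congr_of_eventuallyEq (h.mono fun _ hs => congrFun (congrFun hs i) j)

end EntryDeriv

/-! ### First order perturbation formulas -/

section EigenDeriv

variable {r : ℕ} {S : ℝ → Matrix (Fin r) (Fin r) ℝ} {E : Matrix (Fin r) (Fin r) ℝ}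
  {l' : Fin r → ℝ} {P' : Fin r → Matrix (Fin r) (Fin r) ℝ} {t : ℝ}

/-- First order perturbation of eigenvalues and spectral projections. -/
theorem eigen_perturbation
    (hS : HasEntryDerivAt S E t) (hs : ∀ᶠ s in 𝓝 t, IsSimpleSpectrum (S s))
    (hl : ∀ k, HasDerivAt (fun s => eigs (S s) k) (l' k) t)
    (hP : ∀ k, HasEntryDerivAt (fun s => eigenProj (S s) k) (P' k) t) (k : Fin r) :
    l' k = (eigenProj (S t) k * E).trace ∧
    P' k = ∑ b ∈ Finset.univ.erase k, (eigs (S t) k - eigs (S t) b)⁻¹ •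
      (eigenProj (S t) b * E * eigenProj (S t) k + eigenProj (S t) k * E * eigenProj (S t) b) := by
  have h0 : IsSimpleSpectrum (S t) := hs.self_of_nhds
  set P := eigenProj (S t) with hPdef
  set l := eigs (S t) with hldef
  have hE : Eᵀ = E := by
    refine hS.transpose.unique (hS.congr ?_)
    exact hs.mono fun s h => h.transpose_eq
  have hPt : ∀ k, (P' k)ᵀ = P' k := fun k => by
    refine (hP k).transpose.unique ((hP k).congr ?_)
    exact Eventually.of_forall fun s => eigenProj_transpose _ _
  -- The whole proof rests on differentiating S P_k = l_k P_k and P_k² = P_k. Multiplying the first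
  -- on the left by P_k cancels the terms in P_k' and leaves P_k E P_k = l_k' P_k, whose trace is
  -- the eigenvalue formula.
  have e1 : E * P k + S t * P' k = l' k • P k + l k • P' k := by
    refine (hS.mul (hP k)).unique ((HasEntryDerivAt.smul (hl k) (hP k)).congr ?_)
    exact hs.mono fun s h => h.mul_eigenProj k
  have e2 : P' k * P k + P k * P' k = P' k := by
    refine ((hP k).mul (hP k)).unique ((hP k).congr ?_)
    exact hs.mono fun s h => h.eigenProj_mul_self k
  have hPS : ∀ b, P b * S t = l b • P b := fun b => h0.eigenProj_mul_self_left b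
  constructor
  · have e3 := congrArg (fun M => P k * M) e1
    simp only [Matrix.mul_add, ← Matrix.mul_assoc, hPS, Matrix.mul_smul, Matrix.smul_mul] at e3
    rw [h0.eigenProj_mul_self] at e3
    have e4 := congrArg trace (add_right_cancel e3)
    rw [trace_smul, h0.trace_eigenProj, trace_mul_comm, ← Matrix.mul_assoc,
      h0.eigenProj_mul_self] at e4
    simpa using e4.symm
  -- Multiplying instead by P_b with b ≠ k kills l_k' P_k and determines the block P_b P_k' up to
  -- the gap l_k − l_b.
  · have e5 : ∀ b, b ≠ k → P b * P' k = (l k - l b)⁻¹ • (P b * E * P k) := by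
      intro b hb
      have e3 := congrArg (fun M => P b * M) e1
      simp only [Matrix.mul_add, ← Matrix.mul_assoc, hPS, Matrix.mul_smul, Matrix.smul_mul] at e3
      rw [h0.eigenProj_mul_ne hb, smul_zero, zero_add] at e3
      have hne : l k - l b ≠ 0 := sub_ne_zero.2 (strictChamber_ne h0.eigs_mem hb.symm)
      have e4 : P b * E * P k = (l k - l b) • (P b * P' k) := by
        rw [sub_smul, ← e3]; abel
      rw [e4, smul_smul, inv_mul_cancel₀ hne, one_smul]
    -- Sandwiching P_k' P_k + P_k P_k' = P_k' between copies of P_k gives 2 P_k P_k' P_k = P_k P_k'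
    -- P_k, so the diagonal block vanishes.
    have e6 : P k * (P' k * P k) = 0 := by
      have e3 := congrArg (fun M => P k * M * P k) e2
      simp only [Matrix.mul_add, Matrix.add_mul] at e3
      have q1 : P k * (P' k * P k) * P k = P k * P' k * P k := by
        rw [Matrix.mul_assoc, Matrix.mul_assoc (P' k), h0.eigenProj_mul_self, Matrix.mul_assoc]
      have q2 : P k * (P k * P' k) * P k = P k * P' k * P k := by
        rw [← Matrix.mul_assoc (P k) (P k), h0.eigenProj_mul_self]
      rw [q1, q2] at e3
      have := add_eq_left.1 e3
      rwa [Matrix.mul_assoc] at this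
    have e7 : P' k * P k = ∑ b ∈ Finset.univ.erase k, (l k - l b)⁻¹ • (P b * E * P k) := by
      calc P' k * P k = (∑ b, P b) * (P' k * P k) := by rw [h0.sum_eigenProj, Matrix.one_mul]
        _ = ∑ b ∈ Finset.univ.erase k, P b * (P' k * P k) := by
            rw [Finset.sum_mul, ← Finset.add_sum_erase _ _ (Finset.mem_univ k), e6, zero_add]
        _ = _ := by
            refine Finset.sum_congr rfl fun b hb => ?_
            rw [← Matrix.mul_assoc, e5 b (Finset.ne_of_mem_erase hb), Matrix.smul_mul,
              Matrix.mul_assoc _ (P k), h0.eigenProj_mul_self]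
    have e8 : P k * P' k = ∑ b ∈ Finset.univ.erase k, (l k - l b)⁻¹ • (P k * E * P b) := by
      have := congrArg Matrix.transpose e7
      rw [transpose_mul, hPt, transpose_sum] at this
      simp only [transpose_smul, transpose_mul, hE] at this
      simp only [hPdef, eigenProj_transpose] at this
      simpa only [Matrix.mul_assoc] using this
    rw [← e2, e7, e8, ← Finset.sum_add_distrib]
    exact Finset.sum_congr rfl fun b _ => by rw [smul_add]

end EigenDeriv

/-! ### Partial derivatives on the open chamber -/

section Chamber

variable {r : ℕ}

theorem isOpen_strictChamber : IsOpen (strictChamber r) := by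
  have : strictChamber r = (⋂ k, ⋂ b, {l : Fin r → ℝ | k < b → l b < l k}) ∩
      ⋂ k, {l | 0 < l k} := by
    ext l
    simp [strictChamber, StrictAnti]
  rw [this]
  refine IsOpen.inter (isOpen_iInter_of_finite fun k => isOpen_iInter_of_finite fun b => ?_)
    (isOpen_iInter_of_finite fun k => isOpen_lt continuous_const (continuous_apply k))
  by_cases h : k < b
  · simpa [h] using isOpen_lt (continuous_apply b) (continuous_apply k)
  · simp [h]

theorem hasDerivAt_partial {f : (Fin r → ℝ) → ℝ} {l : Fin r → ℝ} {f' : (Fin r → ℝ) →L[ℝ] ℝ}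
    (hf : HasFDerivAt f f' l) (k : Fin r) :
    HasDerivAt (fun t : ℝ => f (Function.update l k t)) (f' (Pi.single k 1)) (l k) := by
  have h1 : HasDerivAt (fun t : ℝ => Function.update l k t) (Pi.single k 1) (l k) := by
    exact hasDerivAt_update l k (l k)
  have h2 : HasFDerivAt f f' (Function.update l k (l k)) := by rwa [Function.update_eq_self]
  exact HasFDerivAt.comp_hasDerivAt (l k) h2 h1

theorem partialDeriv_eq_fderiv {f : (Fin r → ℝ) → ℝ} {l : Fin r → ℝ}
    (hf : DifferentiableAt ℝ f l) (k : Fin r) :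
    partialDeriv k f l = fderiv ℝ f l (Pi.single k 1) :=
  (hasDerivAt_partial hf.hasFDerivAt k).deriv

theorem fderiv_apply_eq_sum {f : (Fin r → ℝ) → ℝ} {l : Fin r → ℝ}
    (hf : DifferentiableAt ℝ f l) (v : Fin r → ℝ) :
    fderiv ℝ f l v = ∑ k, partialDeriv k f l * v k := by
  conv_lhs => rw [pi_eq_sum_univ' v, map_sum]
  refine Finset.sum_congr rfl fun k _ => ?_
  rw [map_smul, partialDeriv_eq_fderiv hf, smul_eq_mul, mul_comm]

end Chamber

end

noncomputable section

open Filter Topology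

/-! ### The scatter matrix and divergences of spectral vector fields -/

section Scatter

variable {n r : ℕ}

/-- The centered data matrix, with column `a` scaled by `w a`. -/
def centered (w : Fin r → ℝ) (z : Fin n × Fin r → ℝ) : Matrix (Fin n) (Fin r) ℝ :=
  of fun i a => w a * (z (i, a) - (n : ℝ)⁻¹ * ∑ j, z (j, a))

/-- The sample covariance matrix of the scaled data. -/
def scatter (w : Fin r → ℝ) (z : Fin n × Fin r → ℝ) : Matrix (Fin r) (Fin r) ℝ :=
  (n : ℝ)⁻¹ • ((centered w z)ᵀ * centered w z)

theorem centered_apply (w : Fin r → ℝ) (z : Fin n × Fin r → ℝ) (i : Fin n) (a : Fin r) :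
    centered w z i a = w a * (z (i, a) - (n : ℝ)⁻¹ * ∑ j, z (j, a)) := rfl

theorem sum_centered (w : Fin r → ℝ) (z : Fin n × Fin r → ℝ) (a : Fin r) :
    ∑ i, centered w z i a = 0 := by
  simp only [centered_apply, ← Finset.mul_sum, Finset.sum_sub_distrib, Finset.sum_const,
    Finset.card_univ, Fintype.card_fin, nsmul_eq_mul]
  rcases Nat.eq_zero_or_pos n with h | h
  · subst h; simp
  · have : (n : ℝ) ≠ 0 := by positivity
    rw [← mul_assoc, inv_mul_cancel₀ this, one_mul, sub_self, mul_zero]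

theorem scatter_transpose (w : Fin r → ℝ) (z : Fin n × Fin r → ℝ) :
    (scatter w z)ᵀ = scatter w z := by
  rw [scatter, transpose_smul, transpose_mul, transpose_transpose]

theorem contDiff_centered (w : Fin r → ℝ) (i : Fin n) (a : Fin r) :
    ContDiff ℝ 1 (fun z => centered w z i a) := by
  simp only [centered_apply]
  fun_prop

theorem scatter_apply (w : Fin r → ℝ) (z : Fin n × Fin r → ℝ) (a c : Fin r) :
    scatter w z a c = (n : ℝ)⁻¹ * ∑ i, centered w z i a * centered w z i c := rfl

theorem contDiff_scatter (w : Fin r → ℝ) (a c : Fin r) :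
    ContDiff ℝ 1 (fun z : Fin n × Fin r → ℝ => scatter w z a c) := by
  simp only [scatter_apply, centered_apply]
  fun_prop

theorem continuous_scatter (w : Fin r → ℝ) :
    Continuous (fun z : Fin n × Fin r → ℝ => scatter w z) :=
  continuous_matrix fun a c => (contDiff_scatter w a c).continuous

/-- The derivative of the scatter matrix in the coordinate direction `(i, a)`. -/
def scatterDeriv (w : Fin r → ℝ) (z : Fin n × Fin r → ℝ) (i : Fin n) (a : Fin r) :
    Matrix (Fin r) (Fin r) ℝ :=
  ((n : ℝ)⁻¹ * w a) • (vecMulVec (Pi.single a 1) (centered w z i) +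
    vecMulVec (centered w z i) (Pi.single a 1))

/-- The coordinate line through `z`. -/
def coordLine (z : Fin n × Fin r → ℝ) (q : Fin n × Fin r) (t : ℝ) : Fin n × Fin r → ℝ :=
  z + t • Pi.single q 1

theorem coordLine_zero (z : Fin n × Fin r → ℝ) (q : Fin n × Fin r) : coordLine z q 0 = z := by
  simp [coordLine]

theorem hasDerivAt_coordLine (z : Fin n × Fin r → ℝ) (q : Fin n × Fin r) :
    HasDerivAt (coordLine z q) (Pi.single q 1) 0 := by
  have := ((hasDerivAt_id (0 : ℝ)).smul_const (Pi.single q (1 : ℝ) : Fin n × Fin r → ℝ)).const_add z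
  rw [one_smul] at this
  exact this

theorem hasDerivAt_comp_coordLine {f : (Fin n × Fin r → ℝ) → ℝ} {z : Fin n × Fin r → ℝ}
    (hf : DifferentiableAt ℝ f z) (q : Fin n × Fin r) :
    HasDerivAt (fun t => f (coordLine z q t)) (fderiv ℝ f z (Pi.single q 1)) 0 := by
  have h : HasFDerivAt f (fderiv ℝ f z) (coordLine z q 0) := by
    rw [coordLine_zero]; exact hf.hasFDerivAt
  exact h.comp_hasDerivAt (0 : ℝ) (hasDerivAt_coordLine z q)

theorem tendsto_coordLine (z : Fin n × Fin r → ℝ) (q : Fin n × Fin r) :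
    Tendsto (coordLine z q) (𝓝 0) (𝓝 z) := by
  have := (hasDerivAt_coordLine z q).continuousAt.tendsto
  rwa [coordLine_zero] at this

theorem hasEntryDerivAt_centered (w : Fin r → ℝ) (z : Fin n × Fin r → ℝ) (i : Fin n)
    (a : Fin r) :
    HasEntryDerivAt (fun t => centered w (coordLine z (i, a) t))
      (of fun j c => if c = a then w a * ((if j = i then 1 else 0) - (n : ℝ)⁻¹) else 0) 0 := by
  have hz : ∀ j c, HasDerivAt (fun t => coordLine z (i, a) t (j, c))
      ((Pi.single (i, a) 1 : Fin n × Fin r → ℝ) (j, c)) 0 := fun j c =>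
    hasDerivAt_pi.1 (hasDerivAt_coordLine z (i, a)) (j, c)
  intro j c
  have h := ((hz j c).sub ((HasDerivAt.fun_sum (u := Finset.univ)
    fun j' _ => hz j' c).const_mul (n : ℝ)⁻¹)).const_mul (w c)
  refine h.congr_deriv ?_
  by_cases hc : c = a
  · subst hc
    simp [Pi.single_apply]
  · simp [hc]

/-- Moving z_{ia} changes column a of Y by w_a (e_i − 1/n). The centring part −1/n contributes
nothing, because the columns of Y sum to zero. -/
theorem hasEntryDerivAt_scatter (w : Fin r → ℝ) (z : Fin n × Fin r → ℝ) (i : Fin n)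
    (a : Fin r) :
    HasEntryDerivAt (fun t => scatter w (coordLine z (i, a) t)) (scatterDeriv w z i a) 0 := by
  have hY := hasEntryDerivAt_centered w z i a
  have h := HasEntryDerivAt.smul (hasDerivAt_const (0 : ℝ) (n : ℝ)⁻¹) (hY.transpose.mul hY)
  simp only [zero_smul, zero_add, coordLine_zero] at h
  have key : ∀ c, ∑ j, ((if j = i then 1 else 0) - (n : ℝ)⁻¹) * centered w z j c =
      centered w z i c := by
    intro c
    simp only [sub_mul, Finset.sum_sub_distrib, ← Finset.mul_sum, sum_centered]
    simp
  suffices he : scatterDeriv w z i a = (n : ℝ)⁻¹ •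
      ((of fun j c => if c = a then w a * ((if j = i then 1 else 0) - (n : ℝ)⁻¹) else 0 :
          Matrix (Fin n) (Fin r) ℝ)ᵀ * centered w z +
        (centered w z)ᵀ * of fun j c => if c = a then
          w a * ((if j = i then 1 else 0) - (n : ℝ)⁻¹) else 0) by
    rw [he]; exact h
  ext c d
  have e1 : ((of fun j c => if c = a then w a * ((if j = i then 1 else 0) - (n : ℝ)⁻¹) else 0 :
      Matrix (Fin n) (Fin r) ℝ)ᵀ * centered w z) c d =
      if c = a then w a * centered w z i d else 0 := by
    rw [mul_apply]
    by_cases hc : c = a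
    · simp only [transpose_apply, of_apply, hc, if_true, mul_assoc, ← Finset.mul_sum, key]
    · simp [transpose_apply, hc]
  have e2 : ((centered w z)ᵀ * (of fun j c => if c = a then
      w a * ((if j = i then 1 else 0) - (n : ℝ)⁻¹) else 0 : Matrix (Fin n) (Fin r) ℝ)) c d =
      if d = a then w a * centered w z i c else 0 := by
    rw [mul_apply]
    by_cases hd : d = a
    · rw [if_pos hd, ← key c, Finset.mul_sum]
      refine Finset.sum_congr rfl fun j _ => ?_
      simp only [transpose_apply, of_apply, hd, if_true]
      ring
    · simp [hd]
  rw [Matrix.smul_apply, Matrix.add_apply, e1, e2, scatterDeriv, Matrix.smul_apply,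
    Matrix.add_apply, vecMulVec_apply, vecMulVec_apply]
  simp only [Pi.single_apply, smul_eq_mul]
  split_ifs <;> ring

/-- The field part of the divergence: a linear functional of families of matrices. -/
def fieldDiv (w : Fin r → ℝ) (z : Fin n × Fin r → ℝ)
    (D : Fin n → Fin r → Matrix (Fin r) (Fin r) ℝ) : ℝ :=
  ∑ i, ∑ a, (w a)⁻¹ * (centered w z * D i a) i a

theorem fieldDiv_add (w : Fin r → ℝ) (z : Fin n × Fin r → ℝ)
    (D E : Fin n → Fin r → Matrix (Fin r) (Fin r) ℝ) :
    fieldDiv w z (fun i a => D i a + E i a) = fieldDiv w z D + fieldDiv w z E := by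
  simp only [fieldDiv, Matrix.mul_add, Matrix.add_apply, mul_add, Finset.sum_add_distrib]

theorem fieldDiv_smul (w : Fin r → ℝ) (z : Fin n × Fin r → ℝ) (c : ℝ)
    (D : Fin n → Fin r → Matrix (Fin r) (Fin r) ℝ) :
    fieldDiv w z (fun i a => c • D i a) = c * fieldDiv w z D := by
  simp only [fieldDiv, Matrix.mul_smul, Matrix.smul_apply, smul_eq_mul, Finset.mul_sum]
  exact Finset.sum_congr rfl fun i _ => Finset.sum_congr rfl fun a _ => by ring

theorem fieldDiv_sum {ι : Type*} (u : Finset ι) (w : Fin r → ℝ) (z : Fin n × Fin r → ℝ)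
    (D : ι → Fin n → Fin r → Matrix (Fin r) (Fin r) ℝ) :
    fieldDiv w z (fun i a => ∑ k ∈ u, D k i a) = ∑ k ∈ u, fieldDiv w z (D k) := by
  classical
  induction u using Finset.induction_on with
  | empty => simp [fieldDiv]
  | insert k u hk ih =>
    simp only [Finset.sum_insert hk]
    rw [fieldDiv_add, ih]

theorem sum_sum_mul_eq_trace {m : Type*} [Fintype m] (A B : Matrix m (Fin r) ℝ) :
    ∑ i, ∑ a, A i a * B i a = (Aᵀ * B).trace := by
  rw [Finset.sum_comm]
  rfl

theorem natCast_smul_scatter (hn : n ≠ 0) (w : Fin r → ℝ) (z : Fin n × Fin r → ℝ) :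
    (centered w z)ᵀ * centered w z = (n : ℝ) • scatter w z := by
  rw [scatter, smul_smul, mul_inv_cancel₀ (Nat.cast_ne_zero.2 hn), one_smul]

/-- The derivative of S is (w_a/n)(e_a y_iᵗ + y_i e_aᵗ), so the weights cancel. Summing over (i, a)
with YᵗY = nS, the first rank one piece gives the trace of a product and the second the product of
two traces. The latter is the source of the interaction between different eigenvalues. -/
theorem fieldDiv_mul_mul (hn : n ≠ 0) {w : Fin r → ℝ} (hw : ∀ a, w a ≠ 0) (z : Fin n × Fin r → ℝ)
    (N₁ N₂ : Matrix (Fin r) (Fin r) ℝ) :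
    fieldDiv w z (fun i a => N₁ * scatterDeriv w z i a * N₂) =
      (N₁ᵀ * scatter w z * N₂).trace + (N₁ * scatter w z).trace * N₂.trace := by
  have hn' : (n : ℝ) ≠ 0 := Nat.cast_ne_zero.2 hn
  set Y := centered w z with hY
  have e : ∀ i a, (w a)⁻¹ * (Y * (N₁ * scatterDeriv w z i a * N₂)) i a =
      (n : ℝ)⁻¹ * ((Y * N₁) i a * (Y * N₂) i a) + (n : ℝ)⁻¹ * ((Y * N₁ * Yᵀ) i i * N₂ a a) := by
    intro i a
    have : (Y * (N₁ * scatterDeriv w z i a * N₂)) i a = ((n : ℝ)⁻¹ * w a) *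
      ((Y * N₁) i a * (Y * N₂) i a + (Y * N₁ * Yᵀ) i i * N₂ a a) := by
      rw [scatterDeriv, Matrix.mul_smul, Matrix.smul_mul, Matrix.mul_smul, Matrix.smul_apply,
        smul_eq_mul, Matrix.mul_add, Matrix.add_mul, Matrix.mul_add, Matrix.add_apply]
      congr 2
      · rw [mul_vecMulVec, vecMulVec_mul, mul_vecMulVec, vecMulVec_apply, mulVec_mulVec]
        simp [vecMul, mul_apply, dotProduct, hY]
      · rw [mul_vecMulVec, vecMulVec_mul, mul_vecMulVec, vecMulVec_apply, mulVec_mulVec]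
        simp [mulVec, mul_apply, dotProduct, hY]
    rw [this]
    field_simp [hw a]
  unfold fieldDiv
  simp only [← hY, e, Finset.sum_add_distrib, ← Finset.mul_sum, ← Finset.sum_mul]
  rw [sum_sum_mul_eq_trace]
  have h1 : (Y * N₁)ᵀ * (Y * N₂) = (n : ℝ) • (N₁ᵀ * scatter w z * N₂) := by
    rw [transpose_mul, Matrix.mul_assoc, ← Matrix.mul_assoc Yᵀ, natCast_smul_scatter hn,
      Matrix.smul_mul, Matrix.mul_smul, Matrix.mul_assoc]
  have h2 : ∑ i, (Y * N₁ * Yᵀ) i i = (n : ℝ) * (N₁ * scatter w z).trace := by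
    change (Y * N₁ * Yᵀ).trace = _
    rw [trace_mul_cycle, trace_mul_comm, natCast_smul_scatter hn, Matrix.mul_smul, trace_smul,
      smul_eq_mul]
  have h3 : ∑ a, N₂ a a = N₂.trace := rfl
  rw [h1, h2, h3, trace_smul, smul_eq_mul]
  field_simp

/-- For symmetric N₀ both rank one pieces of the derivative have the same trace against N₀, namely
(w_a/n)(Y N₀)_{ia}; hence the factor 2. -/
theorem fieldDiv_trace_smul (hn : n ≠ 0) {w : Fin r → ℝ} (hw : ∀ a, w a ≠ 0)
    (z : Fin n × Fin r → ℝ) {N₀ : Matrix (Fin r) (Fin r) ℝ} (hN : N₀ᵀ = N₀)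
    (N : Matrix (Fin r) (Fin r) ℝ) :
    fieldDiv w z (fun i a => (N₀ * scatterDeriv w z i a).trace • N) =
      2 * (N₀ * scatter w z * N).trace := by
  have hn' : (n : ℝ) ≠ 0 := Nat.cast_ne_zero.2 hn
  set Y := centered w z with hY
  have e : ∀ i a, (N₀ * scatterDeriv w z i a).trace =
      2 * ((n : ℝ)⁻¹ * w a) * (Y * N₀) i a := by
    intro i a
    rw [scatterDeriv, Matrix.mul_smul, trace_smul, smul_eq_mul, Matrix.mul_add, trace_add,
      mul_vecMulVec, mul_vecMulVec, trace_vecMulVec, trace_vecMulVec]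
    have e1 : (N₀ *ᵥ Pi.single a 1) ⬝ᵥ Y i = (Y * N₀) i a := by
      simp [mul_apply, dotProduct, mul_comm]
    have e2 : (N₀ *ᵥ Y i) ⬝ᵥ Pi.single a 1 = (Y * N₀) i a := by
      conv_lhs => rw [← hN, dotProduct_single_one, mulVec_transpose]
      simp [mul_apply, vecMul, dotProduct]
    rw [← hY, e1, e2]; ring
  unfold fieldDiv
  have e' : ∀ i a, (w a)⁻¹ * (Y * ((N₀ * scatterDeriv w z i a).trace • N)) i a =
      (2 * (n : ℝ)⁻¹) * ((Y * N₀) i a * (Y * N) i a) := by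
    intro i a
    rw [e, Matrix.mul_smul, Matrix.smul_apply, smul_eq_mul]
    field_simp [hw a]
  simp only [← hY, e', ← Finset.mul_sum]
  rw [sum_sum_mul_eq_trace]
  have h1 : (Y * N₀)ᵀ * (Y * N) = (n : ℝ) • (N₀ * scatter w z * N) := by
    rw [transpose_mul, Matrix.mul_assoc, ← Matrix.mul_assoc Yᵀ, natCast_smul_scatter hn,
      Matrix.smul_mul, Matrix.mul_smul, Matrix.mul_assoc, hN]
  rw [h1, trace_smul, smul_eq_mul]
  field_simp

end Scatter

end

noncomputable section

open Filter Topology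

/-! ### Divergences of spectral fields -/

section SpectralField

variable {n r : ℕ}

theorem sum_erase_swap (f : Fin r → Fin r → ℝ) :
    ∑ k, ∑ b ∈ Finset.univ.erase k, f k b = ∑ k, ∑ b ∈ Finset.univ.erase k, f b k := by
  refine Finset.sum_comm' fun k b => ?_
  simp [ne_comm]

/-- The derivative of a spectral function with values `d` and Jacobian `J` when the matrix moves in
the direction `E`. -/
def specDeriv (S : Matrix (Fin r) (Fin r) ℝ) (d : Fin r → ℝ) (J : Fin r → Fin r → ℝ)
    (E : Matrix (Fin r) (Fin r) ℝ) : Matrix (Fin r) (Fin r) ℝ :=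
  ∑ k, ((∑ c, J k c * (eigenProj S c * E).trace) • eigenProj S k +
    d k • ∑ b ∈ Finset.univ.erase k, (eigs S k - eigs S b)⁻¹ •
      (eigenProj S b * E * eigenProj S k + eigenProj S k * E * eigenProj S b))

/-- Orthogonality of the projections leaves only ∂_kκ_k from the motion of the eigenvalues. From the
motion of the projections it leaves only the products of traces, where tr(P_b S) = l_b. -/
theorem fieldDiv_specDeriv_mul (hn : n ≠ 0) {w : Fin r → ℝ} (hw : ∀ a, w a ≠ 0)
    {z : Fin n × Fin r → ℝ} (hz : IsSimpleSpectrum (scatter w z)) (d : Fin r → ℝ)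
    (J : Fin r → Fin r → ℝ) (N : Matrix (Fin r) (Fin r) ℝ) :
    fieldDiv w z (fun i a => specDeriv (scatter w z) d J (scatterDeriv w z i a) * N) =
      ∑ k, (2 * J k k * eigs (scatter w z) k * (eigenProj (scatter w z) k * N).trace +
        d k * ∑ b ∈ Finset.univ.erase k, (eigs (scatter w z) k - eigs (scatter w z) b)⁻¹ *
          (eigs (scatter w z) b * (eigenProj (scatter w z) k * N).trace +
            eigs (scatter w z) k * (eigenProj (scatter w z) b * N).trace)) := by
  set S := scatter w z with hS
  set P := eigenProj S with hP
  have e : ∀ i a, specDeriv S d J (scatterDeriv w z i a) * N =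
      ∑ k, (∑ c, J k c • ((P c * scatterDeriv w z i a).trace • (P k * N)) +
        d k • ∑ b ∈ Finset.univ.erase k, (eigs S k - eigs S b)⁻¹ •
          (P b * scatterDeriv w z i a * (P k * N) + P k * scatterDeriv w z i a * (P b * N))) := by
    intro i a
    simp only [specDeriv, Finset.sum_mul, Matrix.add_mul, Matrix.smul_mul, smul_smul,
      Finset.sum_smul, Matrix.mul_assoc, ← hP]
  simp only [e]
  rw [fieldDiv_sum]
  refine Finset.sum_congr rfl fun k _ => ?_
  rw [fieldDiv_add, fieldDiv_sum, fieldDiv_smul, fieldDiv_sum]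
  have hPS : ∀ k, P k * S = eigs S k • P k := fun k => hz.eigenProj_mul_self_left k
  congr 1
  · rw [Finset.sum_eq_single k]
    · rw [fieldDiv_smul, fieldDiv_trace_smul hn hw z (eigenProj_transpose _ _), ← hS, hPS,
        Matrix.smul_mul, ← Matrix.mul_assoc, hz.eigenProj_mul_self, trace_smul, smul_eq_mul]
      ring
    · intro c _ hc
      rw [fieldDiv_smul, fieldDiv_trace_smul hn hw z (eigenProj_transpose _ _), ← hS, hPS,
        Matrix.smul_mul, ← Matrix.mul_assoc, hz.eigenProj_mul_ne hc]
      simp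
    · simp
  · congr 1
    refine Finset.sum_congr rfl fun b hb => ?_
    have hbk := Finset.ne_of_mem_erase hb
    have e1 : P b * P k = 0 := hz.eigenProj_mul_ne hbk
    have e2 : P k * P b = 0 := hz.eigenProj_mul_ne hbk.symm
    rw [fieldDiv_smul, fieldDiv_add, fieldDiv_mul_mul hn hw, fieldDiv_mul_mul hn hw, ← hS,
      eigenProj_transpose, eigenProj_transpose, ← hP, hPS, hPS, Matrix.smul_mul, Matrix.smul_mul,
      ← Matrix.mul_assoc, ← Matrix.mul_assoc, e1, e2]
    simp only [trace_smul, hP, hz.trace_eigenProj]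
    simp

theorem fieldDiv_mul_specDeriv (hn : n ≠ 0) {w : Fin r → ℝ} (hw : ∀ a, w a ≠ 0)
    {z : Fin n × Fin r → ℝ} (hz : IsSimpleSpectrum (scatter w z)) (d : Fin r → ℝ)
    (J : Fin r → Fin r → ℝ) (N : Matrix (Fin r) (Fin r) ℝ) :
    fieldDiv w z (fun i a => N * specDeriv (scatter w z) d J (scatterDeriv w z i a)) =
      ∑ k, (2 * J k k * eigs (scatter w z) k * (eigenProj (scatter w z) k * N).trace +
        d k * ∑ b ∈ Finset.univ.erase k, (eigs (scatter w z) k - eigs (scatter w z) b)⁻¹ *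
          (eigs (scatter w z) b * (eigenProj (scatter w z) b * N).trace +
            eigs (scatter w z) k * (eigenProj (scatter w z) k * N).trace)) := by
  set S := scatter w z with hS
  set P := eigenProj S with hP
  have e : ∀ i a, N * specDeriv S d J (scatterDeriv w z i a) =
      ∑ k, (∑ c, J k c • ((P c * scatterDeriv w z i a).trace • (N * P k)) +
        d k • ∑ b ∈ Finset.univ.erase k, (eigs S k - eigs S b)⁻¹ •
          ((N * P b) * scatterDeriv w z i a * P k + (N * P k) * scatterDeriv w z i a * P b)) := by
    intro i a
    simp only [specDeriv, Finset.mul_sum, Matrix.mul_add, Matrix.mul_smul, smul_smul,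
      Finset.sum_smul, Matrix.mul_assoc, ← hP]
  simp only [e]
  rw [fieldDiv_sum]
  refine Finset.sum_congr rfl fun k _ => ?_
  rw [fieldDiv_add, fieldDiv_sum, fieldDiv_smul, fieldDiv_sum]
  have hPS : ∀ k, P k * S = eigs S k • P k := fun k => hz.eigenProj_mul_self_left k
  have hcyc : ∀ c k, (P c * (N * P k)).trace = ((P k * P c) * N).trace := fun c k => by
    rw [← Matrix.mul_assoc, trace_mul_cycle]
  congr 1
  · rw [Finset.sum_eq_single k]
    · rw [fieldDiv_smul, fieldDiv_trace_smul hn hw z (eigenProj_transpose _ _), ← hS, hPS,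
        Matrix.smul_mul, trace_smul, hcyc, hz.eigenProj_mul_self, smul_eq_mul]
      ring
    · intro c _ hc
      rw [fieldDiv_smul, fieldDiv_trace_smul hn hw z (eigenProj_transpose _ _), ← hS, hPS,
        Matrix.smul_mul, trace_smul, hcyc, hz.eigenProj_mul_ne hc.symm]
      simp
    · simp
  · congr 1
    refine Finset.sum_congr rfl fun b hb => ?_
    have hbk := Finset.ne_of_mem_erase hb
    have e1 : P b * P k = 0 := hz.eigenProj_mul_ne hbk
    have e2 : P k * P b = 0 := hz.eigenProj_mul_ne hbk.symm
    have e3 : ∀ x y, P y * P x = 0 → ((N * P x)ᵀ * S * P y).trace = 0 := by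
      intro x y hxy
      rw [transpose_mul, eigenProj_transpose, ← hP, Matrix.mul_assoc, trace_mul_cycle,
        Matrix.mul_assoc S, hxy]
      simp
    have e4 : ∀ x, (N * P x * S).trace = eigs S x * (P x * N).trace := by
      intro x
      rw [Matrix.mul_assoc, hPS, Matrix.mul_smul, trace_smul, trace_mul_comm, smul_eq_mul]
    rw [fieldDiv_smul, fieldDiv_add, fieldDiv_mul_mul hn hw, fieldDiv_mul_mul hn hw, ← hS,
      e3 _ _ e1, e3 _ _ e2, e4, e4, hz.trace_eigenProj, hz.trace_eigenProj]
    simp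

/-- The matrix `K_κ A K_φ` of spectral functions of `S`. -/
def spectralField (A : Matrix (Fin r) (Fin r) ℝ) (κ φ : Fin r → (Fin r → ℝ) → ℝ)
    (S : Matrix (Fin r) (Fin r) ℝ) : Matrix (Fin r) (Fin r) ℝ :=
  spectralSum S (fun k => κ k (eigs S)) * A * spectralSum S (fun k => φ k (eigs S))

/-- The divergence of the vector field with matrix `spectralField`. -/
def spectralDiv (n : ℕ) (A : Matrix (Fin r) (Fin r) ℝ) (κ φ : Fin r → (Fin r → ℝ) → ℝ)
    (S : Matrix (Fin r) (Fin r) ℝ) : ℝ :=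
  ∑ k, (A * eigenProj S k).trace *
    (((n : ℝ) - 1) * (κ k (eigs S) * φ k (eigs S)) +
      2 * eigs S k * φ k (eigs S) * partialDeriv k (κ k) (eigs S) +
      2 * eigs S k * κ k (eigs S) * partialDeriv k (φ k) (eigs S) +
      ∑ b ∈ Finset.univ.erase k,
        ((κ k (eigs S) - κ b (eigs S)) / (eigs S k - eigs S b) * (eigs S b * φ k (eigs S)) +
          (φ k (eigs S) - φ b (eigs S)) / (eigs S k - eigs S b) * (eigs S k * κ k (eigs S))))

theorem IsSimpleSpectrum.eigenProj_mul_spectralSum {S : Matrix (Fin r) (Fin r) ℝ}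
    (h : IsSimpleSpectrum S) (d : Fin r → ℝ) (k : Fin r) :
    eigenProj S k * spectralSum S d = d k • eigenProj S k := by
  rw [spectralSum, Finset.mul_sum, Finset.sum_eq_single k]
  · rw [Matrix.mul_smul, h.eigenProj_mul_self]
  · intro b _ hb
    rw [Matrix.mul_smul, h.eigenProj_mul_ne hb.symm, smul_zero]
  · simp

theorem IsSimpleSpectrum.spectralSum_mul_eigenProj {S : Matrix (Fin r) (Fin r) ℝ}
    (h : IsSimpleSpectrum S) (d : Fin r → ℝ) (k : Fin r) :
    spectralSum S d * eigenProj S k = d k • eigenProj S k := by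
  rw [spectralSum, Finset.sum_mul, Finset.sum_eq_single k]
  · rw [Matrix.smul_mul, h.eigenProj_mul_self]
  · intro b _ hb
    rw [Matrix.smul_mul, h.eigenProj_mul_ne hb, smul_zero]
  · simp

theorem IsSimpleSpectrum.spectralSum_mul_spectralSum {S : Matrix (Fin r) (Fin r) ℝ}
    (h : IsSimpleSpectrum S) (d e : Fin r → ℝ) :
    spectralSum S d * spectralSum S e = spectralSum S (fun k => d k * e k) := by
  have e1 : spectralSum S d * spectralSum S e =
      ∑ k, (d k • eigenProj S k) * spectralSum S e := Finset.sum_mul _ _ _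
  rw [e1]
  refine Finset.sum_congr rfl fun k _ => ?_
  rw [Matrix.smul_mul, h.eigenProj_mul_spectralSum, smul_smul]

/-- The summand with n − 1 is the derivative of the factor Y; the other two come from the two
spectral factors. Symmetrizing the double sums turns them into difference quotients, weighted by
tr(A P_k) alone. -/
theorem spectralDiv_eq (hn : n ≠ 0) {w : Fin r → ℝ} (hw : ∀ a, w a ≠ 0)
    {z : Fin n × Fin r → ℝ} (hz : IsSimpleSpectrum (scatter w z)) (A : Matrix (Fin r) (Fin r) ℝ)
    (κ φ : Fin r → (Fin r → ℝ) → ℝ) :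
    ((n : ℝ) - 1) * (spectralField A κ φ (scatter w z)).trace +
    fieldDiv w z (fun i a =>
      specDeriv (scatter w z) (fun k => κ k (eigs (scatter w z)))
        (fun k c => partialDeriv c (κ k) (eigs (scatter w z))) (scatterDeriv w z i a) *
          (A * spectralSum (scatter w z) fun k => φ k (eigs (scatter w z))) +
      (spectralSum (scatter w z) fun k => κ k (eigs (scatter w z))) * A *
        specDeriv (scatter w z) (fun k => φ k (eigs (scatter w z)))
          (fun k c => partialDeriv c (φ k) (eigs (scatter w z))) (scatterDeriv w z i a)) =
      spectralDiv n A κ φ (scatter w z) := by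
  rw [fieldDiv_add, fieldDiv_specDeriv_mul hn hw hz, fieldDiv_mul_specDeriv hn hw hz]
  set S := scatter w z
  set P := eigenProj S with hP
  set l := eigs S
  have t1 : ∀ k, (P k * (A * spectralSum S fun k => φ k l)).trace = φ k l * (A * P k).trace := by
    intro k
    rw [← Matrix.mul_assoc, trace_mul_cycle, hz.spectralSum_mul_eigenProj, Matrix.smul_mul,
      trace_smul, smul_eq_mul, trace_mul_comm]
  have t2 : ∀ k, (P k * ((spectralSum S fun k => κ k l) * A)).trace = κ k l * (A * P k).trace := by
    intro k
    rw [← Matrix.mul_assoc, hz.eigenProj_mul_spectralSum, Matrix.smul_mul,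
      trace_smul, smul_eq_mul, trace_mul_comm]
  have t3 : (spectralField A κ φ S).trace = ∑ k, κ k l * φ k l * (A * P k).trace := by
    rw [spectralField, trace_mul_cycle, hz.spectralSum_mul_spectralSum, trace_mul_comm, spectralSum,
      Finset.mul_sum, trace_sum]
    refine Finset.sum_congr rfl fun k _ => ?_
    rw [Matrix.mul_smul, trace_smul, smul_eq_mul]
    ring
  simp only [t1, t2, t3]
  -- Exchanging k and b in the part that carries P_b makes P_k the common factor and reverses the
  -- sign of the gap, so κ_k becomes κ_k − κ_b. The same exchange is used for φ in the second sum.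
  have s1 : ∑ k, κ k l * ∑ b ∈ Finset.univ.erase k, (l k - l b)⁻¹ *
      (l b * (φ k l * (A * P k).trace) + l k * (φ b l * (A * P b).trace)) =
      ∑ k, (A * P k).trace * ∑ b ∈ Finset.univ.erase k,
        (κ k l - κ b l) / (l k - l b) * (l b * φ k l) := by
    have e1 : ∑ k, ∑ b ∈ Finset.univ.erase k, κ k l * ((l k - l b)⁻¹ *
        (l k * (φ b l * (A * P b).trace))) = ∑ k, ∑ b ∈ Finset.univ.erase k,
        κ b l * ((l b - l k)⁻¹ * (l b * (φ k l * (A * P k).trace))) :=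
      sum_erase_swap (fun k b => κ k l * ((l k - l b)⁻¹ * (l k * (φ b l * (A * P b).trace))))
    simp only [Finset.mul_sum, mul_add, Finset.sum_add_distrib]
    rw [e1, ← Finset.sum_add_distrib]
    refine Finset.sum_congr rfl fun k _ => ?_
    rw [← Finset.sum_add_distrib]
    refine Finset.sum_congr rfl fun b hb => ?_
    rw [← neg_sub (l k) (l b), inv_neg, div_eq_mul_inv]
    ring
  have s2 : ∑ k, φ k l * ∑ b ∈ Finset.univ.erase k, (l k - l b)⁻¹ *
      (l b * (κ b l * (A * P b).trace) + l k * (κ k l * (A * P k).trace)) =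
      ∑ k, (A * P k).trace * ∑ b ∈ Finset.univ.erase k,
        (φ k l - φ b l) / (l k - l b) * (l k * κ k l) := by
    have e1 : ∑ k, ∑ b ∈ Finset.univ.erase k, φ k l * ((l k - l b)⁻¹ *
        (l b * (κ b l * (A * P b).trace))) = ∑ k, ∑ b ∈ Finset.univ.erase k,
        φ b l * ((l b - l k)⁻¹ * (l k * (κ k l * (A * P k).trace))) :=
      sum_erase_swap (fun k b => φ k l * ((l k - l b)⁻¹ * (l b * (κ b l * (A * P b).trace))))
    simp only [Finset.mul_sum, mul_add, Finset.sum_add_distrib]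
    rw [e1, ← Finset.sum_add_distrib]
    refine Finset.sum_congr rfl fun k _ => ?_
    rw [← Finset.sum_add_distrib]
    refine Finset.sum_congr rfl fun b hb => ?_
    rw [← neg_sub (l k) (l b), inv_neg, div_eq_mul_inv]
    ring
  rw [Finset.sum_add_distrib, Finset.sum_add_distrib, s1, s2]
  unfold spectralDiv
  simp only [Finset.mul_sum, ← Finset.sum_add_distrib]
  refine Finset.sum_congr rfl fun k _ => ?_
  simp only [Finset.sum_add_distrib, mul_add, Finset.mul_sum]
  ring

end SpectralField

end

noncomputable section

open Filter Topology

/-! ### Stein's identity for spectral vector fields -/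

section SpectralStein

variable {n r : ℕ}

theorem differentiableAt_eigs_scatter {w : Fin r → ℝ} {z : Fin n × Fin r → ℝ}
    (hz : IsSimpleSpectrum (scatter w z)) :
    DifferentiableAt ℝ (fun y => eigs (scatter w y)) z :=
  differentiableAt_eigs (contDiff_scatter w) (scatter_transpose w) hz

theorem differentiableAt_comp_eigs {w : Fin r → ℝ} {f : (Fin r → ℝ) → ℝ}
    (hf : DifferentiableOn ℝ f (strictChamber r)) {z : Fin n × Fin r → ℝ}
    (hz : IsSimpleSpectrum (scatter w z)) :
    DifferentiableAt ℝ (fun y => f (eigs (scatter w y))) z :=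
  DifferentiableAt.comp (g := f) z
    (hf.differentiableAt (isOpen_strictChamber.mem_nhds hz.eigs_mem))
    (differentiableAt_eigs_scatter hz)

theorem differentiableAt_spectralSum_apply {w : Fin r → ℝ} {κ : Fin r → (Fin r → ℝ) → ℝ}
    (hκ : ∀ k, DifferentiableOn ℝ (κ k) (strictChamber r)) {z : Fin n × Fin r → ℝ}
    (hz : IsSimpleSpectrum (scatter w z)) (a c : Fin r) :
    DifferentiableAt ℝ (fun y => spectralSum (scatter w y) (fun k => κ k (eigs (scatter w y))) a c)
      z := by
  simp only [spectralSum, Matrix.sum_apply, Matrix.smul_apply, smul_eq_mul]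
  exact DifferentiableAt.fun_sum fun k _ => (differentiableAt_comp_eigs (hκ k) hz).mul
    (differentiableAt_eigenProj (contDiff_scatter w) (scatter_transpose w) hz k a c)

theorem hasEntryDerivAt_spectralSum {w : Fin r → ℝ} {κ : Fin r → (Fin r → ℝ) → ℝ}
    (hκ : ∀ k, DifferentiableOn ℝ (κ k) (strictChamber r)) {z : Fin n × Fin r → ℝ}
    (hz : IsSimpleSpectrum (scatter w z)) (i : Fin n) (a : Fin r) :
    HasEntryDerivAt (fun t => spectralSum (scatter w (coordLine z (i, a) t))
        (fun k => κ k (eigs (scatter w (coordLine z (i, a) t)))))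
      (specDeriv (scatter w z) (fun k => κ k (eigs (scatter w z)))
        (fun k c => partialDeriv c (κ k) (eigs (scatter w z))) (scatterDeriv w z i a)) 0 := by
  have hd := differentiableAt_pi.1 (differentiableAt_eigs_scatter hz)
  have hl := fun k => hasDerivAt_comp_coordLine (hd k) (i, a)
  have hP : ∀ k, HasEntryDerivAt (fun t => eigenProj (scatter w (coordLine z (i, a) t)) k)
      (of fun c d => fderiv ℝ (fun y => eigenProj (scatter w y) k c d) z (Pi.single (i, a) 1)) 0 :=
    fun k c d => hasDerivAt_comp_coordLine
      (differentiableAt_eigenProj (contDiff_scatter w) (scatter_transpose w) hz k c d) (i, a)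
  have hs : ∀ᶠ t in 𝓝 0, IsSimpleSpectrum (scatter w (coordLine z (i, a) t)) :=
    (tendsto_coordLine z (i, a)).eventually
      (eventually_isSimpleSpectrum (contDiff_scatter w) (scatter_transpose w) hz)
  have hpert := eigen_perturbation (hasEntryDerivAt_scatter w z i a) hs hl hP
  simp only [coordLine_zero] at hpert
  have hκd : ∀ k, HasDerivAt (fun t => κ k (eigs (scatter w (coordLine z (i, a) t))))
      (∑ c, partialDeriv c (κ k) (eigs (scatter w z)) *
        (eigenProj (scatter w z) c * scatterDeriv w z i a).trace) 0 := by
    intro k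
    have hk : DifferentiableAt ℝ (κ k) (eigs (scatter w z)) :=
      (hκ k).differentiableAt (isOpen_strictChamber.mem_nhds hz.eigs_mem)
    have hk' : HasFDerivAt (κ k) (fderiv ℝ (κ k) (eigs (scatter w z)))
        (eigs (scatter w (coordLine z (i, a) 0))) := by
      rw [coordLine_zero]; exact hk.hasFDerivAt
    have h := hk'.comp_hasDerivAt (0 : ℝ) (hasDerivAt_pi.2 hl)
    rw [fderiv_apply_eq_sum hk] at h
    refine h.congr_deriv (Finset.sum_congr rfl fun c _ => ?_)
    rw [(hpert c).1]
  unfold spectralSum specDeriv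
  refine HasEntryDerivAt.sum fun k _ => ?_
  have h := HasEntryDerivAt.smul (hκd k) (hP k)
  simp only [coordLine_zero] at h
  rwa [(hpert k).2] at h

theorem abs_spectralSum_apply_le (S : Matrix (Fin r) (Fin r) ℝ) (d : Fin r → ℝ) (a c : Fin r) :
    |spectralSum S d a c| ≤ ∑ k, |d k| := by
  simp only [spectralSum, Matrix.sum_apply, Matrix.smul_apply, smul_eq_mul]
  refine (Finset.abs_sum_le_sum_abs _ _).trans (Finset.sum_le_sum fun k _ => ?_)
  rw [abs_mul]
  exact mul_le_of_le_one_right (abs_nonneg _) (abs_eigenProj_le_one S k a c)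

theorem abs_mul_apply_le {l m q : Type*} [Fintype m] {A : Matrix l m ℝ} {B : Matrix m q ℝ}
    {α β : ℝ} (hα : 0 ≤ α) (hA : ∀ i j, |A i j| ≤ α) (hB : ∀ i j, |B i j| ≤ β) (i : l) (j : q) :
    |(A * B) i j| ≤ Fintype.card m * (α * β) := by
  rw [mul_apply]
  refine (Finset.abs_sum_le_sum_abs _ _).trans ?_
  rw [← nsmul_eq_mul, ← Finset.card_univ, ← Finset.sum_const]
  refine Finset.sum_le_sum fun k _ => ?_
  rw [abs_mul]
  exact mul_le_mul (hA i k) (hB k j) (abs_nonneg _) hα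

/-- n tr S is the sum of the squares of all entries of Y. Hence bounded eigenvalues bound Y, and
with it the vector field. -/
theorem sq_centered_le (hn : n ≠ 0) (w : Fin r → ℝ) (z : Fin n × Fin r → ℝ) (i : Fin n)
    (a : Fin r) : centered w z i a ^ 2 ≤ n * (scatter w z).trace := by
  have h1 : ∀ c, (n : ℝ) * scatter w z c c = ∑ j, centered w z j c ^ 2 := by
    intro c
    rw [scatter_apply, ← mul_assoc, mul_inv_cancel₀ (Nat.cast_ne_zero.2 hn), one_mul]
    exact Finset.sum_congr rfl fun j _ => (sq _).symm
  have h2 : (n : ℝ) * (scatter w z).trace = ∑ c, ∑ j, centered w z j c ^ 2 := by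
    rw [trace, Finset.mul_sum]
    exact Finset.sum_congr rfl fun c _ => h1 c
  rw [h2]
  refine le_trans ?_ (Finset.single_le_sum (f := fun c => ∑ j, centered w z j c ^ 2)
    (fun c _ => Finset.sum_nonneg fun j _ => sq_nonneg _) (Finset.mem_univ a))
  exact Finset.single_le_sum (f := fun j => centered w z j a ^ 2)
    (fun c _ => sq_nonneg _) (Finset.mem_univ i)

theorem exists_bound_sum_abs {K : Set (Fin r → ℝ)} (hK : IsCompact K) (hKs : K ⊆ strictChamber r)
    {κ : Fin r → (Fin r → ℝ) → ℝ} (hκ : ∀ k, DifferentiableOn ℝ (κ k) (strictChamber r)) :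
    ∃ C, 0 ≤ C ∧ ∀ l ∈ K, ∑ k, |κ k l| ≤ C := by
  obtain ⟨C, hC⟩ := hK.exists_bound_of_continuousOn (f := fun l => ∑ k, |κ k l|)
    (continuousOn_finsetSum _ fun k _ => ((hκ k).continuousOn.mono hKs).abs)
  exact ⟨max C 0, le_max_right _ _, fun l hl =>
    (le_abs_self _).trans ((hC l hl).trans (le_max_left _ _))⟩

theorem spectralField_eq_zero {A : Matrix (Fin r) (Fin r) ℝ} {κ φ : Fin r → (Fin r → ℝ) → ℝ}
    {K : Set (Fin r → ℝ)} (hκ0 : ∀ k, ∀ l ∉ K, κ k l = 0) {S : Matrix (Fin r) (Fin r) ℝ}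
    (hS : eigs S ∉ K) : spectralField A κ φ S = 0 := by
  simp [spectralField, spectralSum, hκ0 _ _ hS]

theorem spectralDiv_eq_zero {A : Matrix (Fin r) (Fin r) ℝ} {κ φ : Fin r → (Fin r → ℝ) → ℝ}
    {K : Set (Fin r → ℝ)} (hK : IsClosed K) (hκ0 : ∀ k, ∀ l ∉ K, κ k l = 0)
    {S : Matrix (Fin r) (Fin r) ℝ} (hS : eigs S ∉ K) : spectralDiv n A κ φ S = 0 := by
  have hp : ∀ k, partialDeriv k (κ k) (eigs S) = 0 := by
    intro k
    have hev : κ k =ᶠ[𝓝 (eigs S)] fun _ => 0 := by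
      filter_upwards [hK.isOpen_compl.mem_nhds hS] with l hl using hκ0 k l hl
    have h0 : HasFDerivAt (κ k) (0 : (Fin r → ℝ) →L[ℝ] ℝ) (eigs S) :=
      (hasFDerivAt_const (0 : ℝ) _).congr_of_eventuallyEq hev
    rw [partialDeriv_eq_fderiv h0.differentiableAt, h0.fderiv]
    rfl
  simp [spectralDiv, hκ0 _ _ hS, hp]

/-- **Stein's identity** for the vector field `Y K_κ(S) A K_φ(S)`, where the spectral function `κ`
is supported in a compact set of distinct positive eigenvalues. -/
theorem integral_spectralDiv [NeZero r] (hn : n ≠ 0) {w : Fin r → ℝ} (hw : ∀ a, w a ≠ 0)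
    (A : Matrix (Fin r) (Fin r) ℝ) {κ φ : Fin r → (Fin r → ℝ) → ℝ} {K : Set (Fin r → ℝ)}
    (hK : IsCompact K) (hKs : K ⊆ strictChamber r) (hκ0 : ∀ k, ∀ l ∉ K, κ k l = 0)
    (hκ : ∀ k, DifferentiableOn ℝ (κ k) (strictChamber r))
    (hφ : ∀ k, DifferentiableOn ℝ (φ k) (strictChamber r))
    (hint : Integrable (fun z => spectralDiv n A κ φ (scatter w z))
      (stdGaussianPi (Fin n × Fin r))) :
    ∫ z, spectralDiv n A κ φ (scatter w z) ∂(stdGaussianPi (Fin n × Fin r)) =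
      ∫ z, n * (diagonal (fun a => (w a ^ 2)⁻¹) * scatter w z *
        spectralField A κ φ (scatter w z)).trace ∂(stdGaussianPi (Fin n × Fin r)) := by
  have hn' : (n : ℝ) ≠ 0 := Nat.cast_ne_zero.2 hn
  let M : (Fin n × Fin r → ℝ) → Matrix (Fin r) (Fin r) ℝ := fun z => spectralField A κ φ (scatter w z)
  -- Dividing column a by w_a makes the divergence independent of w, except through A, while the
  -- pairing of f with z acquires the factor D⁻¹.
  let f : Fin n × Fin r → (Fin n × Fin r → ℝ) → ℝ := fun q z =>
    (w q.2)⁻¹ * (centered w z * M z) q.1 q.2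
  have hsimple : ∀ z : Fin n × Fin r → ℝ, eigs (scatter w z) ∈ K → IsSimpleSpectrum (scatter w z) :=
    fun z hz => isSimpleSpectrum_iff_eigs_mem.2 (hKs hz)
  have hf0 : ∀ q z, eigs (scatter w z) ∉ K → f q z = 0 := by
    intro q z hz
    simp [f, M, spectralField_eq_zero hκ0 hz]
  -- By `isClosed_setOf_eigs_mem` the field vanishes identically near every point whose eigenvalues
  -- are not in K. This makes it differentiable everywhere, although `eigs` is only controlled on
  -- simple spectra.
  have hopen : ∀ z : Fin n × Fin r → ℝ, eigs (scatter w z) ∉ K →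
      ∀ᶠ y in 𝓝 z, eigs (scatter w y) ∉ K := by
    intro z hz
    exact ((isClosed_setOf_eigs_mem hK hKs).preimage (continuous_scatter w)).isOpen_compl.mem_nhds hz
  have hMd : ∀ z, IsSimpleSpectrum (scatter w z) → ∀ a c,
      DifferentiableAt ℝ (fun y => M y a c) z := by
    intro z hz a c
    simp only [M, spectralField, mul_apply]
    exact DifferentiableAt.fun_sum fun j _ => (DifferentiableAt.fun_sum fun i _ =>
      (differentiableAt_spectralSum_apply hκ hz _ _).mul_const _).mul
        (differentiableAt_spectralSum_apply hφ hz _ _)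
  have hfd : ∀ q z, DifferentiableAt ℝ (f q) z := by
    intro q z
    by_cases hz : eigs (scatter w z) ∈ K
    · simp only [f, mul_apply]
      exact (DifferentiableAt.fun_sum fun j _ =>
        ((contDiff_centered w q.1 j).differentiable one_ne_zero z).mul
          (hMd z (hsimple z hz) j q.2)).const_mul _
    · have hev : f q =ᶠ[𝓝 z] fun _ => 0 := (hopen z hz).mono fun y hy => hf0 q y hy
      exact (differentiableAt_const (0 : ℝ)).congr_of_eventuallyEq hev
  have hdiv : ∀ z, ∑ q, fderiv ℝ (f q) z (Pi.single q 1) = spectralDiv n A κ φ (scatter w z) := by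
    intro z
    by_cases hz : eigs (scatter w z) ∈ K
    · have hs := hsimple z hz
      rw [← spectralDiv_eq hn hw hs A κ φ]
      set S := scatter w z with hS
      set Kκ := spectralSum S fun k => κ k (eigs S) with hKκ
      set Kφ := spectralSum S fun k => φ k (eigs S) with hKφ
      set Dκ := fun i a => specDeriv S (fun k => κ k (eigs S))
        (fun k c => partialDeriv c (κ k) (eigs S)) (scatterDeriv w z i a) with hDκ
      set Dφ := fun i a => specDeriv S (fun k => φ k (eigs S))
        (fun k c => partialDeriv c (φ k) (eigs S)) (scatterDeriv w z i a) with hDφ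
      -- The coefficient 1 − 1/n is the derivative of the centred entry in its own coordinate;
      -- summed over i it becomes n − 1.
      have hq : ∀ i a, fderiv ℝ (f (i, a)) z (Pi.single (i, a) 1) =
          (1 - (n : ℝ)⁻¹) * M z a a + (w a)⁻¹ *
            (centered w z * (Dκ i a * (A * Kφ) + Kκ * A * Dφ i a)) i a := by
        intro i a
        have h1 := hasDerivAt_comp_coordLine (hfd (i, a) z) (i, a)
        have h2 : HasEntryDerivAt (fun t => M (coordLine z (i, a) t))
            (Dκ i a * (A * Kφ) + Kκ * A * Dφ i a) 0 := by
          have := ((hasEntryDerivAt_spectralSum hκ hs i a).mul (hasEntryDerivAt_const A)).mul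
            (hasEntryDerivAt_spectralSum hφ hs i a)
          simp only [coordLine_zero, Matrix.mul_zero, add_zero] at this
          rw [← Matrix.mul_assoc (Dκ i a)]
          exact this
        have h3 := (((hasEntryDerivAt_centered w z i a).mul h2) i a).const_mul (w a)⁻¹
        rw [h1.unique h3, coordLine_zero, Matrix.add_apply, mul_add]
        congr 1
        rw [mul_apply, Finset.sum_eq_single a]
        · simp only [of_apply, if_true]
          field_simp [hw a]
        · intro c _ hc
          simp [hc]
        · simp
      rw [Fintype.sum_prod_type]
      simp only [hq, Finset.sum_add_distrib]
      congr 1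
      rw [Finset.sum_const, Finset.card_univ, Fintype.card_fin, nsmul_eq_mul, ← Finset.mul_sum,
        ← mul_assoc, mul_sub, mul_inv_cancel₀ hn', mul_one]
      rfl
    · rw [spectralDiv_eq_zero hK.isClosed hκ0 hz]
      refine Finset.sum_eq_zero fun q _ => ?_
      have hev : f q =ᶠ[𝓝 z] fun _ => 0 := (hopen z hz).mono fun y hy => hf0 q y hy
      rw [hev.fderiv_eq]
      simp
  obtain ⟨C₁, hC₁, hκb⟩ := exists_bound_sum_abs hK hKs hκ
  obtain ⟨C₂, hC₂, hφb⟩ := exists_bound_sum_abs hK hKs hφ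
  obtain ⟨C₃, hC₃, hlb⟩ := exists_bound_sum_abs hK hKs (κ := fun k l => l k)
    (fun k => (differentiable_apply k).differentiableOn)
  have hbound : ∃ B, ∀ q z, |f q z| ≤ B := by
    let α := ∑ a, ∑ c, |A a c|
    have hα : 0 ≤ α := Finset.sum_nonneg fun a _ => Finset.sum_nonneg fun c _ => abs_nonneg _
    have hA : ∀ a c, |A a c| ≤ α := fun a c =>
      (Finset.single_le_sum (f := fun c => |A a c|) (fun _ _ => abs_nonneg _)
        (Finset.mem_univ c)).trans
      (Finset.single_le_sum (f := fun a => ∑ c, |A a c|)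
        (fun _ _ => Finset.sum_nonneg fun c _ => abs_nonneg _) (Finset.mem_univ a))
    let B₁ := (r : ℝ) * (C₁ * α)
    let B₂ := (r : ℝ) * (B₁ * C₂)
    let B₃ := (r : ℝ) * (Real.sqrt (n * C₃) * B₂)
    have hB₁ : 0 ≤ B₁ := by positivity
    have hB₃ : 0 ≤ B₃ := by positivity
    refine ⟨(∑ a, |(w a)⁻¹|) * B₃, fun q z => ?_⟩
    by_cases hz : eigs (scatter w z) ∈ K
    · have e1 := abs_mul_apply_le hC₁ (fun a c => (abs_spectralSum_apply_le (scatter w z)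
        (fun k => κ k (eigs (scatter w z))) a c).trans (hκb _ hz)) hA
      rw [Fintype.card_fin] at e1
      have e2 := abs_mul_apply_le hB₁ e1 (fun a c => (abs_spectralSum_apply_le (scatter w z)
        (fun k => φ k (eigs (scatter w z))) a c).trans (hφb _ hz))
      rw [Fintype.card_fin] at e2
      have e3 : ∀ i a, |centered w z i a| ≤ Real.sqrt (n * C₃) := by
        intro i a
        refine Real.abs_le_sqrt ((sq_centered_le hn w z i a).trans ?_)
        rw [(hsimple z hz).trace_eq]
        refine mul_le_mul_of_nonneg_left ?_ (Nat.cast_nonneg n)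
        exact (Finset.sum_le_sum fun k _ => le_abs_self _).trans (hlb _ hz)
      have e4 := abs_mul_apply_le (Real.sqrt_nonneg _) e3 e2 q.1 q.2
      rw [Fintype.card_fin] at e4
      simp only [f, abs_mul]
      exact mul_le_mul (Finset.single_le_sum (f := fun a => |(w a)⁻¹|)
        (fun _ _ => abs_nonneg _) (Finset.mem_univ q.2)) e4 (abs_nonneg _)
        (Finset.sum_nonneg fun _ _ => abs_nonneg _)
    · rw [hf0 q z hz, abs_zero]
      exact mul_nonneg (Finset.sum_nonneg fun _ _ => abs_nonneg _) hB₃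
  obtain ⟨B, hB⟩ := hbound
  have key := integral_stein f (fun q z => fderiv ℝ (f q) z) (fun q z => (hfd q z).hasFDerivAt)
    hB (by simpa only [hdiv] using hint)
  simp only [hdiv] at key
  rw [key]
  congr 1
  ext z
  rw [Fintype.sum_prod_type, Finset.sum_comm, trace, Finset.mul_sum]
  refine Finset.sum_congr rfl fun a _ => ?_
  -- z_{ia} is Y_{ia}/w_a plus a column mean, and the mean is orthogonal to the columns of Y.
  have hYz : ∀ c, ∑ i, z (i, a) * centered w z i c = (w a)⁻¹ * (n * scatter w z a c) := by
    intro c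
    have h1 : ∀ i, z (i, a) * centered w z i c = (w a)⁻¹ * (centered w z i a * centered w z i c) +
        ((n : ℝ)⁻¹ * ∑ j, z (j, a)) * centered w z i c := by
      intro i
      rw [centered_apply w z i a]
      field_simp [hw a]
      ring
    simp only [h1, Finset.sum_add_distrib, ← Finset.mul_sum, sum_centered]
    rw [scatter_apply, mul_inv_cancel_left₀ hn']
    ring
  have h2 : ∀ i, z (i, a) * f (i, a) z = ∑ c, (w a)⁻¹ * M z c a * (z (i, a) * centered w z i c) := by
    intro i
    simp only [f, mul_apply, Finset.mul_sum]
    exact Finset.sum_congr rfl fun c _ => by ring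
  simp only [h2]
  rw [Finset.sum_comm]
  simp only [← Finset.mul_sum, hYz]
  rw [diag_apply, mul_apply, Finset.mul_sum]
  refine Finset.sum_congr rfl fun c _ => ?_
  rw [diagonal_mul]
  simp only [M]
  have := hw a
  field_simp

end SpectralStein

end

noncomputable section

open Filter Topology
open scoped ContDiff

/-! ### Almost every scatter matrix has simple positive spectrum -/

section NullSets

/-- The zero set of a nonzero real analytic function is a null set. -/
theorem ae_ne_zero_of_analytic {ι : Type*} [Fintype ι] {g : (ι → ℝ) → ℝ}
    (hg : AnalyticOnNhd ℝ g Set.univ) {z₀ : ι → ℝ} (h0 : g z₀ ≠ 0) :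
    ∀ᵐ z, g z ≠ 0 := by
  have hgc : Continuous g := continuousOn_univ.1 hg.continuousOn
  let B : Set (ι → ℝ) := {x | g (z₀ + x) = 0}
  have hB : MeasurableSet B := (isClosed_eq (by fun_prop) continuous_const).measurableSet
  have hcount : ∀ x, volume {t : ℝ | t • x ∈ B} = 0 := by
    intro x
    -- On every line through z₀ the function is analytic in one variable and nonzero at parameter 0,
    -- so its zeros there form a null set.
    have hline : AnalyticOnNhd ℝ (fun t : ℝ => g (z₀ + t • x)) Set.univ := by
      intro t _
      exact AnalyticAt.comp (g := g) (hg _ (Set.mem_univ _)) (by fun_prop)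
    have h1 := hline.preimage_zero_mem_codiscrete (x := 0) (by simpa using h0)
    have h2 := ae_restrict_le_codiscreteWithin (μ := (volume : Measure ℝ)) MeasurableSet.univ h1
    rw [Measure.restrict_univ, mem_ae_iff] at h2
    refine measure_mono_null (fun t ht => ?_) h2
    simpa [B] using ht
  have hC : MeasurableSet {q : (ι → ℝ) × ℝ | q.2 • q.1 ∈ B} :=
    hB.preimage (by fun_prop : Measurable fun q : (ι → ℝ) × ℝ => q.2 • q.1)
  have hnull : (volume : Measure (ι → ℝ)).prod (volume : Measure ℝ)
      {q : (ι → ℝ) × ℝ | q.2 • q.1 ∈ B} = 0 := by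
    rw [Measure.measure_prod_null hC]
    exact Eventually.of_forall fun x => hcount x
  -- The set of pairs (x, t) with tx in B is null by Fubini. Slicing it the other way makes a dilate
  -- of B null for almost every t, and a single t ≠ 0 suffices to conclude by scaling.
  have hae : ∀ᵐ t : ℝ, volume {x : ι → ℝ | t • x ∈ B} = 0 := by
    have h1 := (Measure.measurePreserving_swap (μ := (volume : Measure ℝ))
      (ν := (volume : Measure (ι → ℝ)))).measure_preimage hC.nullMeasurableSet
    rw [hnull] at h1
    exact Measure.ae_ae_of_ae_prod (p := fun q : ℝ × (ι → ℝ) => ¬ q.1 • q.2 ∈ B)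
      (measure_eq_zero_iff_ae_notMem.1 h1) |>.mono fun t ht => by
        rw [measure_eq_zero_iff_ae_notMem]; exact ht
  obtain ⟨t, ht, ht0⟩ := (hae.and (Measure.ae_ne volume (0 : ℝ))).exists
  have hB0 : volume B = 0 := by
    have h2 := Measure.addHaar_preimage_smul (volume : Measure (ι → ℝ)) ht0 B
    have h3 : (volume : Measure (ι → ℝ)) ((t • ·) ⁻¹' B) = 0 := ht
    rw [h3] at h2
    refine (mul_eq_zero.1 h2.symm).resolve_left ?_
    simp [ht0]
  have h4 : {z | g z = 0} = (fun x => -z₀ + x) ⁻¹' B := by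
    ext z; simp [B]
  rw [ae_iff]
  simp only [not_not]
  rw [h4, measure_preimage_add]
  exact hB0

end NullSets

/-! ### The discriminant as a polynomial in the matrix entries -/

section Discriminant

variable {r : ℕ}

/-- The Hankel matrix of power sums of the eigenvalues, whose determinant is the discriminant. -/
def powerHankel (S : Matrix (Fin r) (Fin r) ℝ) : Matrix (Fin r) (Fin r) ℝ :=
  of fun i j => (S ^ ((i : ℕ) + (j : ℕ))).trace

theorem trace_pow_frame {H : Matrix (Fin r) (Fin r) ℝ} (hH : Hᵀ * H = 1) (d : Fin r → ℝ) (k : ℕ) :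
    ((H * diagonal d * Hᵀ) ^ k).trace = ∑ a, d a ^ k := by
  have h : (H * diagonal d * Hᵀ) ^ k = H * diagonal d ^ k * Hᵀ := by
    induction k with
    | zero => rw [pow_zero, pow_zero, Matrix.mul_one, mul_eq_one_comm.1 hH]
    | succ k ih =>
      rw [pow_succ, ih, pow_succ]
      calc H * diagonal d ^ k * Hᵀ * (H * diagonal d * Hᵀ)
          = H * diagonal d ^ k * (Hᵀ * H) * diagonal d * Hᵀ := by simp only [Matrix.mul_assoc]
        _ = _ := by rw [hH, Matrix.mul_one, Matrix.mul_assoc H]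
  rw [h, trace_mul_cycle, hH, Matrix.one_mul, diagonal_pow, trace_diagonal]
  rfl

/-- The Hankel matrix of power sums is VᵗV with V the Vandermonde matrix of the eigenvalues. This
detects repeated eigenvalues by a polynomial in the entries of S. -/
theorem det_powerHankel_frame {H : Matrix (Fin r) (Fin r) ℝ} (hH : Hᵀ * H = 1) (d : Fin r → ℝ) :
    (powerHankel (H * diagonal d * Hᵀ)).det = (vandermonde d).det ^ 2 := by
  have h : powerHankel (H * diagonal d * Hᵀ) = (vandermonde d)ᵀ * vandermonde d := by
    ext i j
    rw [powerHankel, of_apply, trace_pow_frame hH, mul_apply]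
    refine Finset.sum_congr rfl fun a _ => ?_
    rw [transpose_apply, vandermonde_apply, vandermonde_apply, pow_add]
  rw [h, det_mul, det_transpose, sq]

theorem isSimpleSpectrum_of_posSemidef {S : Matrix (Fin r) (Fin r) ℝ} (hS : S.PosSemidef)
    (hdet : S.det ≠ 0) (hdisc : (powerHankel S).det ≠ 0) : IsSimpleSpectrum S := by
  have hA := hS.isHermitian
  set U : Matrix (Fin r) (Fin r) ℝ := (hA.eigenvectorUnitary : Matrix (Fin r) (Fin r) ℝ)
  set d := hA.eigenvalues with hd
  have hU : Uᵀ * U = 1 := by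
    have h := (Matrix.mem_unitaryGroup_iff').1 hA.eigenvectorUnitary.2
    rwa [star_eq_conjTranspose, conjTranspose_eq_transpose_of_trivial] at h
  have hs : S = U * diagonal d * Uᵀ := by
    have h := hA.spectral_theorem
    rw [Unitary.conjStarAlgAut_apply, star_eq_conjTranspose,
      conjTranspose_eq_transpose_of_trivial] at h
    exact h
  rw [hs, det_frame hU] at hdet
  rw [hs, det_powerHankel_frame hU] at hdisc
  have hinj : Function.Injective d := det_vandermonde_ne_zero_iff.1 (pow_ne_zero_iff two_ne_zero |>.1 hdisc)
  have hpos : ∀ a, 0 < d a := fun a => lt_of_le_of_ne (hS.eigenvalues_nonneg a)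
    (Finset.prod_ne_zero_iff.1 hdet a (Finset.mem_univ a)).symm
  let σ : Equiv.Perm (Fin r) := Tuple.sort (fun a => - d a)
  have hσ : StrictAnti (d ∘ σ) := by
    have h1 : Monotone ((fun a => - d a) ∘ σ) := Tuple.monotone_sort _
    have h2 : Antitone (d ∘ σ) := fun a c hac => neg_le_neg_iff.1 (h1 hac)
    exact h2.strictAnti_of_injective (hinj.comp σ.injective)
  refine ⟨U.submatrix id σ, d ∘ σ, ?_, ?_, hσ, fun k => hpos _⟩
  · ext a c
    have := congrFun (congrFun hU (σ a)) (σ c)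
    rw [mul_apply] at this ⊢
    simp only [transpose_apply, submatrix_apply, id] at this ⊢
    rw [this, one_apply, one_apply]
    simp
  · ext a c
    rw [mul_diagonal_mul_transpose_apply]
    conv_lhs => rw [hs, mul_diagonal_mul_transpose_apply]
    rw [← Equiv.sum_comp σ]
    rfl

end Discriminant

/-! ### One scatter matrix with simple spectrum, hence almost all -/

section Generic

variable {n r : ℕ}

theorem contDiff_omega_mul {V : Type*} [NormedAddCommGroup V] [NormedSpace ℝ V] {l m q : Type*}
    [Fintype m] {A : V → Matrix l m ℝ} {B : V → Matrix m q ℝ}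
    (hA : ∀ i j, ContDiff ℝ ω (fun z => A z i j)) (hB : ∀ i j, ContDiff ℝ ω (fun z => B z i j))
    (i : l) (j : q) : ContDiff ℝ ω (fun z => (A z * B z) i j) := by
  simp only [mul_apply]
  exact ContDiff.sum fun k _ => (hA i k).mul (hB k j)

theorem contDiff_omega_det {V : Type*} [NormedAddCommGroup V] [NormedSpace ℝ V] {m : ℕ}
    {A : V → Matrix (Fin m) (Fin m) ℝ} (hA : ∀ i j, ContDiff ℝ ω (fun z => A z i j)) :
    ContDiff ℝ ω (fun z => (A z).det) := by
  simp only [det_apply']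
  exact ContDiff.sum fun σ _ => contDiff_const.mul (contDiff_prod fun i _ => hA _ _)

theorem contDiff_omega_scatter (w : Fin r → ℝ) (a c : Fin r) :
    ContDiff ℝ ω (fun z : Fin n × Fin r → ℝ => scatter w z a c) := by
  simp only [scatter_apply, centered_apply]
  fun_prop

theorem posSemidef_scatter (w : Fin r → ℝ) (z : Fin n × Fin r → ℝ) : (scatter w z).PosSemidef := by
  have h := posSemidef_conjTranspose_mul_self (centered w z)
  rw [conjTranspose_eq_transpose_of_trivial] at h
  exact h.smul (by positivity)

/-- `r` orthonormal vectors orthogonal to the constants. -/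
theorem exists_orthonormal_sum_zero (hrn : r ≤ n - 1) :
    ∃ u : Fin r → Fin n → ℝ, (∀ a c, ∑ i, u a i * u c i = if a = c then 1 else 0) ∧
      ∀ a, ∑ i, u a i = 0 := by
  rcases Nat.eq_zero_or_pos n with rfl | hn
  · have : r = 0 := by omega
    subst this
    exact ⟨fun a => a.elim0, fun a => a.elim0, fun a => a.elim0⟩
  let e : EuclideanSpace ℝ (Fin n) := WithLp.toLp 2 fun _ => 1
  have he : e ≠ 0 := by
    intro h
    have := congrArg (fun v : EuclideanSpace ℝ (Fin n) => v ⟨0, hn⟩) h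
    simp [e] at this
  -- The complement of the constants has dimension n − 1; this is where r ≤ n − 1 enters.
  let W := (ℝ ∙ e)ᗮ
  have hfin : Module.finrank ℝ W = n - 1 := by
    have h1 := Submodule.finrank_add_finrank_orthogonal (ℝ ∙ e)
    rw [finrank_span_singleton he, finrank_euclideanSpace_fin] at h1
    change 1 + Module.finrank ℝ W = n at h1
    omega
  let bs := stdOrthonormalBasis ℝ W
  let ix : Fin r → Fin (Module.finrank ℝ W) := fun a => ⟨a, by rw [hfin]; omega⟩
  have hix : Function.Injective ix := fun a c h => Fin.ext (by simpa [ix] using h)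
  refine ⟨fun a i => (bs (ix a) : EuclideanSpace ℝ (Fin n)) i, fun a c => ?_, fun a => ?_⟩
  · have h := (orthonormal_iff_ite.1 bs.orthonormal) (ix a) (ix c)
    rw [Submodule.coe_inner, PiLp.inner_apply] at h
    simp only [hix.eq_iff] at h
    rw [← h]
    refine Finset.sum_congr rfl fun i _ => ?_
    exact mul_comm _ _
  · have h := Submodule.mem_orthogonal_singleton_iff_inner_right.1 (bs (ix a)).2
    rw [PiLp.inner_apply] at h
    simpa [e] using h

/-- Almost every scatter matrix has simple positive spectrum. -/
theorem ae_isSimpleSpectrum (hrn : r ≤ n - 1) (hn : n ≠ 0) {w : Fin r → ℝ} (hw : ∀ a, w a ≠ 0) :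
    ∀ᵐ z ∂(stdGaussianPi (Fin n × Fin r)), IsSimpleSpectrum (scatter w z) := by
  have hac : stdGaussianPi (Fin n × Fin r) ≪ volume := by
    rw [stdGaussianPi_eq_withDensity]; exact withDensity_absolutelyContinuous _ _
  refine hac.ae_le ?_
  -- The determinant excludes the eigenvalue zero and the discriminant excludes coincidences. Their
  -- product is analytic in z, so it is enough to find one point where it does not vanish.
  let g : (Fin n × Fin r → ℝ) → ℝ := fun z => (scatter w z).det * (powerHankel (scatter w z)).det
  have hpow : ∀ k a c, ContDiff ℝ ω (fun z : Fin n × Fin r → ℝ => (scatter w z ^ k) a c) := by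
    intro k
    induction k with
    | zero => intro a c; simp only [pow_zero]; exact contDiff_const
    | succ k ih =>
      intro a c
      simp only [pow_succ]
      exact contDiff_omega_mul ih (contDiff_omega_scatter w) a c
  have hg : ContDiff ℝ ω g := by
    refine (contDiff_omega_det (contDiff_omega_scatter w)).mul (contDiff_omega_det fun i j => ?_)
    simp only [powerHankel, of_apply, trace]
    exact ContDiff.sum fun a _ => hpow _ a a
  obtain ⟨u, hu, hu0⟩ := exists_orthonormal_sum_zero hrn
  -- Chosen so that the centred columns are √(n(a+1)) u_a, orthogonal to each other and to the
  -- constants; the scatter matrix is then diag(1, …, r).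
  let z₀ : Fin n × Fin r → ℝ := fun q =>
    (w q.2)⁻¹ * (Real.sqrt (n * ((q.2 : ℕ) + 1)) * u q.2 q.1)
  have hn' : (n : ℝ) ≠ 0 := Nat.cast_ne_zero.2 hn
  have hS : scatter w z₀ = 1 * diagonal (fun a : Fin r => ((a : ℕ) : ℝ) + 1) * (1 : Matrix _ _ ℝ)ᵀ := by
    have hY : ∀ i a, centered w z₀ i a = Real.sqrt (n * ((a : ℕ) + 1)) * u a i := by
      intro i a
      rw [centered_apply]
      simp only [z₀, ← Finset.mul_sum, hu0]
      have := hw a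
      field_simp
      ring
    rw [transpose_one, Matrix.one_mul, Matrix.mul_one]
    ext a c
    rw [scatter_apply]
    simp only [hY]
    have : ∀ i, Real.sqrt (n * ((a : ℕ) + 1)) * u a i * (Real.sqrt (n * ((c : ℕ) + 1)) * u c i) =
        Real.sqrt (n * ((a : ℕ) + 1)) * Real.sqrt (n * ((c : ℕ) + 1)) * (u a i * u c i) :=
      fun i => by ring
    simp only [this, ← Finset.mul_sum, hu, diagonal_apply]
    split_ifs with h
    · subst h
      rw [Real.mul_self_sqrt (by positivity)]
      field_simp
    · simp
  have hg0 : g z₀ ≠ 0 := by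
    have h1 : (1 : Matrix (Fin r) (Fin r) ℝ)ᵀ * 1 = 1 := by simp
    simp only [g, hS]
    rw [det_frame h1, det_powerHankel_frame h1]
    refine mul_ne_zero (Finset.prod_ne_zero_iff.2 fun a _ => by positivity) (pow_ne_zero _ ?_)
    refine det_vandermonde_ne_zero_iff.2 fun a c h => ?_
    simpa [Fin.ext_iff] using h
  filter_upwards [ae_ne_zero_of_analytic (contDiff_omega_iff_analyticOnNhd.1 hg) hg0] with z hz
  exact isSimpleSpectrum_of_posSemidef (posSemidef_scatter w z) (left_ne_zero_of_mul hz)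
    (right_ne_zero_of_mul hz)

end Generic

end

noncomputable section

open Filter Topology

/-! ### The two Stein identities for compactly supported functions of the eigenvalues -/

section Operators

variable {r : ℕ}

theorem partialDeriv_mul {f g : (Fin r → ℝ) → ℝ} {l : Fin r → ℝ} (hf : DifferentiableAt ℝ f l)
    (hg : DifferentiableAt ℝ g l) (k : Fin r) :
    partialDeriv k (fun l => f l * g l) l = partialDeriv k f l * g l + f l * partialDeriv k g l := by
  rw [partialDeriv_eq_fderiv (hf.fun_mul hg), partialDeriv_eq_fderiv hf, partialDeriv_eq_fderiv hg,
    fderiv_fun_mul hf hg]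
  simp
  ring

theorem partialDeriv_div_apply {f : (Fin r → ℝ) → ℝ} {l : Fin r → ℝ} (hf : DifferentiableAt ℝ f l)
    {k : Fin r} (hl : l k ≠ 0) :
    partialDeriv k (fun l => f l / l k) l = partialDeriv k f l / l k - f l / l k ^ 2 := by
  have h1 := hasDerivAt_partial hf.hasFDerivAt k
  have h2 : HasDerivAt (fun t : ℝ => f (Function.update l k t) / t)
      ((fderiv ℝ f l (Pi.single k 1) * l k - f l * 1) / l k ^ 2) (l k) := by
    have := h1.div (hasDerivAt_id (l k)) hl
    simpa using! this
  unfold partialDeriv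
  simp only [Function.update_self]
  rw [h2.deriv, h1.deriv]
  field_simp

theorem differentiableOn_div_apply {f : (Fin r → ℝ) → ℝ} (hf : DifferentiableOn ℝ f (strictChamber r))
    (k : Fin r) : DifferentiableOn ℝ (fun l => f l / l k) (strictChamber r) := by
  simp only [div_eq_mul_inv]
  exact hf.fun_mul (DifferentiableOn.fun_inv (differentiable_apply k).differentiableOn
    fun l hl => (hl.2 k).ne')

theorem partialDeriv_const (k : Fin r) (c : ℝ) (l : Fin r → ℝ) :
    partialDeriv k (fun _ => c) l = 0 := by
  simp [partialDeriv]

/-- The differential operator `U` of the risk formula, without constant and normalization. -/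
def steinOp (n : ℕ) (φ : Fin r → (Fin r → ℝ) → ℝ) (l : Fin r → ℝ) : ℝ :=
  ((n : ℝ) - r - 2) * ∑ k, φ k l / l k + 2 * ∑ k, partialDeriv k (φ k) l +
    ∑ k, ∑ b ∈ Finset.univ.erase k, (φ k l - φ b l) / (l k - l b)

theorem riskExpr_eq {n : ℕ} (p : ℕ) (φ : Fin r → (Fin r → ℝ) → ℝ) (l : Fin r → ℝ) :
    riskExpr n p φ l = p + (n : ℝ)⁻¹ * steinOp n φ l := by
  unfold riskExpr steinOp
  ring

/-- All terms of the operator except the partial derivatives are linear over multiplication by the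
value ξ(l). A cutoff therefore costs only the gradient term, with no difference quotients of ξ. -/
theorem steinOp_mul {n : ℕ} {ξ : (Fin r → ℝ) → ℝ} {φ : Fin r → (Fin r → ℝ) → ℝ} {l : Fin r → ℝ}
    (hξ : DifferentiableAt ℝ ξ l) (hφ : ∀ k, DifferentiableAt ℝ (φ k) l) :
    steinOp n (fun k l => ξ l * φ k l) l =
      ξ l * steinOp n φ l + 2 * ∑ k, φ k l * partialDeriv k ξ l := by
  have h1 : ∀ k b, (ξ l * φ k l - ξ l * φ b l) / (l k - l b) =
      ξ l * ((φ k l - φ b l) / (l k - l b)) := fun k b => by ring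
  have h2 : ∀ k, ξ l * φ k l / l k = ξ l * (φ k l / l k) := fun k => by ring
  have h3 : ∀ k, partialDeriv k (fun l => ξ l * φ k l) l =
      φ k l * partialDeriv k ξ l + ξ l * partialDeriv k (φ k) l := fun k => by
    rw [partialDeriv_mul hξ (hφ k)]; ring
  unfold steinOp
  simp only [h1, h2, h3, Finset.sum_add_distrib, ← Finset.mul_sum]
  ring

/-- The quantity `[(n-r-2) ψ_k/l_k + 4 ∂ψ_k/∂l_k + 2 ∑_{b≠k} (ψ_k-ψ_b)/(l_k-l_b)] ψ_k`. -/
def steinQuad (n : ℕ) (ψ : Fin r → (Fin r → ℝ) → ℝ) (k : Fin r) (l : Fin r → ℝ) : ℝ :=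
  (((n : ℝ) - r - 2) * (ψ k l / l k) + 4 * partialDeriv k (ψ k) l +
    2 * ∑ b ∈ Finset.univ.erase k, (ψ k l - ψ b l) / (l k - l b)) * ψ k l

/-- The −2 in `psiStar` is there to absorb the cross term of the loss. -/
theorem steinQuad_eq {n : ℕ} (hn : n ≠ 0) (ψ : Fin r → (Fin r → ℝ) → ℝ) (k : Fin r)
    (l : Fin r → ℝ) : steinQuad n ψ k l = n * (psiStar n ψ k l + 2 * ψ k l) := by
  have hn' : (n : ℝ) ≠ 0 := Nat.cast_ne_zero.2 hn
  unfold steinQuad psiStar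
  field_simp
  ring

end Operators

/-! ### Specializing the spectral field to the two identities -/

section Identities

variable {n r : ℕ}

/-- The diagonal entry `(Hᵗ D⁻¹ H)_{kk}` with `D = diag(w²)`. -/
def invWeight (w : Fin r → ℝ) (S : Matrix (Fin r) (Fin r) ℝ) (k : Fin r) : ℝ :=
  (diagonal (fun a => (w a ^ 2)⁻¹) * eigenProj S k).trace

/-- `tr (D⁻¹ K D⁻¹ K)` with `K = K_d(S)`. -/
def quadWeight (w : Fin r → ℝ) (S : Matrix (Fin r) (Fin r) ℝ) (d : Fin r → ℝ) : ℝ :=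
  (diagonal (fun a => (w a ^ 2)⁻¹) * spectralSum S d *
    (diagonal (fun a => (w a ^ 2)⁻¹) * spectralSum S d)).trace

theorem trace_mul_spectralSum (A S : Matrix (Fin r) (Fin r) ℝ) (d : Fin r → ℝ) :
    (A * spectralSum S d).trace = ∑ k, d k * (A * eigenProj S k).trace := by
  rw [spectralSum, Finset.mul_sum, trace_sum]
  exact Finset.sum_congr rfl fun k _ => by rw [Matrix.mul_smul, trace_smul, smul_eq_mul]

theorem IsSimpleSpectrum.spectralSum_one {S : Matrix (Fin r) (Fin r) ℝ} (h : IsSimpleSpectrum S) :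
    spectralSum S (fun _ => 1) = 1 := by
  simp [spectralSum, h.sum_eigenProj]

theorem IsSimpleSpectrum.mul_spectralSum {S : Matrix (Fin r) (Fin r) ℝ} (h : IsSimpleSpectrum S)
    (d : Fin r → ℝ) : S * spectralSum S d = spectralSum S (fun k => eigs S k * d k) := by
  conv_rhs => rw [← h.spectralSum_mul_spectralSum]
  exact congrArg (· * spectralSum S d) h.eq_sum

/-- (φ_k/l_k − φ_b/l_b) l_b = (φ_k − φ_b) − (φ_k/l_k)(l_k − l_b), which over the r − 1 indices b
costs (r − 1) φ_k/l_k. Differentiating 1/l_k costs another 2 φ_k/l_k, so n − 1 becomes n − r − 2. -/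
theorem spectralDiv_one {S : Matrix (Fin r) (Fin r) ℝ} (h : IsSimpleSpectrum S)
    {φ : Fin r → (Fin r → ℝ) → ℝ} (hφ : ∀ k, DifferentiableOn ℝ (φ k) (strictChamber r)) :
    spectralDiv n 1 (fun k l => φ k l / l k) (fun _ _ => 1) S = steinOp n φ (eigs S) := by
  have hl := h.eigs_mem
  unfold spectralDiv steinOp
  set l := eigs S
  have e1 : ∀ k, partialDeriv k (fun l => φ k l / l k) l =
      partialDeriv k (φ k) l / l k - φ k l / l k ^ 2 := fun k =>
    partialDeriv_div_apply ((hφ k).differentiableAt (isOpen_strictChamber.mem_nhds hl)) (hl.2 k).ne'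
  have e2 : ∀ k, ∑ b ∈ Finset.univ.erase k, ((φ k l / l k - φ b l / l b) / (l k - l b) *
      (l b * 1) + (1 - 1) / (l k - l b) * (l k * (φ k l / l k))) =
      ∑ b ∈ Finset.univ.erase k, (φ k l - φ b l) / (l k - l b) - ((r : ℝ) - 1) * (φ k l / l k) := by
    intro k
    have hr : (r : ℝ) - 1 = ((Finset.univ.erase k).card : ℝ) := by
      rw [Finset.card_erase_of_mem (Finset.mem_univ k), Finset.card_univ, Fintype.card_fin,
        Nat.cast_sub (by have := k.2; omega), Nat.cast_one]
    rw [hr, ← nsmul_eq_mul, ← Finset.sum_const, ← Finset.sum_sub_distrib]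
    refine Finset.sum_congr rfl fun b hb => ?_
    have h1 := (hl.2 k).ne'
    have h2 := (hl.2 b).ne'
    have h3 := sub_ne_zero.2 (strictChamber_ne hl (Finset.ne_of_mem_erase hb).symm)
    field_simp
    ring
  simp only [h.trace_eigenProj, one_mul, e1, e2, partialDeriv_const]
  simp only [mul_one, mul_zero, add_zero, Finset.mul_sum, ← Finset.sum_add_distrib]
  refine Finset.sum_congr rfl fun k _ => ?_
  have h1 := (hl.2 k).ne'
  field_simp
  ring

theorem trace_field_one {w : Fin r → ℝ} {S : Matrix (Fin r) (Fin r) ℝ} (h : IsSimpleSpectrum S)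
    (φ : Fin r → (Fin r → ℝ) → ℝ) :
    (diagonal (fun a => (w a ^ 2)⁻¹) * S *
      spectralField 1 (fun k l => φ k l / l k) (fun _ _ => 1) S).trace =
      ∑ k, φ k (eigs S) * invWeight w S k := by
  rw [spectralField, h.spectralSum_one, Matrix.mul_one, Matrix.mul_one, Matrix.mul_assoc,
    h.mul_spectralSum, trace_mul_spectralSum]
  refine Finset.sum_congr rfl fun k _ => ?_
  rw [mul_div_cancel₀ _ (h.eigs_mem.2 k).ne']
  rfl

/-- First Stein identity, for compactly supported functions of the eigenvalues. -/
theorem integral_steinOp_of_compact [NeZero r] (hrn : r ≤ n - 1) (hn : n ≠ 0) {w : Fin r → ℝ}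
    (hw : ∀ a, w a ≠ 0) {φ : Fin r → (Fin r → ℝ) → ℝ} {K : Set (Fin r → ℝ)}
    (hK : IsCompact K) (hKs : K ⊆ strictChamber r) (hφ0 : ∀ k, ∀ l ∉ K, φ k l = 0)
    (hφ : ∀ k, DifferentiableOn ℝ (φ k) (strictChamber r))
    (hint : Integrable (fun z => steinOp n φ (eigs (scatter w z)))
      (stdGaussianPi (Fin n × Fin r))) :
    ∫ z, steinOp n φ (eigs (scatter w z)) ∂(stdGaussianPi (Fin n × Fin r)) =
      ∫ z, n * ∑ k, φ k (eigs (scatter w z)) * invWeight w (scatter w z) k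
        ∂(stdGaussianPi (Fin n × Fin r)) := by
  have hae := ae_isSimpleSpectrum hrn hn hw
  have e1 : (fun z => spectralDiv n 1 (fun k l => φ k l / l k) (fun _ _ => 1) (scatter w z)) =ᵐ[
      stdGaussianPi (Fin n × Fin r)] fun z => steinOp n φ (eigs (scatter w z)) :=
    hae.mono fun z hz => spectralDiv_one hz hφ
  have key := integral_spectralDiv (n := n) hn hw 1 (κ := fun k l => φ k l / l k)
    (φ := fun _ _ => 1) hK hKs (fun k l hl => by simp [hφ0 k l hl])
    (fun k => differentiableOn_div_apply (hφ k) k)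
    (fun k => differentiableOn_const _) (hint.congr e1.symm)
  rw [integral_congr_ae e1] at key
  rw [key]
  refine integral_congr_ae (hae.mono fun z hz => ?_)
  change (n : ℝ) * _ = n * _
  rw [trace_field_one hz]

/-- The count of `spectralDiv_one` applies again. Both factors now contribute a derivative and a
difference quotient of ψ, which doubles these coefficients to 4 and 2, while ξ is differentiated
only once. -/
theorem spectralDiv_quad {w : Fin r → ℝ} {S : Matrix (Fin r) (Fin r) ℝ} (h : IsSimpleSpectrum S)
    {ξ : (Fin r → ℝ) → ℝ} {ψ : Fin r → (Fin r → ℝ) → ℝ}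
    (hξ : DifferentiableOn ℝ ξ (strictChamber r))
    (hψ : ∀ k, DifferentiableOn ℝ (ψ k) (strictChamber r)) :
    spectralDiv n (diagonal fun a => (w a ^ 2)⁻¹) (fun k l => ξ l * ψ k l / l k) ψ S =
      ∑ k, invWeight w S k * (ξ (eigs S) * steinQuad n ψ k (eigs S) +
        2 * ψ k (eigs S) ^ 2 * partialDeriv k ξ (eigs S)) := by
  have hl := h.eigs_mem
  unfold spectralDiv steinQuad
  set l := eigs S
  have hξl := hξ.differentiableAt (isOpen_strictChamber.mem_nhds hl)
  have hψl := fun k => (hψ k).differentiableAt (isOpen_strictChamber.mem_nhds hl)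
  refine Finset.sum_congr rfl fun k _ => ?_
  rw [invWeight]
  congr 1
  have h1 := (hl.2 k).ne'
  rw [partialDeriv_div_apply (f := fun l => ξ l * ψ k l) (hξl.mul (hψl k)) h1,
    partialDeriv_mul hξl (hψl k)]
  have e2 : ∑ b ∈ Finset.univ.erase k, ((ξ l * ψ k l / l k - ξ l * ψ b l / l b) / (l k - l b) *
      (l b * ψ k l) + (ψ k l - ψ b l) / (l k - l b) * (l k * (ξ l * ψ k l / l k))) =
      2 * ξ l * ψ k l * ∑ b ∈ Finset.univ.erase k, (ψ k l - ψ b l) / (l k - l b) -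
        ((r : ℝ) - 1) * (ξ l * ψ k l * ψ k l / l k) := by
    have hr : (r : ℝ) - 1 = ((Finset.univ.erase k).card : ℝ) := by
      rw [Finset.card_erase_of_mem (Finset.mem_univ k), Finset.card_univ, Fintype.card_fin,
        Nat.cast_sub (by have := k.2; omega), Nat.cast_one]
    rw [hr, ← nsmul_eq_mul, ← Finset.sum_const, Finset.mul_sum, ← Finset.sum_sub_distrib]
    refine Finset.sum_congr rfl fun b hb => ?_
    have h2 := (hl.2 b).ne'
    have h3 := sub_ne_zero.2 (strictChamber_ne hl (Finset.ne_of_mem_erase hb).symm)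
    field_simp
    ring
  rw [e2]
  field_simp
  ring

theorem trace_field_quad {w : Fin r → ℝ} {S : Matrix (Fin r) (Fin r) ℝ} (h : IsSimpleSpectrum S)
    (ξ : (Fin r → ℝ) → ℝ) (ψ : Fin r → (Fin r → ℝ) → ℝ) :
    (diagonal (fun a => (w a ^ 2)⁻¹) * S *
      spectralField (diagonal fun a => (w a ^ 2)⁻¹) (fun k l => ξ l * ψ k l / l k) ψ S).trace =
      ξ (eigs S) * quadWeight w S (fun k => ψ k (eigs S)) := by
  have e : spectralSum S (fun k => eigs S k * (ξ (eigs S) * ψ k (eigs S) / eigs S k)) =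
      ξ (eigs S) • spectralSum S (fun k => ψ k (eigs S)) := by
    rw [spectralSum, spectralSum, Finset.smul_sum]
    refine Finset.sum_congr rfl fun k _ => ?_
    rw [smul_smul, mul_div_cancel₀ _ (h.eigs_mem.2 k).ne']
  rw [spectralField, quadWeight, Matrix.mul_assoc, ← Matrix.mul_assoc S, ← Matrix.mul_assoc S,
    h.mul_spectralSum, e, Matrix.smul_mul, Matrix.smul_mul, Matrix.mul_smul, trace_smul,
    smul_eq_mul]
  simp only [Matrix.mul_assoc]

/-- Second Stein identity, with a compactly supported cutoff function of the eigenvalues. -/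
theorem integral_steinQuad_of_compact [NeZero r] (hrn : r ≤ n - 1) (hn : n ≠ 0) {w : Fin r → ℝ}
    (hw : ∀ a, w a ≠ 0) {ξ : (Fin r → ℝ) → ℝ} {ψ : Fin r → (Fin r → ℝ) → ℝ} {K : Set (Fin r → ℝ)}
    (hK : IsCompact K) (hKs : K ⊆ strictChamber r) (hξ0 : ∀ l ∉ K, ξ l = 0)
    (hξ : DifferentiableOn ℝ ξ (strictChamber r))
    (hψ : ∀ k, DifferentiableOn ℝ (ψ k) (strictChamber r))
    (hint : Integrable (fun z => ∑ k, invWeight w (scatter w z) k *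
      (ξ (eigs (scatter w z)) * steinQuad n ψ k (eigs (scatter w z)) +
        2 * ψ k (eigs (scatter w z)) ^ 2 * partialDeriv k ξ (eigs (scatter w z))))
      (stdGaussianPi (Fin n × Fin r))) :
    ∫ z, ∑ k, invWeight w (scatter w z) k *
      (ξ (eigs (scatter w z)) * steinQuad n ψ k (eigs (scatter w z)) +
        2 * ψ k (eigs (scatter w z)) ^ 2 * partialDeriv k ξ (eigs (scatter w z)))
        ∂(stdGaussianPi (Fin n × Fin r)) =
      ∫ z, n * (ξ (eigs (scatter w z)) * quadWeight w (scatter w z)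
        (fun k => ψ k (eigs (scatter w z)))) ∂(stdGaussianPi (Fin n × Fin r)) := by
  have hae := ae_isSimpleSpectrum hrn hn hw
  have e1 := hae.mono fun z hz => spectralDiv_quad (n := n) (w := w) hz hξ hψ
  have key := integral_spectralDiv (n := n) hn hw (diagonal fun a => (w a ^ 2)⁻¹)
    (κ := fun k l => ξ l * ψ k l / l k) (φ := ψ) hK hKs (fun k l hl => by simp [hξ0 l hl])
    (fun k => differentiableOn_div_apply (hξ.fun_mul (hψ k)) k) hψ (hint.congr (e1.mono fun z hz => hz.symm))
  rw [integral_congr_ae e1] at key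
  rw [key]
  refine integral_congr_ae (hae.mono fun z hz => ?_)
  change (n : ℝ) * _ = n * _
  rw [trace_field_quad hz]

end Identities

end

noncomputable section

open Filter Topology

/-! ### A logarithmic energy on the chamber of distinct positive eigenvalues -/

section Energy

variable {r : ℕ}

/-- A function tending to infinity at the boundary of the chamber of distinct positive
eigenvalues. -/
def energy (l : Fin r → ℝ) : ℝ :=
  ((r : ℝ) ^ 2 + r + 1) * ∑ k, l k - ∑ k, Real.log (l k) -
    2⁻¹ * ∑ k, ∑ b ∈ Finset.univ.erase k, Real.log (l k - l b)

/-- The partial derivatives of `energy`. -/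
def energyGrad (k : Fin r) (l : Fin r → ℝ) : ℝ :=
  ((r : ℝ) ^ 2 + r + 1) - (l k)⁻¹ - ∑ b ∈ Finset.univ.erase k, (l k - l b)⁻¹

theorem apply_le_sum {l : Fin r → ℝ} (hl : l ∈ strictChamber r) (k : Fin r) : l k ≤ ∑ b, l b :=
  Finset.single_le_sum (fun b _ => (hl.2 b).le) (Finset.mem_univ k)

/-- `Real.log` is even, so the sign of l_k − l_b is immaterial, and |l_k − l_b| is at most the sum
of the eigenvalues. -/
theorem log_sub_le_sum {l : Fin r → ℝ} (hl : l ∈ strictChamber r) (k b : Fin r) :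
    Real.log (l k - l b) ≤ ∑ b, l b := by
  rw [← Real.log_abs]
  refine (Real.log_le_self (abs_nonneg _)).trans (abs_le.2 ⟨?_, ?_⟩)
  · linarith [apply_le_sum hl b, (hl.2 k).le]
  · linarith [apply_le_sum hl k, (hl.2 b).le]

theorem log_apply_le_sum {l : Fin r → ℝ} (hl : l ∈ strictChamber r) (k : Fin r) :
    Real.log (l k) ≤ ∑ b, l b :=
  (Real.log_le_self (hl.2 k).le).trans (apply_le_sum hl k)

theorem sum_pos_of_mem {l : Fin r → ℝ} (hl : l ∈ strictChamber r) : 0 ≤ ∑ b, l b :=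
  Finset.sum_nonneg fun b _ => (hl.2 b).le

theorem sum_log_sub_le {l : Fin r → ℝ} (hl : l ∈ strictChamber r) :
    ∑ k, ∑ b ∈ Finset.univ.erase k, (∑ c, l c - Real.log (l k - l b)) ≤
      (r : ℝ) ^ 2 * ∑ c, l c - ∑ k, ∑ b ∈ Finset.univ.erase k, Real.log (l k - l b) := by
  have hs := sum_pos_of_mem hl
  have h : ∀ k : Fin r, ∑ b ∈ Finset.univ.erase k, ∑ c, l c ≤ (r : ℝ) * ∑ c, l c := by
    intro k
    rw [Finset.sum_const, nsmul_eq_mul]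
    refine mul_le_mul_of_nonneg_right ?_ hs
    have := Finset.card_le_univ (Finset.univ.erase k)
    rw [Fintype.card_fin] at this
    exact_mod_cast this
  have h2 := Finset.sum_le_sum fun k (_ : k ∈ Finset.univ) => h k
  simp only [Finset.sum_const, Finset.card_univ, Fintype.card_fin, nsmul_eq_mul] at h2
  simp only [Finset.sum_sub_distrib, Finset.sum_const, nsmul_eq_mul]
  nlinarith [h2]

/-- Each logarithm is at most ∑ l_c. The coefficient r² + r + 1 provides one copy of ∑ l_c for each
of them and leaves at least one over, so the energy dominates a sum of nonnegative terms. All lower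
bounds for the energy are read off from this. -/
theorem sum_add_le_energy {l : Fin r → ℝ} (hl : l ∈ strictChamber r) :
    ∑ c, l c + ∑ k, (∑ c, l c - Real.log (l k)) +
      2⁻¹ * ∑ k, ∑ b ∈ Finset.univ.erase k, (∑ c, l c - Real.log (l k - l b)) ≤ energy l := by
  have h1 := sum_log_sub_le hl
  have hs := sum_pos_of_mem hl
  have h2 : 0 ≤ (r : ℝ) ^ 2 * ∑ c, l c := by positivity
  have e : ∑ k, (∑ c, l c - Real.log (l k)) = r * ∑ c, l c - ∑ k, Real.log (l k) := by
    rw [Finset.sum_sub_distrib, Finset.sum_const, Finset.card_univ, Fintype.card_fin, nsmul_eq_mul]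
  rw [e]
  unfold energy
  linarith

theorem sum_le_energy {l : Fin r → ℝ} (hl : l ∈ strictChamber r) : ∑ k, l k ≤ energy l := by
  have h := sum_add_le_energy hl
  have h1 : 0 ≤ ∑ k, (∑ c, l c - Real.log (l k)) :=
    Finset.sum_nonneg fun k _ => sub_nonneg.2 (log_apply_le_sum hl k)
  have h2 : 0 ≤ ∑ k, ∑ b ∈ Finset.univ.erase k, (∑ c, l c - Real.log (l k - l b)) :=
    Finset.sum_nonneg fun k _ => Finset.sum_nonneg fun b _ => sub_nonneg.2 (log_sub_le_sum hl k b)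
  linarith

theorem energy_nonneg {l : Fin r → ℝ} (hl : l ∈ strictChamber r) : 0 ≤ energy l :=
  (sum_pos_of_mem hl).trans (sum_le_energy hl)

theorem neg_log_le_energy {l : Fin r → ℝ} (hl : l ∈ strictChamber r) (k : Fin r) :
    -Real.log (l k) ≤ energy l := by
  have h := sum_add_le_energy hl
  have h1 : ∑ c, l c - Real.log (l k) ≤ ∑ k, (∑ c, l c - Real.log (l k)) :=
    Finset.single_le_sum (f := fun k => ∑ c, l c - Real.log (l k))
      (fun k _ => sub_nonneg.2 (log_apply_le_sum hl k)) (Finset.mem_univ k)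
  have h2 : 0 ≤ ∑ k, ∑ b ∈ Finset.univ.erase k, (∑ c, l c - Real.log (l k - l b)) :=
    Finset.sum_nonneg fun k _ => Finset.sum_nonneg fun b _ => sub_nonneg.2 (log_sub_le_sum hl k b)
  linarith [sum_pos_of_mem hl]

/-- The factor 2 undoes the 2⁻¹ in the energy, since only one of the two orderings of the pair is
used. -/
theorem neg_log_sub_le_energy {l : Fin r → ℝ} (hl : l ∈ strictChamber r) {k b : Fin r}
    (hkb : k ≠ b) : -Real.log (l k - l b) ≤ 2 * energy l := by
  have h := sum_add_le_energy hl
  have h1 : 0 ≤ ∑ k, (∑ c, l c - Real.log (l k)) :=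
    Finset.sum_nonneg fun k _ => sub_nonneg.2 (log_apply_le_sum hl k)
  have h2 : ∑ c, l c - Real.log (l k - l b) ≤
      ∑ b ∈ Finset.univ.erase k, (∑ c, l c - Real.log (l k - l b)) :=
    Finset.single_le_sum (f := fun b => ∑ c, l c - Real.log (l k - l b))
      (fun b _ => sub_nonneg.2 (log_sub_le_sum hl k b))
      (Finset.mem_erase.2 ⟨hkb.symm, Finset.mem_univ b⟩)
  have h3 : ∑ b ∈ Finset.univ.erase k, (∑ c, l c - Real.log (l k - l b)) ≤
      ∑ k, ∑ b ∈ Finset.univ.erase k, (∑ c, l c - Real.log (l k - l b)) :=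
    Finset.single_le_sum
      (f := fun k => ∑ b ∈ Finset.univ.erase k, (∑ c, l c - Real.log (l k - l b)))
      (fun k _ => Finset.sum_nonneg fun b _ => sub_nonneg.2 (log_sub_le_sum hl k b))
      (Finset.mem_univ k)
  linarith [sum_pos_of_mem hl]

/-- A compact part of the chamber of distinct positive eigenvalues. -/
def chamberBox (r : ℕ) (M : ℝ) : Set (Fin r → ℝ) :=
  {l | (∀ k, l k ∈ Set.Icc (Real.exp (-M)) M) ∧
    ∀ k b, k < b → l b + Real.exp (-(2 * M)) ≤ l k}

theorem isCompact_chamberBox (M : ℝ) : IsCompact (chamberBox r M) := by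
  have h1 : IsCompact (Set.univ.pi fun _ : Fin r => Set.Icc (Real.exp (-M)) M) :=
    isCompact_univ_pi fun _ => isCompact_Icc
  have h2 : IsClosed {l : Fin r → ℝ | ∀ k b, k < b → l b + Real.exp (-(2 * M)) ≤ l k} := by
    simp only [Set.ofPred_forall]
    exact isClosed_iInter fun k => isClosed_iInter fun b => isClosed_iInter fun _ =>
      isClosed_le (by fun_prop) (by fun_prop)
  convert! h1.inter_right h2 using 1
  ext l
  simp [chamberBox, Pi.le_def, forall_and]

theorem chamberBox_subset (M : ℝ) : chamberBox r M ⊆ strictChamber r := fun l hl =>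
  ⟨fun k b hkb => by linarith [hl.2 k b hkb, Real.exp_pos (-(2 * M))],
    fun k => (Real.exp_pos _).trans_le (hl.1 k).1⟩

/-- The energy bounds ∑ l_c, −log l_k and, up to a factor 2, −log(l_k − l_b). Its sublevel sets thus
stay at positive distance from every wall and from infinity. -/
theorem mem_chamberBox {l : Fin r → ℝ} (hl : l ∈ strictChamber r) {M : ℝ} (hM : energy l ≤ M) :
    l ∈ chamberBox r M := by
  refine ⟨fun k => ⟨?_, ?_⟩, fun k b hkb => ?_⟩
  · rw [← Real.le_log_iff_exp_le (hl.2 k)]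
    linarith [neg_log_le_energy hl k]
  · exact (apply_le_sum hl k).trans ((sum_le_energy hl).trans hM)
  · have h : Real.exp (-(2 * M)) ≤ l k - l b := by
      rw [← Real.le_log_iff_exp_le (sub_pos.2 (hl.1 hkb))]
      linarith [neg_log_sub_le_energy hl hkb.ne]
    linarith

/-- The `k`-th coordinate as a continuous linear form. -/
abbrev coordProj (k : Fin r) : (Fin r → ℝ) →L[ℝ] ℝ := ContinuousLinearMap.proj k

theorem hasFDerivAt_energy {l : Fin r → ℝ} (hl : l ∈ strictChamber r) :
    HasFDerivAt energy (((r : ℝ) ^ 2 + r + 1) • ∑ k, coordProj k -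
      ∑ k, (l k)⁻¹ • coordProj k -
      (2⁻¹ : ℝ) • ∑ k, ∑ b ∈ Finset.univ.erase k, (l k - l b)⁻¹ •
        (coordProj k - coordProj b) :
        (Fin r → ℝ) →L[ℝ] ℝ) l := by
  have hp : ∀ k, HasFDerivAt (fun l : Fin r → ℝ => l k)
      (coordProj k) l := fun k => hasFDerivAt_apply k l
  unfold energy
  refine HasFDerivAt.fun_sub (HasFDerivAt.fun_sub ?_ ?_) ?_
  · exact (HasFDerivAt.fun_sum fun k _ => hp k).const_mul _
  · exact HasFDerivAt.fun_sum fun k _ => (hp k).log (hl.2 k).ne'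
  · refine HasFDerivAt.const_mul (HasFDerivAt.fun_sum fun k _ => HasFDerivAt.fun_sum fun b hb => ?_) _
    exact ((hp k).fun_sub (hp b)).log
      (sub_ne_zero.2 (strictChamber_ne hl (Finset.ne_of_mem_erase hb).symm))

theorem partialDeriv_energy {l : Fin r → ℝ} (hl : l ∈ strictChamber r) (k : Fin r) :
    partialDeriv k energy l = energyGrad k l := by
  have h := hasFDerivAt_energy hl
  rw [partialDeriv_eq_fderiv h.differentiableAt, h.fderiv]
  have e1 : ∑ a, ∑ b ∈ Finset.univ.erase a, (l a - l b)⁻¹ *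
      ((Pi.single k 1 : Fin r → ℝ) a - (Pi.single k 1 : Fin r → ℝ) b) =
      2 * ∑ b ∈ Finset.univ.erase k, (l k - l b)⁻¹ := by
    simp only [mul_sub, Finset.sum_sub_distrib]
    rw [sum_erase_swap (fun a b => (l a - l b)⁻¹ * (Pi.single k 1 : Fin r → ℝ) b)]
    simp only [← Finset.sum_mul]
    simp only [← Finset.sum_sub_distrib, ← sub_mul]
    rw [Finset.sum_eq_single k (fun b _ hb => by simp [hb]) (by simp), Finset.mul_sum,
      Pi.single_eq_same, mul_one]
    refine Finset.sum_congr rfl fun b _ => ?_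
    rw [← neg_sub (l k) (l b), inv_neg]
    ring
  simp only [_root_.sub_apply, _root_.smul_apply,
    _root_.sum_apply, ContinuousLinearMap.proj_apply, smul_eq_mul, e1, energyGrad]
  rw [Finset.sum_eq_single k (fun b _ hb => by simp [hb]) (by simp),
    Finset.sum_eq_single k (fun b _ hb => by simp [hb]) (by simp)]
  simp

theorem continuousOn_energyGrad (k : Fin r) : ContinuousOn (energyGrad k) (strictChamber r) := by
  unfold energyGrad
  refine (continuousOn_const.sub ?_).sub (continuousOn_finsetSum _ fun b hb => ?_)
  · exact (continuous_apply k).continuousOn.inv₀ fun l hl => (hl.2 k).ne'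
  · exact ContinuousOn.inv₀ (by fun_prop) fun l hl =>
      sub_ne_zero.2 (strictChamber_ne hl (Finset.ne_of_mem_erase hb).symm)

/-- A function of the energy, extended by zero outside the chamber. -/
def chamberCutoff (r : ℕ) (q : ℝ → ℝ) : (Fin r → ℝ) → ℝ :=
  (strictChamber r).indicator fun l => q (energy l)

theorem chamberCutoff_of_mem {q : ℝ → ℝ} {l : Fin r → ℝ} (hl : l ∈ strictChamber r) :
    chamberCutoff r q l = q (energy l) := Set.indicator_of_mem hl _

theorem chamberCutoff_eq_zero {q : ℝ → ℝ} {M : ℝ} (hq : ∀ t, M < t → q t = 0) {l : Fin r → ℝ}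
    (hl : l ∉ chamberBox r M) : chamberCutoff r q l = 0 := by
  by_cases h : l ∈ strictChamber r
  · rw [chamberCutoff_of_mem h]
    exact hq _ (lt_of_not_ge fun h' => hl (mem_chamberBox h h'))
  · exact Set.indicator_of_notMem h _

theorem hasFDerivAt_chamberCutoff {q : ℝ → ℝ} (hq : Differentiable ℝ q) {l : Fin r → ℝ}
    (hl : l ∈ strictChamber r) :
    HasFDerivAt (chamberCutoff r q) (deriv q (energy l) • fderiv ℝ energy l) l := by
  have h := HasDerivAt.comp_hasFDerivAt (h₂ := q) l (hq (energy l)).hasDerivAt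
    (hasFDerivAt_energy hl).differentiableAt.hasFDerivAt
  refine h.congr_of_eventuallyEq ?_
  filter_upwards [isOpen_strictChamber.mem_nhds hl] with y hy using chamberCutoff_of_mem hy

theorem differentiableOn_chamberCutoff {q : ℝ → ℝ} (hq : Differentiable ℝ q) :
    DifferentiableOn ℝ (chamberCutoff r q) (strictChamber r) := fun _ hl =>
  (hasFDerivAt_chamberCutoff hq hl).differentiableAt.differentiableWithinAt

theorem partialDeriv_chamberCutoff {q : ℝ → ℝ} (hq : Differentiable ℝ q) {l : Fin r → ℝ}
    (hl : l ∈ strictChamber r) (k : Fin r) :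
    partialDeriv k (chamberCutoff r q) l = deriv q (energy l) * energyGrad k l := by
  have h := hasFDerivAt_chamberCutoff hq hl
  rw [partialDeriv_eq_fderiv h.differentiableAt, h.fderiv, _root_.smul_apply,
    ← partialDeriv_eq_fderiv (hasFDerivAt_energy hl).differentiableAt, partialDeriv_energy hl,
    smul_eq_mul]

end Energy

/-! ### The Stein operator on the gradient field of the energy -/

section EnergyField

variable {r : ℕ}

/-- The field `-l_k² ∂_k energy`. -/
def energyField (k : Fin r) (l : Fin r → ℝ) : ℝ := -(l k ^ 2 * energyGrad k l)

theorem hasDerivAt_energyField {l : Fin r → ℝ} (hl : l ∈ strictChamber r) (k : Fin r) :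
    partialDeriv k (energyField k) l = 1 - 2 * ((r : ℝ) ^ 2 + r + 1) * l k +
      ∑ b ∈ Finset.univ.erase k, (2 * l k * (l k - l b)⁻¹ - l k ^ 2 * (l k - l b)⁻¹ ^ 2) := by
  unfold partialDeriv
  have e : ∀ t : ℝ, energyField k (Function.update l k t) =
      -(t ^ 2 * (((r : ℝ) ^ 2 + r + 1) - t⁻¹ - ∑ b ∈ Finset.univ.erase k, (t - l b)⁻¹)) := by
    intro t
    unfold energyField energyGrad
    rw [Function.update_self]
    congr 3
    exact Finset.sum_congr rfl fun b hb => by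
      rw [Function.update_of_ne (Finset.ne_of_mem_erase hb)]
  simp only [e]
  have h0 := (hl.2 k).ne'
  have hs : HasDerivAt (fun t : ℝ => ∑ b ∈ Finset.univ.erase k, (t - l b)⁻¹)
      (∑ b ∈ Finset.univ.erase k, -(l k - l b)⁻¹ ^ 2) (l k) := by
    refine HasDerivAt.fun_sum fun b hb => ?_
    have h1 := sub_ne_zero.2 (strictChamber_ne hl (Finset.ne_of_mem_erase hb).symm)
    have := ((hasDerivAt_id (l k)).sub_const (l b)).fun_inv h1
    convert! this using 1
    simp only [id]
    field_simp
  have h2 := ((hasDerivAt_pow 2 (l k)).fun_mul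
    (((hasDerivAt_inv h0).const_sub ((r : ℝ) ^ 2 + r + 1)).fun_sub hs)).fun_neg
  rw [h2.deriv]
  simp only [Finset.sum_sub_distrib, ← Finset.mul_sum, Finset.sum_neg_distrib]
  push_cast
  field_simp
  ring

/-- The left side is the second divided difference of t² at x, y, z, that is, its leading
coefficient. -/
theorem cyclic_inv_identity {x y z : ℝ} (hxy : x ≠ y) (hyz : y ≠ z) (hxz : x ≠ z) :
    x ^ 2 * (x - y)⁻¹ * (x - z)⁻¹ + y ^ 2 * (y - z)⁻¹ * (y - x)⁻¹ +
      z ^ 2 * (z - x)⁻¹ * (z - y)⁻¹ = 1 := by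
  have h1 := sub_ne_zero.2 hxy
  have h2 := sub_ne_zero.2 hyz
  have h3 := sub_ne_zero.2 hxz
  have h4 : y - x ≠ 0 := sub_ne_zero.2 hxy.symm
  have h5 : z - y ≠ 0 := sub_ne_zero.2 hyz.symm
  have h6 : z - x ≠ 0 := sub_ne_zero.2 hxz.symm
  rw [← neg_sub x y, ← neg_sub x z, ← neg_sub y z]
  simp only [inv_neg]
  field_simp
  ring

/-- Up to a bounded term, only the diagonal of the triple sum `∑ l_k²/((l_k-l_b)(l_k-l_c))`
matters. -/
theorem abs_triple_sum_le {l : Fin r → ℝ} (hl : l ∈ strictChamber r) :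
    |∑ k, l k ^ 2 * (∑ b ∈ Finset.univ.erase k, (l k - l b)⁻¹) ^ 2 -
      ∑ k, ∑ b ∈ Finset.univ.erase k, l k ^ 2 * (l k - l b)⁻¹ ^ 2| ≤ (r : ℝ) ^ 3 := by
  -- The term b = k can be restored freely, because 0⁻¹ = 0.
  have e1 : ∀ k, ∑ b ∈ Finset.univ.erase k, (l k - l b)⁻¹ = ∑ b, (l k - l b)⁻¹ := fun k =>
    Finset.sum_erase _ (by simp)
  have e2 : ∀ k, ∑ b ∈ Finset.univ.erase k, l k ^ 2 * (l k - l b)⁻¹ ^ 2 =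
      ∑ b, l k ^ 2 * (l k - l b)⁻¹ ^ 2 := fun k => Finset.sum_erase _ (by simp)
  simp only [e1, e2]
  set f : Fin r → Fin r → Fin r → ℝ := fun k b c => l k ^ 2 * (l k - l b)⁻¹ * (l k - l c)⁻¹ with hf
  set q : Fin r → Fin r → ℝ := fun k b => l k ^ 2 * (l k - l b)⁻¹ ^ 2 with hq
  have e3 : ∑ k, l k ^ 2 * (∑ b, (l k - l b)⁻¹) ^ 2 = ∑ k, ∑ b, ∑ c, f k b c := by
    refine Finset.sum_congr rfl fun k _ => ?_
    rw [sq (∑ b, _), Finset.sum_mul_sum, Finset.mul_sum]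
    refine Finset.sum_congr rfl fun b _ => ?_
    rw [Finset.mul_sum]
    exact Finset.sum_congr rfl fun c _ => by simp only [hf]; ring
  have c1 : ∑ k, ∑ b, ∑ c, f b c k = ∑ k, ∑ b, ∑ c, f k b c := by
    rw [Finset.sum_comm]
    exact Finset.sum_congr rfl fun b _ => Finset.sum_comm
  have c2 : ∑ k, ∑ b, ∑ c, f c k b = ∑ k, ∑ b, ∑ c, f k b c := by
    rw [Finset.sum_congr rfl fun k _ => Finset.sum_comm]
    exact Finset.sum_comm
  have d1 : ∑ k, ∑ b, ∑ c, (if b = c then q k b else 0) = ∑ k, ∑ b, q k b := by simp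
  have d2 : ∑ k, ∑ b, ∑ c, (if c = k then q b k else 0) = ∑ k, ∑ b, q k b := by
    simp only [Finset.sum_ite_eq', Finset.mem_univ, if_true]
    exact Finset.sum_comm
  have d3 : ∑ k, ∑ b, ∑ c, (if k = b then q c k else 0) = ∑ k, ∑ b, q k b := by
    rw [Finset.sum_congr rfl fun k _ => Finset.sum_comm]
    simp only [Finset.sum_ite_eq, Finset.mem_univ, if_true]
    exact Finset.sum_comm
  have z1 : ∀ k b, f k b b = q k b := fun k b => by simp only [hf, hq]; rw [sq (l k - l b)⁻¹, mul_assoc]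
  have z2 : ∀ k b, f k k b = 0 := fun k b => by simp [hf]
  have z3 : ∀ k b, f k b k = 0 := fun k b => by simp [hf]
  -- Symmetrize over the three rotations of (k, b, c). For distinct indices the sum is 1 by
  -- `cyclic_inv_identity`; if exactly two coincide the only surviving term is a double pole, which
  -- is subtracted; if all coincide everything is 0.
  have hpt : ∀ k b c, 0 ≤ f k b c + f b c k + f c k b - ((if b = c then q k b else 0) +
      (if c = k then q b k else 0) + (if k = b then q c k else 0)) ∧
      f k b c + f b c k + f c k b - ((if b = c then q k b else 0) +
      (if c = k then q b k else 0) + (if k = b then q c k else 0)) ≤ 1 := by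
    intro k b c
    by_cases h1 : b = c
    · subst h1
      by_cases h2 : b = k
      · subst h2; simp [hf, hq]
      · have h2' : ¬ k = b := fun h => h2 h.symm
        have : f k b b + f b b k + f b k b - q k b = 0 := by rw [z1, z2, z3]; ring
        simp [h2, h2', this]
    · by_cases h2 : c = k
      · subst h2
        have h2' : ¬ c = b := fun h => h1 h.symm
        have : f c b c + f b c c + f c c b - q b c = 0 := by rw [z1, z2, z3]; ring
        simp [h1, h2', this]
      · by_cases h3 : k = b
        · subst h3
          have : f k k c + f k c k + f c k k - q c k = 0 := by rw [z1, z2, z3]; ring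
          simp [h1, h2, this]
        · have : f k b c + f b c k + f c k b = 1 := by
            exact cyclic_inv_identity (strictChamber_ne hl h3) (strictChamber_ne hl h1)
              (strictChamber_ne hl fun h => h2 h.symm)
          simp [h1, h2, h3, this]
  have hsum : ∑ k, ∑ b, ∑ c, (f k b c + f b c k + f c k b - ((if b = c then q k b else 0) +
      (if c = k then q b k else 0) + (if k = b then q c k else 0))) =
      3 * (∑ k, ∑ b, ∑ c, f k b c - ∑ k, ∑ b, q k b) := by
    simp only [Finset.sum_sub_distrib, Finset.sum_add_distrib, c1, c2, d1, d2, d3]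
    ring
  have hlow : 0 ≤ 3 * (∑ k, ∑ b, ∑ c, f k b c - ∑ k, ∑ b, q k b) := by
    rw [← hsum]
    exact Finset.sum_nonneg fun k _ => Finset.sum_nonneg fun b _ => Finset.sum_nonneg fun c _ =>
      (hpt k b c).1
  have hup : 3 * (∑ k, ∑ b, ∑ c, f k b c - ∑ k, ∑ b, q k b) ≤ (r : ℝ) ^ 3 := by
    rw [← hsum]
    refine (Finset.sum_le_sum fun k _ => Finset.sum_le_sum fun b _ => Finset.sum_le_sum fun c _ =>
      (hpt k b c).2).trans (le_of_eq ?_)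
    simp
    ring
  rw [e3, abs_of_nonneg (by linarith)]
  linarith

theorem card_erase_univ (k : Fin r) : ((Finset.univ.erase k).card : ℝ) = (r : ℝ) - 1 := by
  rw [Finset.card_erase_of_mem (Finset.mem_univ k), Finset.card_univ, Fintype.card_fin,
    Nat.cast_sub (by have := k.2; omega), Nat.cast_one]

/-- Adding the terms for (k, b) and (b, k) removes the pole and leaves 1; with squares in the
numerators, as in the next lemma, it leaves l_k + l_b. -/
theorem sum_sum_mul_inv {l : Fin r → ℝ} (hl : l ∈ strictChamber r) :
    ∑ k, ∑ b ∈ Finset.univ.erase k, l k * (l k - l b)⁻¹ = (r : ℝ) * (r - 1) / 2 := by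
  have h1 := sum_erase_swap (fun k b => l k * (l k - l b)⁻¹)
  have h2 : ∑ k, ∑ b ∈ Finset.univ.erase k, l k * (l k - l b)⁻¹ +
      ∑ k, ∑ b ∈ Finset.univ.erase k, l b * (l b - l k)⁻¹ =
      ∑ k : Fin r, ∑ b ∈ Finset.univ.erase k, (1 : ℝ) := by
    simp only [← Finset.sum_add_distrib]
    refine Finset.sum_congr rfl fun k _ => Finset.sum_congr rfl fun b hb => ?_
    have h := sub_ne_zero.2 (strictChamber_ne hl (Finset.ne_of_mem_erase hb).symm)
    rw [← neg_sub (l k) (l b), inv_neg]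
    field_simp
    ring
  simp only [Finset.sum_const, nsmul_eq_mul, mul_one, card_erase_univ, Finset.card_univ,
    Fintype.card_fin] at h2
  linarith

theorem sum_sum_sq_mul_inv {l : Fin r → ℝ} (hl : l ∈ strictChamber r) :
    ∑ k, ∑ b ∈ Finset.univ.erase k, l k ^ 2 * (l k - l b)⁻¹ = ((r : ℝ) - 1) * ∑ k, l k := by
  have h1 := sum_erase_swap (fun k b => l k ^ 2 * (l k - l b)⁻¹)
  have h2 : ∑ k, ∑ b ∈ Finset.univ.erase k, l k ^ 2 * (l k - l b)⁻¹ +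
      ∑ k, ∑ b ∈ Finset.univ.erase k, l b ^ 2 * (l b - l k)⁻¹ =
      ∑ k : Fin r, ∑ b ∈ Finset.univ.erase k, l k + ∑ k : Fin r, ∑ b ∈ Finset.univ.erase k, l b := by
    simp only [← Finset.sum_add_distrib]
    refine Finset.sum_congr rfl fun k _ => Finset.sum_congr rfl fun b hb => ?_
    have h := sub_ne_zero.2 (strictChamber_ne hl (Finset.ne_of_mem_erase hb).symm)
    rw [← neg_sub (l k) (l b), inv_neg]
    field_simp
    ring
  rw [← sum_erase_swap (fun k _ => l k)] at h2
  simp only [Finset.sum_const, nsmul_eq_mul, card_erase_univ] at h2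
  rw [← Finset.mul_sum] at h2
  linarith

/-- The double poles have coefficient −2 from the partial derivatives and +2 from the difference
quotients, so they meet in the difference bounded by `abs_triple_sum_le`. The weight 2⁻¹ of the pair
interaction in the energy is what balances them. Simple poles disappear by symmetrization. -/
theorem steinOp_energyField (n : ℕ) {l : Fin r → ℝ} (hl : l ∈ strictChamber r) :
    steinOp n energyField l =
      ((n : ℝ) - r - 2) * (r + (r : ℝ) * (r - 1) / 2) + 2 * r + 3 * ((r : ℝ) * (r - 1)) -
        (n + r) * ((r : ℝ) ^ 2 + r + 1) * ∑ k, l k +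
      2 * (∑ k, l k ^ 2 * (∑ b ∈ Finset.univ.erase k, (l k - l b)⁻¹) ^ 2 -
        ∑ k, ∑ b ∈ Finset.univ.erase k, l k ^ 2 * (l k - l b)⁻¹ ^ 2) := by
  have hA := sum_sum_mul_inv hl
  have hB := sum_sum_sq_mul_inv hl
  unfold steinOp
  simp only [hasDerivAt_energyField hl]
  have e1 : ∑ k, energyField k l / l k = r - ((r : ℝ) ^ 2 + r + 1) * ∑ k, l k +
      (r : ℝ) * (r - 1) / 2 := by
    rw [← hA, Finset.mul_sum]
    have hr : (r : ℝ) = ∑ k : Fin r, (1 : ℝ) := by simp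
    conv_rhs => enter [1, 1]; rw [hr]
    rw [← Finset.sum_sub_distrib, ← Finset.sum_add_distrib]
    refine Finset.sum_congr rfl fun k _ => ?_
    have h0 := (hl.2 k).ne'
    rw [← Finset.mul_sum]
    unfold energyField energyGrad
    field_simp
    ring
  have e2 : ∑ k, ∑ b ∈ Finset.univ.erase k, (energyField k l - energyField b l) / (l k - l b) =
      2 * ∑ k, energyField k l * ∑ b ∈ Finset.univ.erase k, (l k - l b)⁻¹ := by
    have h1 : ∑ k, ∑ b ∈ Finset.univ.erase k, (energyField k l - energyField b l) / (l k - l b) =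
        ∑ k, ∑ b ∈ Finset.univ.erase k, energyField k l * (l k - l b)⁻¹ +
        ∑ k, ∑ b ∈ Finset.univ.erase k, energyField b l * (l b - l k)⁻¹ := by
      simp only [← Finset.sum_add_distrib]
      refine Finset.sum_congr rfl fun k _ => Finset.sum_congr rfl fun b hb => ?_
      rw [← neg_sub (l k) (l b), inv_neg]
      ring
    rw [h1, ← sum_erase_swap (fun k b => energyField k l * (l k - l b)⁻¹)]
    simp only [← Finset.mul_sum]
    ring
  have e3 : ∑ k, energyField k l * ∑ b ∈ Finset.univ.erase k, (l k - l b)⁻¹ =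
      (r : ℝ) * (r - 1) / 2 - ((r : ℝ) ^ 2 + r + 1) * (((r : ℝ) - 1) * ∑ k, l k) +
        ∑ k, l k ^ 2 * (∑ b ∈ Finset.univ.erase k, (l k - l b)⁻¹) ^ 2 := by
    rw [← hA, ← hB, Finset.mul_sum, ← Finset.sum_sub_distrib, ← Finset.sum_add_distrib]
    refine Finset.sum_congr rfl fun k _ => ?_
    have h0 := (hl.2 k).ne'
    simp only [← Finset.mul_sum]
    unfold energyField energyGrad
    field_simp
    ring
  have e4 : ∑ k, (1 - 2 * ((r : ℝ) ^ 2 + r + 1) * l k +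
      ∑ b ∈ Finset.univ.erase k, (2 * l k * (l k - l b)⁻¹ - l k ^ 2 * (l k - l b)⁻¹ ^ 2)) =
      r - 2 * ((r : ℝ) ^ 2 + r + 1) * ∑ k, l k + (r : ℝ) * (r - 1) -
        ∑ k, ∑ b ∈ Finset.univ.erase k, l k ^ 2 * (l k - l b)⁻¹ ^ 2 := by
    have h2 : ∑ k, ∑ b ∈ Finset.univ.erase k, 2 * l k * (l k - l b)⁻¹ = (r : ℝ) * (r - 1) := by
      simp only [mul_assoc, ← Finset.mul_sum] at hA ⊢
      linarith
    simp only [Finset.sum_add_distrib, Finset.sum_sub_distrib, h2, Finset.sum_const,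
      Finset.card_univ, Fintype.card_fin, nsmul_eq_mul, mul_one]
    rw [← Finset.mul_sum]
    ring
  rw [e1, e2, e3, e4]
  ring

theorem exists_abs_steinOp_energyField_le (n r : ℕ) : ∃ C : ℝ, 0 ≤ C ∧ ∀ l ∈ strictChamber r,
    |steinOp n energyField l| ≤ C * (1 + ∑ k, l k) := by
  set A : ℝ := ((n : ℝ) - r - 2) * (r + (r : ℝ) * (r - 1) / 2) + 2 * r + 3 * ((r : ℝ) * (r - 1))
  set B : ℝ := (n + r) * ((r : ℝ) ^ 2 + r + 1)
  have hB : 0 ≤ B := by positivity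
  refine ⟨|A| + 2 * (r : ℝ) ^ 3 + B, by positivity, fun l hl => ?_⟩
  rw [steinOp_energyField n hl]
  change |A - B * _ + 2 * _| ≤ _
  have h1 := abs_le.1 (abs_triple_sum_le hl)
  have hs := sum_pos_of_mem hl
  have h2 := abs_le.1 (le_refl |A|)
  have h3 : 0 ≤ (|A| + 2 * (r : ℝ) ^ 3) * ∑ k, l k := by positivity
  have h4 : 0 ≤ B * ∑ k, l k := by positivity
  rw [abs_le]
  constructor <;> nlinarith [h1.1, h1.2]

end EnergyField

end

noncomputable section

open Filter Topology

/-! ### Measurability and integrability of functions of the sample eigenvalues -/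

section ChamberMeasurable

variable {r : ℕ}

/-- The restriction of `f` to the chamber of distinct positive eigenvalues is measurable. -/
def ChamberMeasurable (f : (Fin r → ℝ) → ℝ) : Prop := Measurable fun l : strictChamber r => f l

theorem ChamberMeasurable.of_continuousOn {f : (Fin r → ℝ) → ℝ}
    (hf : ContinuousOn f (strictChamber r)) : ChamberMeasurable f :=
  (continuousOn_iff_continuous_domRestrict.1 hf).measurable

theorem ChamberMeasurable.measurable_indicator {f : (Fin r → ℝ) → ℝ} (hf : ChamberMeasurable f) :
    Measurable ((strictChamber r).indicator f) := by
  classical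
  have h : (strictChamber r).indicator f =
      fun l => if h : l ∈ strictChamber r then f (⟨l, h⟩ : strictChamber r) else 0 := by
    funext l
    by_cases h : l ∈ strictChamber r <;> simp [h]
  rw [h]
  exact Measurable.dite (s := strictChamber r) hf measurable_const isOpen_strictChamber.measurableSet

/-- The derivative of a merely differentiable function may be discontinuous; it is still measurable,
as an evaluation of `fderiv`. -/
theorem ChamberMeasurable.partialDeriv {f : (Fin r → ℝ) → ℝ}
    (hf : DifferentiableOn ℝ f (strictChamber r)) (k : Fin r) :
    ChamberMeasurable (partialDeriv k f) := by
  have h : (fun l : strictChamber r => _root_.partialDeriv k f l) =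
      fun l : strictChamber r => fderiv ℝ f l (Pi.single k 1) := by
    funext l
    exact partialDeriv_eq_fderiv (hf.differentiableAt (isOpen_strictChamber.mem_nhds l.2)) k
  rw [ChamberMeasurable, h]
  exact (measurable_fderiv_apply_const ℝ f (Pi.single k 1)).comp measurable_subtype_coe

theorem ChamberMeasurable.eval (k : Fin r) : ChamberMeasurable fun l : Fin r → ℝ => l k :=
  .of_continuousOn (continuous_apply k).continuousOn

theorem ChamberMeasurable.steinOp {n : ℕ} {φ : Fin r → (Fin r → ℝ) → ℝ}
    (hφ : ∀ k, DifferentiableOn ℝ (φ k) (strictChamber r)) : ChamberMeasurable (steinOp n φ) := by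
  have h1 : ∀ k, Measurable fun l : strictChamber r => φ k l := fun k =>
    ChamberMeasurable.of_continuousOn (hφ k).continuousOn
  have h2 : ∀ k, Measurable fun l : strictChamber r => _root_.partialDeriv k (φ k) l := fun k =>
    ChamberMeasurable.partialDeriv (hφ k) k
  have h3 : ∀ k, Measurable fun l : strictChamber r => (l : Fin r → ℝ) k := fun k =>
    ChamberMeasurable.eval k
  exact (((Finset.measurable_fun_sum _ fun k _ => (h1 k).div (h3 k)).const_mul _).add
    ((Finset.measurable_fun_sum _ fun k _ => h2 k).const_mul _)).add
    (Finset.measurable_fun_sum _ fun k _ => Finset.measurable_fun_sum _ fun b _ =>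
      ((h1 k).sub (h1 b)).div ((h3 k).sub (h3 b)))

end ChamberMeasurable

/-! ### Measurability and moments of the sample eigenvalues -/

section SampleEigenvalues

variable {n r : ℕ} {w : Fin r → ℝ}

theorem isOpen_setOf_isSimpleSpectrum (w : Fin r → ℝ) :
    IsOpen {z : Fin n × Fin r → ℝ | IsSimpleSpectrum (scatter w z)} :=
  isOpen_iff_mem_nhds.2 fun _ hz =>
    eventually_isSimpleSpectrum (contDiff_scatter w) (scatter_transpose w) hz

/-- Scatter matrices with simple spectrum come from an open set of full measure, so continuity there
is enough, whatever the default values elsewhere. -/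
theorem aestronglyMeasurable_of_continuousAt (hrn : r ≤ n - 1) (hn : n ≠ 0) (hw : ∀ a, w a ≠ 0)
    {β : Type*} [TopologicalSpace β] [TopologicalSpace.PseudoMetrizableSpace β]
    [SecondCountableTopology β] {F : (Fin n × Fin r → ℝ) → β}
    (hF : ∀ z, IsSimpleSpectrum (scatter w z) → ContinuousAt F z) :
    AEStronglyMeasurable F (stdGaussianPi (Fin n × Fin r)) := by
  borelize β
  have h : ContinuousOn F {z | IsSimpleSpectrum (scatter w z)} := fun z hz =>
    (hF z hz).continuousWithinAt
  have h2 := h.aestronglyMeasurable (μ := stdGaussianPi (Fin n × Fin r))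
    (isOpen_setOf_isSimpleSpectrum w).measurableSet
  have e : (stdGaussianPi (Fin n × Fin r)).restrict {z | IsSimpleSpectrum (scatter w z)} =
      stdGaussianPi (Fin n × Fin r) :=
    Measure.restrict_eq_self_of_ae_mem (ae_isSimpleSpectrum hrn hn hw)
  rwa [e] at h2

theorem ChamberMeasurable.aestronglyMeasurable (hrn : r ≤ n - 1) (hn : n ≠ 0) (hw : ∀ a, w a ≠ 0)
    {f : (Fin r → ℝ) → ℝ} (hf : ChamberMeasurable f) :
    AEStronglyMeasurable (fun z => f (eigs (scatter w z))) (stdGaussianPi (Fin n × Fin r)) := by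
  have h1 : AEMeasurable (fun z => eigs (scatter w z)) (stdGaussianPi (Fin n × Fin r)) :=
    (aestronglyMeasurable_of_continuousAt hrn hn hw fun z hz =>
      (differentiableAt_eigs_scatter hz).continuousAt).aemeasurable
  refine (hf.measurable_indicator.comp_aemeasurable h1).aestronglyMeasurable.congr
    ((ae_isSimpleSpectrum hrn hn hw).mono fun z hz => ?_)
  exact Set.indicator_of_mem hz.eigs_mem f

theorem invWeight_eq_sum (w : Fin r → ℝ) (S : Matrix (Fin r) (Fin r) ℝ) (k : Fin r) :
    invWeight w S k = ∑ a, (w a ^ 2)⁻¹ * eigenProj S k a a := by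
  simp [invWeight, trace, diagonal_mul]

theorem invWeight_nonneg (w : Fin r → ℝ) (S : Matrix (Fin r) (Fin r) ℝ) (k : Fin r) :
    0 ≤ invWeight w S k := by
  rw [invWeight_eq_sum]
  exact Finset.sum_nonneg fun a _ => mul_nonneg (by positivity) (eigenProj_diag_nonneg S k a)

theorem invWeight_le (w : Fin r → ℝ) (S : Matrix (Fin r) (Fin r) ℝ) (k : Fin r) :
    invWeight w S k ≤ ∑ a, (w a ^ 2)⁻¹ := by
  rw [invWeight_eq_sum]
  refine Finset.sum_le_sum fun a _ => ?_
  have h := (abs_le.1 (abs_eigenProj_le_one S k a a)).2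
  have h2 : 0 ≤ (w a ^ 2)⁻¹ := by positivity
  nlinarith

theorem aestronglyMeasurable_invWeight (hrn : r ≤ n - 1) (hn : n ≠ 0) (hw : ∀ a, w a ≠ 0)
    (k : Fin r) :
    AEStronglyMeasurable (fun z => invWeight w (scatter w z) k)
      (stdGaussianPi (Fin n × Fin r)) := by
  refine aestronglyMeasurable_of_continuousAt hrn hn hw fun z hz => ?_
  simp only [invWeight_eq_sum]
  exact tendsto_finsetSum _ fun a _ => ((differentiableAt_eigenProj (contDiff_scatter w)
    (scatter_transpose w) hz k a a).continuousAt).const_mul _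

theorem memLp_four_apply {ι : Type*} [Fintype ι] (i : ι) :
    MemLp (fun z : ι → ℝ => z i) 4 (stdGaussianPi ι) := by
  have h := memLp_id_gaussianReal (μ := 0) (v := 1) 4
  have hp : MeasurePreserving (Function.eval i) (stdGaussianPi ι) (gaussianReal 0 1) :=
    measurePreserving_eval _ i
  exact h.comp_measurePreserving hp

theorem memLp_two_trace_scatter (w : Fin r → ℝ) :
    MemLp (fun z : Fin n × Fin r → ℝ => (scatter w z).trace) 2
      (stdGaussianPi (Fin n × Fin r)) := by
  have h1 : ∀ i a, MemLp (fun z : Fin n × Fin r → ℝ => centered w z i a) 4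
      (stdGaussianPi (Fin n × Fin r)) := by
    intro i a
    simp only [centered_apply]
    refine MemLp.const_mul (MemLp.sub (memLp_four_apply _) (MemLp.const_mul ?_ _)) _
    exact memLp_finsetSum _ fun j _ => memLp_four_apply _
  have : ENNReal.HolderTriple 4 4 2 := ⟨by
    rw [← two_mul, show (4 : ENNReal) = 2 * 2 by norm_num,
      ENNReal.mul_inv (by simp) (by simp), ← mul_assoc, ENNReal.mul_inv_cancel (by simp) (by simp),
      one_mul]⟩
  have h2 : ∀ i a, MemLp (fun z : Fin n × Fin r → ℝ => centered w z i a * centered w z i a) 2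
      (stdGaussianPi (Fin n × Fin r)) := fun i a => (h1 i a).mul' (h1 i a)
  have h3 : ∀ a, MemLp (fun z : Fin n × Fin r → ℝ => scatter w z a a) 2
      (stdGaussianPi (Fin n × Fin r)) := fun a => by
    simp only [scatter_apply]
    exact (memLp_finsetSum _ fun i _ => h2 i a).const_mul _
  exact memLp_finsetSum _ fun a _ => h3 a

theorem memLp_two_sum_eigs (hrn : r ≤ n - 1) (hn : n ≠ 0) (hw : ∀ a, w a ≠ 0) :
    MemLp (fun z => ∑ k, eigs (scatter w z) k) 2 (stdGaussianPi (Fin n × Fin r)) :=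
  (memLp_two_trace_scatter w).ae_eq
    ((ae_isSimpleSpectrum hrn hn hw).mono fun _ hz => hz.trace_eq)

theorem integrable_eigs_sq (hrn : r ≤ n - 1) (hn : n ≠ 0) (hw : ∀ a, w a ≠ 0) (k : Fin r) :
    Integrable (fun z => eigs (scatter w z) k ^ 2) (stdGaussianPi (Fin n × Fin r)) := by
  refine (memLp_two_sum_eigs hrn hn hw).integrable_sq.mono'
    (ChamberMeasurable.aestronglyMeasurable hrn hn hw
      (.of_continuousOn (f := fun l => l k ^ 2) (by fun_prop)))
    ((ae_isSimpleSpectrum hrn hn hw).mono fun z hz => ?_)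
  have hl := hz.eigs_mem
  rw [Real.norm_of_nonneg (sq_nonneg _)]
  exact pow_le_pow_left₀ (hl.2 k).le (apply_le_sum hl k) 2

theorem integrable_sum_eigs (hrn : r ≤ n - 1) (hn : n ≠ 0) (hw : ∀ a, w a ≠ 0) :
    Integrable (fun z => ∑ k, eigs (scatter w z) k) (stdGaussianPi (Fin n × Fin r)) :=
  (memLp_two_sum_eigs hrn hn hw).integrable (by norm_num)

theorem integrable_comp_eigs_of_compact (hrn : r ≤ n - 1) (hn : n ≠ 0) (hw : ∀ a, w a ≠ 0)
    {f : (Fin r → ℝ) → ℝ} {K : Set (Fin r → ℝ)} (hK : IsCompact K) (hKs : K ⊆ strictChamber r)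
    (hf : ContinuousOn f (strictChamber r)) (h0 : ∀ l ∉ K, f l = 0) :
    Integrable (fun z => f (eigs (scatter w z))) (stdGaussianPi (Fin n × Fin r)) := by
  obtain ⟨C, hC⟩ := hK.exists_bound_of_continuousOn (hf.mono hKs)
  refine (integrable_const (max C 0)).mono'
    (ChamberMeasurable.aestronglyMeasurable hrn hn hw (.of_continuousOn hf)) (.of_forall fun z => ?_)
  by_cases h : eigs (scatter w z) ∈ K
  · exact (hC _ h).trans (le_max_left _ _)
  · rw [h0 _ h, norm_zero]
    exact le_max_right _ _

end SampleEigenvalues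

/-! ### The energy estimate -/

section EnergyEstimate

theorem hasDerivAt_max_zero_sq (x : ℝ) : HasDerivAt (fun t : ℝ => max t 0 ^ 2) (2 * max x 0) x := by
  rcases lt_trichotomy x 0 with hx | hx | hx
  · rw [max_eq_right hx.le, mul_zero]
    refine (hasDerivAt_const x (0 : ℝ)).congr_of_eventuallyEq ?_
    filter_upwards [Iio_mem_nhds hx] with t ht
    rw [max_eq_right (le_of_lt ht)]
    norm_num
  · subst hx
    rw [max_self, mul_zero]
    have h : (fun t : ℝ => max t 0 ^ 2) =O[𝓝 0] fun t : ℝ => ‖t - 0‖ ^ 2 := by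
      refine Asymptotics.IsBigO.of_bound 1 (.of_forall fun t => ?_)
      rw [sub_zero, one_mul, Real.norm_of_nonneg (sq_nonneg _), norm_pow, norm_norm, Real.norm_eq_abs]
      exact pow_le_pow_left₀ (le_max_right _ _) (max_le (le_abs_self t) (abs_nonneg t)) 2
    have h2 : HasFDerivAt (fun t : ℝ => max t 0 ^ 2) (0 : ℝ →L[ℝ] ℝ) 0 := h.hasFDerivAt (by norm_num)
    simpa using h2.hasDerivAt
  · rw [max_eq_left hx.le]
    have h : HasDerivAt (fun t : ℝ => t ^ 2) (2 * x) x := by simpa using hasDerivAt_pow 2 x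
    refine h.congr_of_eventuallyEq ?_
    filter_upwards [Ioi_mem_nhds hx] with t ht
    rw [max_eq_left (le_of_lt ht)]

/-- The squared ramp is differentiable at the corner, and its derivative is a multiple of the ramp
itself. Testing with the square therefore produces the weight that appears in the energy estimate.
-/
theorem hasDerivAt_sq_ramp (M x : ℝ) : HasDerivAt (fun t : ℝ => max (1 - t / M) 0 ^ 2)
    (-(2 / M) * max (1 - x / M) 0) x := by
  have h1 : HasDerivAt (fun t : ℝ => 1 - t / M) (-(1 / M)) x :=
    ((hasDerivAt_id x).div_const M).const_sub 1
  have h2 := (hasDerivAt_max_zero_sq (1 - x / M)).comp x h1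
  convert! h2 using 1
  ring

variable {n r : ℕ} {w : Fin r → ℝ}

/-- The weighted squared gradient `∑ l_k² (∂_k energy)²`. -/
def energyQuad (l : Fin r → ℝ) : ℝ := ∑ k, (l k * energyGrad k l) ^ 2

theorem energyQuad_nonneg (l : Fin r → ℝ) : 0 ≤ energyQuad l :=
  Finset.sum_nonneg fun _ _ => sq_nonneg _

theorem continuousOn_energyQuad : ContinuousOn (energyQuad (r := r)) (strictChamber r) :=
  continuousOn_finsetSum _ fun k _ =>
    ((continuous_apply k).continuousOn.mul (continuousOn_energyGrad k)).pow 2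

theorem continuousOn_energy : ContinuousOn (energy (r := r)) (strictChamber r) := fun _ hl =>
  (hasFDerivAt_energy hl).continuousAt.continuousWithinAt

theorem continuousOn_chamberCutoff {q : ℝ → ℝ} (hq : Continuous q) :
    ContinuousOn (chamberCutoff r q) (strictChamber r) :=
  (hq.comp_continuousOn continuousOn_energy).congr fun _ hl => chamberCutoff_of_mem hl

theorem differentiableOn_energyField (k : Fin r) :
    DifferentiableOn ℝ (energyField k) (strictChamber r) := by
  unfold energyField energyGrad
  have h : ∀ k : Fin r, DifferentiableOn ℝ (fun l : Fin r → ℝ => l k) (strictChamber r) := fun k =>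
    (differentiable_apply k).differentiableOn
  refine DifferentiableOn.fun_neg (DifferentiableOn.fun_mul ((h k).fun_pow 2)
    (DifferentiableOn.fun_sub (DifferentiableOn.fun_sub (differentiableOn_const _) ?_) ?_))
  · exact (h k).fun_inv fun l hl => (hl.2 k).ne'
  · exact DifferentiableOn.fun_sum fun b hb => ((h k).fun_sub (h b)).fun_inv fun l hl =>
      sub_ne_zero.2 (strictChamber_ne hl (Finset.ne_of_mem_erase hb).symm)

theorem integrable_ramp_mul_energyQuad (hrn : r ≤ n - 1) (hn : n ≠ 0) (hw : ∀ a, w a ≠ 0) {M : ℝ}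
    (hM : 0 < M) :
    Integrable (fun z => chamberCutoff r (fun t => max (1 - t / M) 0) (eigs (scatter w z)) *
      energyQuad (eigs (scatter w z))) (stdGaussianPi (Fin n × Fin r)) := by
  refine integrable_comp_eigs_of_compact hrn hn hw (isCompact_chamberBox M) (chamberBox_subset M)
    (f := fun l => chamberCutoff r (fun t => max (1 - t / M) 0) l * energyQuad l)
    ((continuousOn_chamberCutoff (by fun_prop)).mul continuousOn_energyQuad) fun l hl => ?_
  rw [chamberCutoff_eq_zero (fun t ht => max_eq_right ?_) hl, zero_mul]
  rw [sub_nonpos, one_le_div hM]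
  exact ht.le

/-- Let u = max(1 − W/M, 0), with W the energy, and test the compactly supported first identity with
u² times the field −l_k² ∂_kW. The left side is an integrable term plus (4/M) u ∑ (l_k ∂_kW)². The
right side is at most n u² ∑ |l_k ∂_kW| l_k times a constant, and half of the main term absorbs it
at the cost of O(M) E ∑ l_k². Multiplying by M/2 gives O(M²), the rate needed against cutoffs with
gradient of order 1/M. -/
theorem exists_integral_ramp_mul_energyQuad_le [NeZero r] (hrn : r ≤ n - 1) (hn : n ≠ 0)
    (hw : ∀ a, w a ≠ 0) : ∃ C : ℝ, 0 ≤ C ∧ ∀ M : ℝ, 1 ≤ M →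
      ∫ z, chamberCutoff r (fun t => max (1 - t / M) 0) (eigs (scatter w z)) *
        energyQuad (eigs (scatter w z)) ∂(stdGaussianPi (Fin n × Fin r)) ≤ C * M ^ 2 := by
  obtain ⟨A, hA0, hA⟩ := exists_abs_steinOp_energyField_le n r
  set D : ℝ := n * ∑ a, (w a ^ 2)⁻¹ with hD
  have hD0 : 0 ≤ D := by positivity
  set γ := stdGaussianPi (Fin n × Fin r) with hγ
  set E1 := ∫ z, (1 + ∑ k, eigs (scatter w z) k) ∂γ with hE1
  set E2 := ∫ z, ∑ k, eigs (scatter w z) k ^ 2 ∂γ with hE2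
  have hi1 : Integrable (fun z => 1 + ∑ k, eigs (scatter w z) k) γ :=
    (integrable_const 1).add (integrable_sum_eigs hrn hn hw)
  have hi2 : Integrable (fun z => ∑ k, eigs (scatter w z) k ^ 2) γ :=
    integrable_finsetSum _ fun k _ => integrable_eigs_sq hrn hn hw k
  have hsimple := ae_isSimpleSpectrum hrn hn hw
  have hE10 : 0 ≤ E1 := integral_nonneg_of_ae (hsimple.mono fun z hz => by
    have := sum_pos_of_mem hz.eigs_mem
    simp only [Pi.zero_apply]
    linarith)
  have hE20 : 0 ≤ E2 := integral_nonneg fun z => Finset.sum_nonneg fun k _ => sq_nonneg _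
  -- The estimate below is I ≤ (M/2)(A E1 + (M/8) D² E2), and M ≤ M² since M ≥ 1.
  refine ⟨A * E1 / 2 + D ^ 2 * E2 / 16, by positivity, fun M hM => ?_⟩
  have hM0 : 0 < M := by linarith
  set u : ℝ → ℝ := fun t => max (1 - t / M) 0 with hu
  set q : ℝ → ℝ := fun t => max (1 - t / M) 0 ^ 2 with hq
  have hqd : ∀ t, HasDerivAt q (-(2 / M) * u t) t := fun t => hasDerivAt_sq_ramp M t
  have hqD : Differentiable ℝ q := fun t => (hqd t).differentiableAt
  have hu0 : ∀ t, 0 ≤ u t := fun t => le_max_right _ _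
  have hu1 : ∀ t, 0 ≤ t → u t ≤ 1 := fun t ht => max_le (by
    have : 0 ≤ t / M := by positivity
    linarith) zero_le_one
  have hq0 : ∀ t, M < t → q t = 0 := fun t ht => by
    simp only [hq]
    rw [max_eq_right (by rw [sub_nonpos, one_le_div hM0]; exact ht.le)]
    norm_num
  set φ : Fin r → (Fin r → ℝ) → ℝ := fun k l => chamberCutoff r q l * energyField k l with hφ
  have hφd : ∀ k, DifferentiableOn ℝ (φ k) (strictChamber r) := fun k =>
    (differentiableOn_chamberCutoff hqD).fun_mul (differentiableOn_energyField k)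
  -- The field carries a minus sign and the cutoff decreases, so the cutoff term of `steinOp_mul` is
  -- positive: it is the quantity to be estimated.
  have hst : ∀ l ∈ strictChamber r, steinOp n φ l = q (energy l) * steinOp n energyField l +
      4 / M * (u (energy l) * energyQuad l) := by
    intro l hl
    have hm := isOpen_strictChamber.mem_nhds hl
    rw [hφ, steinOp_mul ((differentiableOn_chamberCutoff hqD).differentiableAt hm)
      fun k => (differentiableOn_energyField k).differentiableAt hm]
    rw [chamberCutoff_of_mem hl, add_right_inj]
    simp only [partialDeriv_chamberCutoff hqD hl, (hqd _).deriv, energyQuad, Finset.mul_sum]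
    refine Finset.sum_congr rfl fun k _ => ?_
    unfold energyField
    ring
  have hcut : ∀ l ∈ strictChamber r, chamberCutoff r u l = u (energy l) := fun l hl =>
    chamberCutoff_of_mem hl
  have hiu := integrable_ramp_mul_energyQuad hrn hn hw hM0
  have hq1 : ∀ l ∈ strictChamber r, 0 ≤ q (energy l) ∧ q (energy l) ≤ 1 := fun l hl =>
    ⟨sq_nonneg _, pow_le_one₀ (hu0 _) (hu1 _ (energy_nonneg hl))⟩
  have hb1 : ∀ l ∈ strictChamber r, |q (energy l) * steinOp n energyField l| ≤
      A * (1 + ∑ k, l k) := by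
    intro l hl
    rw [abs_mul, abs_of_nonneg (hq1 l hl).1]
    exact (mul_le_of_le_one_left (abs_nonneg _) (hq1 l hl).2).trans (hA l hl)
  have hint1 : Integrable (fun z => steinOp n φ (eigs (scatter w z))) γ := by
    refine ((hi1.const_mul A).add (hiu.const_mul (4 / M))).mono'
      (ChamberMeasurable.aestronglyMeasurable hrn hn hw (ChamberMeasurable.steinOp hφd))
      (hsimple.mono fun z hz => ?_)
    have hl := hz.eigs_mem
    rw [hst _ hl, Pi.add_apply, hcut _ hl, Real.norm_eq_abs]
    refine (abs_add_le _ _).trans (add_le_add (hb1 _ hl) (le_of_eq (abs_of_nonneg ?_)))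
    exact mul_nonneg (by positivity) (mul_nonneg (hu0 _) (energyQuad_nonneg _))
  have hF2 : ∀ z : Fin n × Fin r → ℝ, IsSimpleSpectrum (scatter w z) →
      |n * ∑ k, φ k (eigs (scatter w z)) * invWeight w (scatter w z) k| ≤
        2 / M * (u (energy (eigs (scatter w z))) * energyQuad (eigs (scatter w z))) +
        M / 8 * D ^ 2 * ∑ k, eigs (scatter w z) k ^ 2 := by
    intro z hz
    have hl := hz.eigs_mem
    set l := eigs (scatter w z)
    rw [energyQuad, Finset.mul_sum, Finset.mul_sum, Finset.mul_sum, Finset.mul_sum,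
      ← Finset.sum_add_distrib]
    refine (Finset.abs_sum_le_sum_abs _ _).trans (Finset.sum_le_sum fun k _ => ?_)
    have hd0 := invWeight_nonneg w (scatter w z) k
    have hd1 := invWeight_le w (scatter w z) k
    have h1 : |n * (φ k l * invWeight w (scatter w z) k)| ≤
        u (energy l) ^ 2 * (|l k * energyGrad k l| * (l k * D)) := by
      have e : n * (φ k l * invWeight w (scatter w z) k) =
          -(u (energy l) ^ 2 * ((l k * energyGrad k l) * (l k * (n * invWeight w (scatter w z) k)))) := by
        simp only [hφ, chamberCutoff_of_mem hl, energyField, hq, hu]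
        ring
      rw [e, abs_neg, abs_mul, abs_of_nonneg (sq_nonneg _), abs_mul (l k * energyGrad k l),
        abs_mul (l k) (_ * _), abs_of_pos (hl.2 k),
        abs_of_nonneg (mul_nonneg (Nat.cast_nonneg n) hd0)]
      exact mul_le_mul_of_nonneg_left (mul_le_mul_of_nonneg_left (mul_le_mul_of_nonneg_left
        (mul_le_mul_of_nonneg_left hd1 (Nat.cast_nonneg n)) (hl.2 k).le) (abs_nonneg _)) (sq_nonneg _)
    refine h1.trans ?_
    set x := |l k * energyGrad k l| with hx
    have hx2 : (l k * energyGrad k l) ^ 2 = x ^ 2 := (sq_abs _).symm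
    rw [hx2]
    have hU0 := hu0 (energy l)
    have hU1 := hu1 _ (energy_nonneg hl)
    set U := u (energy l)
    set y := l k * D with hy
    have hy0 : 0 ≤ y := mul_nonneg (hl.2 k).le hD0
    have hx0 : 0 ≤ x := abs_nonneg _
    -- The weight 2/M is half of the coefficient 4/M available on the left.
    have h2 : x * y ≤ 2 / M * x ^ 2 + M / 8 * y ^ 2 := by
      have h3 : 0 ≤ (4 * x - M * y) ^ 2 / (8 * M) := by positivity
      have h4 : (4 * x - M * y) ^ 2 / (8 * M) = 2 / M * x ^ 2 + M / 8 * y ^ 2 - x * y := by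
        field_simp
        ring
      linarith
    calc U ^ 2 * (x * y) ≤ U * (x * y) :=
          mul_le_mul_of_nonneg_right (by nlinarith) (mul_nonneg hx0 hy0)
      _ ≤ U * (2 / M * x ^ 2 + M / 8 * y ^ 2) := mul_le_mul_of_nonneg_left h2 hU0
      _ = 2 / M * (U * x ^ 2) + U * (M / 8 * y ^ 2) := by ring
      _ ≤ 2 / M * (U * x ^ 2) + 1 * (M / 8 * y ^ 2) := by gcongr
      _ = 2 / M * (U * x ^ 2) + M / 8 * D ^ 2 * l k ^ 2 := by rw [hy]; ring
  have key := integral_steinOp_of_compact hrn hn hw (isCompact_chamberBox M) (chamberBox_subset M)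
    (φ := φ) (fun k l hl => by simp only [hφ]; rw [chamberCutoff_eq_zero hq0 hl, zero_mul]) hφd hint1
  have hle1 : ∫ z, (4 / M * (chamberCutoff r u (eigs (scatter w z)) * energyQuad (eigs (scatter w z))) -
      A * (1 + ∑ k, eigs (scatter w z) k)) ∂γ ≤ ∫ z, steinOp n φ (eigs (scatter w z)) ∂γ := by
    refine integral_mono_ae ((hiu.const_mul _).sub (hi1.const_mul _)) hint1
      (hsimple.mono fun z hz => ?_)
    have hl := hz.eigs_mem
    simp only
    rw [hst _ hl, hcut _ hl]
    linarith [(abs_le.1 (hb1 _ hl)).1]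
  have hle2 : ∫ z, n * ∑ k, φ k (eigs (scatter w z)) * invWeight w (scatter w z) k ∂γ ≤
      ∫ z, (2 / M * (chamberCutoff r u (eigs (scatter w z)) * energyQuad (eigs (scatter w z))) +
        M / 8 * D ^ 2 * ∑ k, eigs (scatter w z) k ^ 2) ∂γ := by
    have hid : Integrable (fun z => (2 / M * (chamberCutoff r u (eigs (scatter w z)) *
        energyQuad (eigs (scatter w z))) + M / 8 * D ^ 2 * ∑ k, eigs (scatter w z) k ^ 2)) γ :=
      (hiu.const_mul _).add (hi2.const_mul _)
    have hm : AEStronglyMeasurable (fun z =>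
        (n : ℝ) * ∑ k, φ k (eigs (scatter w z)) * invWeight w (scatter w z) k) γ :=
      (Finset.aestronglyMeasurable_fun_sum _ fun k _ =>
        (ChamberMeasurable.aestronglyMeasurable hrn hn hw
          (.of_continuousOn (hφd k).continuousOn)).mul
          (aestronglyMeasurable_invWeight hrn hn hw k)).const_mul _
    refine integral_mono_ae (hid.mono' hm (hsimple.mono fun z hz => ?_)) hid
      (hsimple.mono fun z hz => ?_)
    · rw [hcut _ hz.eigs_mem]
      exact hF2 z hz
    · simp only
      rw [hcut _ hz.eigs_mem]
      exact (le_abs_self _).trans (hF2 z hz)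
  set I := ∫ z, chamberCutoff r u (eigs (scatter w z)) * energyQuad (eigs (scatter w z)) ∂γ with hI
  have hv1 : ∫ z, (4 / M * (chamberCutoff r u (eigs (scatter w z)) * energyQuad (eigs (scatter w z))) -
      A * (1 + ∑ k, eigs (scatter w z) k)) ∂γ = 4 / M * I - A * E1 := by
    rw [integral_sub (hiu.const_mul _) (hi1.const_mul _), integral_const_mul, integral_const_mul]
  have hv2 : ∫ z, (2 / M * (chamberCutoff r u (eigs (scatter w z)) * energyQuad (eigs (scatter w z))) +
      M / 8 * D ^ 2 * ∑ k, eigs (scatter w z) k ^ 2) ∂γ = 2 / M * I + M / 8 * D ^ 2 * E2 := by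
    rw [integral_add (hiu.const_mul _) (hi2.const_mul _), integral_const_mul, integral_const_mul]
  rw [hv1, key] at hle1
  rw [hv2] at hle2
  have hfin : 2 / M * I ≤ A * E1 + M / 8 * D ^ 2 * E2 := by
    have e : 4 / M * I = 2 / M * I + 2 / M * I := by ring
    linarith
  have hIle : I ≤ M / 2 * (A * E1 + M / 8 * D ^ 2 * E2) := by
    have := mul_le_mul_of_nonneg_left hfin (by positivity : 0 ≤ M / 2)
    have e : M / 2 * (2 / M * I) = I := by field_simp
    rwa [e] at this
  refine hIle.trans ?_
  have h5 : M * (A * E1) ≤ M ^ 2 * (A * E1) :=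
    mul_le_mul_of_nonneg_right (by nlinarith) (by positivity)
  nlinarith

end EnergyEstimate

end

noncomputable section

open Filter Topology

/-! ### Removing the cutoff near the boundary of the chamber -/

section Cutoff

variable {n r : ℕ} {w : Fin r → ℝ}

/-- A cutoff function of the energy, supported in a compact part of the chamber. -/
def energyCutoff (r : ℕ) (M : ℝ) : (Fin r → ℝ) → ℝ := chamberCutoff r fun t => plateau (t / M)

theorem differentiable_plateau_div (M : ℝ) : Differentiable ℝ fun t => plateau (t / M) :=
  plateau_differentiable.comp (differentiable_id.div_const M)

theorem deriv_plateau_div (M t : ℝ) :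
    deriv (fun t => plateau (t / M)) t = deriv plateau (t / M) / M := by
  have h := (plateau_differentiable (t / M)).hasDerivAt.comp t ((hasDerivAt_id t).div_const M)
  have h2 := h.deriv
  simp only [Function.comp_def, id] at h2
  rw [h2]
  ring

theorem differentiableOn_energyCutoff (M : ℝ) :
    DifferentiableOn ℝ (energyCutoff r M) (strictChamber r) :=
  differentiableOn_chamberCutoff (differentiable_plateau_div M)

theorem energyCutoff_of_mem {M : ℝ} {l : Fin r → ℝ} (hl : l ∈ strictChamber r) :
    energyCutoff r M l = plateau (energy l / M) := chamberCutoff_of_mem hl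

theorem energyCutoff_eq_zero {M : ℝ} (hM : 0 < M) {l : Fin r → ℝ} (hl : l ∉ chamberBox r (2 * M)) :
    energyCutoff r M l = 0 :=
  chamberCutoff_eq_zero (fun t ht => plateau_eq_zero (by rw [le_div_iff₀ hM]; exact ht.le)) hl

theorem energyCutoff_nonneg (M : ℝ) (l : Fin r → ℝ) : 0 ≤ energyCutoff r M l :=
  Set.indicator_nonneg (fun _ _ => plateau_nonneg _) _

theorem energyCutoff_le_one (M : ℝ) (l : Fin r → ℝ) : energyCutoff r M l ≤ 1 :=
  Set.indicator_le' (fun _ _ => plateau_le_one _) (fun _ _ => zero_le_one) _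

theorem aestronglyMeasurable_energyCutoff (hrn : r ≤ n - 1) (hn : n ≠ 0) (hw : ∀ a, w a ≠ 0)
    (M : ℝ) : AEStronglyMeasurable (fun z => energyCutoff r M (eigs (scatter w z)))
      (stdGaussianPi (Fin n × Fin r)) :=
  ChamberMeasurable.aestronglyMeasurable hrn hn hw
    (.of_continuousOn (differentiableOn_energyCutoff M).continuousOn)

theorem integrable_energyCutoff_mul (hrn : r ≤ n - 1) (hn : n ≠ 0) (hw : ∀ a, w a ≠ 0) (M : ℝ)
    {f : (Fin n × Fin r → ℝ) → ℝ} (hf : Integrable f (stdGaussianPi (Fin n × Fin r))) :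
    Integrable (fun z => energyCutoff r M (eigs (scatter w z)) * f z)
      (stdGaussianPi (Fin n × Fin r)) := by
  refine hf.norm.mono' ((aestronglyMeasurable_energyCutoff hrn hn hw M).mul hf.1)
    (.of_forall fun z => ?_)
  rw [norm_mul, Real.norm_of_nonneg (energyCutoff_nonneg _ _)]
  exact mul_le_of_le_one_left (norm_nonneg _) (energyCutoff_le_one _ _)

theorem tendsto_integral_energyCutoff_mul (hrn : r ≤ n - 1) (hn : n ≠ 0) (hw : ∀ a, w a ≠ 0)
    {f : (Fin n × Fin r → ℝ) → ℝ} (hf : Integrable f (stdGaussianPi (Fin n × Fin r))) :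
    Tendsto (fun M => ∫ z, energyCutoff r M (eigs (scatter w z)) * f z
      ∂(stdGaussianPi (Fin n × Fin r))) atTop (𝓝 (∫ z, f z ∂(stdGaussianPi (Fin n × Fin r)))) := by
  refine tendsto_integral_filter_of_dominated_convergence (fun z => ‖f z‖)
    (.of_forall fun M => (integrable_energyCutoff_mul hrn hn hw M hf).1)
    (.of_forall fun M => .of_forall fun z => ?_) hf.norm
    ((ae_isSimpleSpectrum hrn hn hw).mono fun z hz => ?_)
  · rw [norm_mul, Real.norm_of_nonneg (energyCutoff_nonneg _ _)]
    exact mul_le_of_le_one_left (norm_nonneg _) (energyCutoff_le_one _ _)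
  · refine tendsto_const_nhds.congr' ?_
    filter_upwards [eventually_ge_atTop (energy (eigs (scatter w z))), eventually_gt_atTop 0]
      with M hM hM0
    rw [energyCutoff_of_mem hz.eigs_mem, plateau_eq_one ((div_le_one hM0).2 hM), one_mul]

/-- Pointwise bound for the error produced by the energy cutoff. -/
theorem abs_sum_partialDeriv_energyCutoff_le {B : ℝ} (hB : ∀ t, |deriv plateau t| ≤ B) {M t : ℝ}
    (hM : 0 < M) (ht : 0 < t) {l : Fin r → ℝ} (hl : l ∈ strictChamber r) (f : Fin r → ℝ) :
    |∑ k, f k * partialDeriv k (energyCutoff r M) l| ≤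
      B * t / 2 * (∑ k, (f k / l k) ^ 2 - energyCutoff r (M / 2) l * ∑ k, (f k / l k) ^ 2) +
      B / (t * M ^ 2) *
        (chamberCutoff r (fun t => max (1 - t / (4 * M)) 0) l * energyQuad l) := by
  have hB0 : 0 ≤ B := (abs_nonneg _).trans (hB 0)
  have hW := energy_nonneg hl
  have hη := energyCutoff_le_one (r := r) (M / 2) l
  have hU : 0 ≤ chamberCutoff r (fun t => max (1 - t / (4 * M)) 0) l :=
    Set.indicator_nonneg (fun _ _ => le_max_right _ _) _
  have hX : 0 ≤ ∑ k, (f k / l k) ^ 2 := Finset.sum_nonneg fun _ _ => sq_nonneg _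
  have hR : 0 ≤ B * t / 2 * (∑ k, (f k / l k) ^ 2 - energyCutoff r (M / 2) l * ∑ k, (f k / l k) ^ 2) +
      B / (t * M ^ 2) *
        (chamberCutoff r (fun t => max (1 - t / (4 * M)) 0) l * energyQuad l) := by
    have := mul_nonneg hU (energyQuad_nonneg l)
    have h2 : 0 ≤ ∑ k, (f k / l k) ^ 2 - energyCutoff r (M / 2) l * ∑ k, (f k / l k) ^ 2 := by
      nlinarith
    positivity
  have hpd : ∀ k, partialDeriv k (energyCutoff r M) l =
      deriv plateau (energy l / M) / M * energyGrad k l := fun k => by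
    rw [energyCutoff, partialDeriv_chamberCutoff (differentiable_plateau_div M) hl, deriv_plateau_div]
  by_cases h1 : energy l / M ≤ 1
  · simpa [hpd, deriv_plateau_eq_zero_of_le h1] using hR
  by_cases h2 : 2 ≤ energy l / M
  · simpa [hpd, deriv_plateau_eq_zero_of_ge h2] using hR
  push Not at h1 h2
  rw [one_lt_div hM] at h1
  rw [div_lt_iff₀ hM] at h2
  -- Only the shell M < W < 2M is left. There the cutoff at level M/2 has already vanished, so the
  -- first bracket of the bound is the full sum, and the ramp of length 4M is at least 1/2.
  have e1 : energyCutoff r (M / 2) l = 0 := by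
    rw [energyCutoff_of_mem hl]
    exact plateau_eq_zero (by rw [le_div_iff₀ (by positivity)]; linarith)
  have e2 : 1 / 2 ≤ chamberCutoff r (fun t => max (1 - t / (4 * M)) 0) l := by
    rw [chamberCutoff_of_mem hl]
    refine le_max_of_le_left ?_
    have : energy l / (4 * M) ≤ 1 / 2 := by rw [div_le_iff₀ (by positivity)]; linarith
    linarith
  rw [e1, zero_mul, sub_zero]
  have h3 : B / (t * M ^ 2) * (1 / 2 * energyQuad l) ≤ B / (t * M ^ 2) *
      (chamberCutoff r (fun t => max (1 - t / (4 * M)) 0) l * energyQuad l) := by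
    have := energyQuad_nonneg l
    gcongr
  refine le_trans ?_ (add_le_add_right h3 _)
  rw [energyQuad, Finset.mul_sum, Finset.mul_sum, Finset.mul_sum, ← Finset.sum_add_distrib]
  refine (Finset.abs_sum_le_sum_abs _ _).trans (Finset.sum_le_sum fun k _ => ?_)
  have h0 := (hl.2 k).ne'
  have e3 : f k * partialDeriv k (energyCutoff r M) l =
      deriv plateau (energy l / M) * ((f k / l k) * (l k * energyGrad k l) / M) := by
    rw [hpd]
    field_simp
  rw [e3, abs_mul]
  set x := f k / l k
  set y := l k * energyGrad k l
  -- Arithmetic-geometric inequality with a free weight t, to be fixed only after M is sent to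
  -- infinity.
  have h4 : |x * y / M| ≤ t / 2 * x ^ 2 + 1 / (2 * t * M ^ 2) * y ^ 2 := by
    have e5 : t / 2 * x ^ 2 + 1 / (2 * t * M ^ 2) * y ^ 2 - x * y / M =
        (t * M * x - y) ^ 2 / (2 * t * M ^ 2) := by
      field_simp
      ring
    have e6 : t / 2 * x ^ 2 + 1 / (2 * t * M ^ 2) * y ^ 2 + x * y / M =
        (t * M * x + y) ^ 2 / (2 * t * M ^ 2) := by
      field_simp
      ring
    have h5 : 0 ≤ (t * M * x - y) ^ 2 / (2 * t * M ^ 2) := by positivity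
    have h6 : 0 ≤ (t * M * x + y) ^ 2 / (2 * t * M ^ 2) := by positivity
    rw [abs_le]
    constructor <;> linarith
  calc |deriv plateau (energy l / M)| * |x * y / M|
      ≤ B * (t / 2 * x ^ 2 + 1 / (2 * t * M ^ 2) * y ^ 2) := by
        gcongr
        exact hB _
    _ = B * t / 2 * x ^ 2 + B / (t * M ^ 2) * (1 / 2 * y ^ 2) := by
        field_simp

theorem chamberMeasurable_partialDeriv_energyCutoff (M : ℝ) (k : Fin r) :
    ChamberMeasurable (partialDeriv k (energyCutoff r M)) :=
  ChamberMeasurable.partialDeriv (differentiableOn_energyCutoff M) k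

theorem aestronglyMeasurable_cutoff_error (hrn : r ≤ n - 1) (hn : n ≠ 0) (hw : ∀ a, w a ≠ 0)
    {f : Fin r → (Fin n × Fin r → ℝ) → ℝ}
    (hf : ∀ k, AEStronglyMeasurable (f k) (stdGaussianPi (Fin n × Fin r))) (M : ℝ) :
    AEStronglyMeasurable
      (fun z => ∑ k, f k z * partialDeriv k (energyCutoff r M) (eigs (scatter w z)))
      (stdGaussianPi (Fin n × Fin r)) :=
  Finset.aestronglyMeasurable_fun_sum _ fun k _ => (hf k).mul
    (ChamberMeasurable.aestronglyMeasurable hrn hn hw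
      (chamberMeasurable_partialDeriv_energyCutoff M k))

theorem integrable_cutoff_error_bound (hrn : r ≤ n - 1) (hn : n ≠ 0) (hw : ∀ a, w a ≠ 0)
    {g : (Fin n × Fin r → ℝ) → ℝ} (hg : Integrable g (stdGaussianPi (Fin n × Fin r)))
    (b c : ℝ) {M : ℝ} (hM : 0 < M) :
    Integrable (fun z => b * (g z - energyCutoff r (M / 2) (eigs (scatter w z)) * g z) +
      c * (chamberCutoff r (fun t => max (1 - t / (4 * M)) 0) (eigs (scatter w z)) *
        energyQuad (eigs (scatter w z)))) (stdGaussianPi (Fin n × Fin r)) :=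
  ((hg.sub (integrable_energyCutoff_mul hrn hn hw _ hg)).const_mul _).add
    ((integrable_ramp_mul_energyQuad hrn hn hw (by positivity)).const_mul _)

theorem integrable_cutoff_error (hrn : r ≤ n - 1) (hn : n ≠ 0) (hw : ∀ a, w a ≠ 0)
    {f : Fin r → (Fin n × Fin r → ℝ) → ℝ}
    (hf : ∀ k, AEStronglyMeasurable (f k) (stdGaussianPi (Fin n × Fin r)))
    (hint : Integrable (fun z => ∑ k, (f k z / eigs (scatter w z) k) ^ 2)
      (stdGaussianPi (Fin n × Fin r))) {M : ℝ} (hM : 0 < M) :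
    Integrable (fun z => ∑ k, f k z * partialDeriv k (energyCutoff r M) (eigs (scatter w z)))
      (stdGaussianPi (Fin n × Fin r)) := by
  obtain ⟨B, hB0, hB⟩ := exists_abs_deriv_plateau_le
  exact (integrable_cutoff_error_bound hrn hn hw hint (B * 1 / 2) (B / (1 * M ^ 2)) hM).mono'
    (aestronglyMeasurable_cutoff_error hrn hn hw hf M) ((ae_isSimpleSpectrum hrn hn hw).mono
      fun z hz => abs_sum_partialDeriv_energyCutoff_le hB hM one_pos hz.eigs_mem fun k => f k z)

/-- For fixed t the first part of the pointwise bound is the tail of an integrable function, so it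
vanishes as M → ∞. The second is at most 16BC/t uniformly in M, because the energy estimate at level
4M grows like M² and is divided by M². Taking t large first makes the total arbitrarily small. -/
theorem tendsto_cutoff_error [NeZero r] (hrn : r ≤ n - 1) (hn : n ≠ 0) (hw : ∀ a, w a ≠ 0)
    {f : Fin r → (Fin n × Fin r → ℝ) → ℝ}
    (hint : Integrable (fun z => ∑ k, (f k z / eigs (scatter w z) k) ^ 2)
      (stdGaussianPi (Fin n × Fin r))) :
    Tendsto (fun M => ∫ z, ∑ k, f k z * partialDeriv k (energyCutoff r M) (eigs (scatter w z))
      ∂(stdGaussianPi (Fin n × Fin r))) atTop (𝓝 0) := by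
  obtain ⟨B, hB0, hB⟩ := exists_abs_deriv_plateau_le
  obtain ⟨C, hC0, hC⟩ := exists_integral_ramp_mul_energyQuad_le hrn hn hw
  set g := fun z : Fin n × Fin r → ℝ => ∑ k, (f k z / eigs (scatter w z) k) ^ 2 with hg
  have hT : Tendsto (fun M : ℝ => ∫ z, g z ∂(stdGaussianPi (Fin n × Fin r)) -
      ∫ z, energyCutoff r (M / 2) (eigs (scatter w z)) * g z ∂(stdGaussianPi (Fin n × Fin r))) atTop (𝓝 0) := by
    rw [← sub_self (∫ z, g z ∂(stdGaussianPi (Fin n × Fin r)))]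
    exact tendsto_const_nhds.sub ((tendsto_integral_energyCutoff_mul hrn hn hw hint).comp
      (tendsto_id.atTop_div_const two_pos))
  have hbound : ∀ t M : ℝ, 0 < t → 1 ≤ M →
      |∫ z, ∑ k, f k z * partialDeriv k (energyCutoff r M) (eigs (scatter w z)) ∂(stdGaussianPi (Fin n × Fin r))| ≤
        B * t / 2 * (∫ z, g z ∂(stdGaussianPi (Fin n × Fin r)) - ∫ z, energyCutoff r (M / 2) (eigs (scatter w z)) * g z ∂(stdGaussianPi (Fin n × Fin r))) +
          16 * B * C / t := by
    intro t M ht hM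
    have hM0 : 0 < M := by linarith
    have h1 := norm_integral_le_of_norm_le (f := fun z => ∑ k, f k z *
        partialDeriv k (energyCutoff r M) (eigs (scatter w z)))
      (integrable_cutoff_error_bound hrn hn hw hint (B * t / 2) (B / (t * M ^ 2)) hM0)
      ((ae_isSimpleSpectrum hrn hn hw).mono fun z hz =>
        abs_sum_partialDeriv_energyCutoff_le hB hM0 ht hz.eigs_mem fun k => f k z)
    refine h1.trans ?_
    have hd : Integrable (fun z => B * t / 2 *
        (g z - energyCutoff r (M / 2) (eigs (scatter w z)) * g z)) (stdGaussianPi (Fin n × Fin r)) :=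
      (hint.sub (integrable_energyCutoff_mul hrn hn hw _ hint)).const_mul _
    rw [integral_add hd
      ((integrable_ramp_mul_energyQuad hrn hn hw (by positivity)).const_mul _), integral_const_mul,
      integral_const_mul, integral_sub hint (integrable_energyCutoff_mul hrn hn hw _ hint)]
    gcongr
    have h2 := hC (4 * M) (by linarith)
    calc B / (t * M ^ 2) * _ ≤ B / (t * M ^ 2) * (C * (4 * M) ^ 2) := by gcongr
      _ = 16 * B * C / t := by field_simp; ring
  rw [Metric.tendsto_nhds]
  intro ε hε
  -- This makes 16BC/t at most ε/2; C + 1 instead of C keeps t positive.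
  set t := 32 * B * (C + 1) / ε with ht
  have ht0 : 0 < t := by positivity
  have hev : ∀ᶠ M in atTop, ∫ z, g z ∂(stdGaussianPi (Fin n × Fin r)) -
      ∫ z, energyCutoff r (M / 2) (eigs (scatter w z)) * g z ∂(stdGaussianPi (Fin n × Fin r)) < ε / (B * t) :=
    (tendsto_order.1 hT).2 _ (by positivity)
  filter_upwards [hev, eventually_ge_atTop 1] with M h1 h2
  rw [Real.dist_eq, sub_zero]
  refine (hbound t M ht0 h2).trans_lt ?_
  have h3 : B * t / 2 * (∫ z, g z ∂(stdGaussianPi (Fin n × Fin r)) - ∫ z, energyCutoff r (M / 2) (eigs (scatter w z)) * g z ∂(stdGaussianPi (Fin n × Fin r))) <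
      ε / 2 := by
    calc _ < B * t / 2 * (ε / (B * t)) := by gcongr
      _ = ε / 2 := by field_simp
  have h4 : 16 * B * C / t ≤ ε / 2 := by
    rw [div_le_iff₀ ht0, ht]
    have : ε / 2 * (32 * B * (C + 1) / ε) = 16 * B * (C + 1) := by field_simp; ring
    rw [this]
    gcongr
    linarith
  linarith

end Cutoff

/-! ### The first Stein identity without compact support -/

section FirstIdentity

variable {n r : ℕ} {w : Fin r → ℝ}

/-- |φ_k| = |φ_k/l_k| · l_k is bounded by the sum of the squares of its factors, and the eigenvalues
have second moments. -/
theorem integrable_apply_of_sq (hrn : r ≤ n - 1) (hn : n ≠ 0) (hw : ∀ a, w a ≠ 0)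
    {φ : Fin r → (Fin r → ℝ) → ℝ} (hφ : ∀ k, ChamberMeasurable (φ k))
    (hsq : Integrable (fun z => ∑ k, (φ k (eigs (scatter w z)) / eigs (scatter w z) k) ^ 2)
      (stdGaussianPi (Fin n × Fin r))) (k : Fin r) :
    Integrable (fun z => φ k (eigs (scatter w z))) (stdGaussianPi (Fin n × Fin r)) := by
  refine (hsq.add (integrable_eigs_sq hrn hn hw k)).mono'
    ((hφ k).aestronglyMeasurable hrn hn hw) ((ae_isSimpleSpectrum hrn hn hw).mono fun z hz => ?_)
  have hl := hz.eigs_mem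
  set l := eigs (scatter w z) with hl'
  rw [Pi.add_apply, Real.norm_eq_abs]
  have h1 : (φ k l / l k) ^ 2 ≤ ∑ k, (φ k l / l k) ^ 2 :=
    Finset.single_le_sum (f := fun k => (φ k l / l k) ^ 2) (fun _ _ => sq_nonneg _)
      (Finset.mem_univ k)
  refine le_trans ?_ (add_le_add_left h1 _)
  have e : φ k l = φ k l / l k * l k := (div_mul_cancel₀ _ (hl.2 k).ne').symm
  rw [← hl']
  conv_lhs => rw [e, abs_mul]
  rw [← sq_abs (φ k l / l k), ← sq_abs (l k)]
  nlinarith [sq_nonneg (|φ k l / l k| - |l k|), abs_nonneg (φ k l / l k), abs_nonneg (l k)]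

theorem integrable_mul_invWeight (hrn : r ≤ n - 1) (hn : n ≠ 0) (hw : ∀ a, w a ≠ 0)
    {f : (Fin n × Fin r → ℝ) → ℝ} (hf : Integrable f (stdGaussianPi (Fin n × Fin r))) (k : Fin r) :
    Integrable (fun z => f z * invWeight w (scatter w z) k) (stdGaussianPi (Fin n × Fin r)) := by
  refine (hf.norm.mul_const (∑ a, (w a ^ 2)⁻¹)).mono'
    (hf.1.mul (aestronglyMeasurable_invWeight hrn hn hw k)) (.of_forall fun z => ?_)
  rw [norm_mul, Real.norm_of_nonneg (invWeight_nonneg _ _ _)]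
  exact mul_le_mul_of_nonneg_left (invWeight_le _ _ _) (norm_nonneg _)

/-- **First Stein identity** for functions of the sample eigenvalues. -/
theorem integral_steinOp [NeZero r] (hrn : r ≤ n - 1) (hn : n ≠ 0) (hw : ∀ a, w a ≠ 0)
    {φ : Fin r → (Fin r → ℝ) → ℝ} (hφ : ∀ k, DifferentiableOn ℝ (φ k) (strictChamber r))
    (hsq : Integrable (fun z => ∑ k, (φ k (eigs (scatter w z)) / eigs (scatter w z) k) ^ 2)
      (stdGaussianPi (Fin n × Fin r)))
    (hst : Integrable (fun z => steinOp n φ (eigs (scatter w z)))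
      (stdGaussianPi (Fin n × Fin r))) :
    ∫ z, steinOp n φ (eigs (scatter w z)) ∂(stdGaussianPi (Fin n × Fin r)) =
      ∫ z, n * ∑ k, φ k (eigs (scatter w z)) * invWeight w (scatter w z) k
        ∂(stdGaussianPi (Fin n × Fin r)) := by
  set γ := stdGaussianPi (Fin n × Fin r)
  have hφm := fun k => ChamberMeasurable.of_continuousOn (hφ k).continuousOn
  have hR : Integrable (fun z => n * ∑ k, φ k (eigs (scatter w z)) *
      invWeight w (scatter w z) k) γ :=
    (integrable_finsetSum _ fun k _ => integrable_mul_invWeight hrn hn hw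
      (integrable_apply_of_sq hrn hn hw hφm hsq k) k).const_mul _
  have hfm := fun k => (hφm k).aestronglyMeasurable hrn hn hw
  -- The compactly supported identity for the truncated functions. As M → ∞ two terms converge by
  -- domination and the gradient term vanishes.
  have hid : ∀ M : ℝ, 0 < M →
      ∫ z, energyCutoff r M (eigs (scatter w z)) * steinOp n φ (eigs (scatter w z)) ∂γ +
        2 * ∫ z, ∑ k, φ k (eigs (scatter w z)) *
          partialDeriv k (energyCutoff r M) (eigs (scatter w z)) ∂γ =
      ∫ z, energyCutoff r M (eigs (scatter w z)) * (n * ∑ k, φ k (eigs (scatter w z)) *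
        invWeight w (scatter w z) k) ∂γ := by
    intro M hM
    have hi1 := integrable_energyCutoff_mul hrn hn hw M hst
    have hi2 := integrable_cutoff_error hrn hn hw hfm hsq hM
    have he : ∀ᵐ z ∂γ, steinOp n (fun k l => energyCutoff r M l * φ k l) (eigs (scatter w z)) =
        energyCutoff r M (eigs (scatter w z)) * steinOp n φ (eigs (scatter w z)) +
        2 * ∑ k, φ k (eigs (scatter w z)) *
          partialDeriv k (energyCutoff r M) (eigs (scatter w z)) :=
      (ae_isSimpleSpectrum hrn hn hw).mono fun z hz =>
        have hm := isOpen_strictChamber.mem_nhds hz.eigs_mem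
        steinOp_mul ((differentiableOn_energyCutoff M).differentiableAt hm)
          fun k => (hφ k).differentiableAt hm
    have key := integral_steinOp_of_compact hrn hn hw (isCompact_chamberBox (2 * M))
      (chamberBox_subset (2 * M)) (φ := fun k l => energyCutoff r M l * φ k l)
      (fun k l hl => by rw [energyCutoff_eq_zero hM hl, zero_mul])
      (fun k => (differentiableOn_energyCutoff M).fun_mul (hφ k))
      ((hi1.add (hi2.const_mul 2)).congr (he.mono fun z hz => hz.symm))
    rw [integral_congr_ae he, integral_add hi1 (hi2.const_mul 2), integral_const_mul] at key
    rw [key]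
    refine integral_congr_ae (.of_forall fun z => ?_)
    simp only [Finset.mul_sum]
    exact Finset.sum_congr rfl fun k _ => by ring
  have h1 := tendsto_integral_energyCutoff_mul hrn hn hw hst
  have h2 := tendsto_integral_energyCutoff_mul hrn hn hw hR
  have h3 := tendsto_cutoff_error hrn hn hw hsq
      (f := fun k z => φ k (eigs (scatter w z)))
  have h4 := h1.add (h3.const_mul 2)
  rw [mul_zero, add_zero] at h4
  exact tendsto_nhds_unique (h4.congr' (by
    filter_upwards [eventually_gt_atTop 0] with M hM using hid M hM)) h2

end FirstIdentity

end

noncomputable section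

open Filter Topology

/-! ### The second Stein identity -/

section QuadWeight

variable {n r : ℕ} {w : Fin r → ℝ}

theorem spectralSum_transpose (S : Matrix (Fin r) (Fin r) ℝ) (d : Fin r → ℝ) :
    (spectralSum S d)ᵀ = spectralSum S d := by
  simp only [spectralSum, transpose_sum, transpose_smul, eigenProj_transpose]

/-- Written as a sum of squares with positive weights, tr(D⁻¹KD⁻¹K) is comparable from both sides
with tr K² = ∑ d_k². -/
theorem quadWeight_eq_sum (w : Fin r → ℝ) (S : Matrix (Fin r) (Fin r) ℝ) (d : Fin r → ℝ) :
    quadWeight w S d = ∑ a, ∑ b, (w a ^ 2)⁻¹ * (w b ^ 2)⁻¹ * spectralSum S d a b ^ 2 := by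
  have h : ∀ a b, spectralSum S d b a = spectralSum S d a b := fun a b => by
    conv_lhs => rw [← spectralSum_transpose, transpose_apply]
  simp only [quadWeight, trace, diag_apply, mul_apply (M := diagonal _ * _), diagonal_mul]
  refine Finset.sum_congr rfl fun a _ => Finset.sum_congr rfl fun b _ => ?_
  rw [h a b]
  ring

theorem IsSimpleSpectrum.sum_sum_spectralSum_sq {S : Matrix (Fin r) (Fin r) ℝ}
    (h : IsSimpleSpectrum S) (d : Fin r → ℝ) :
    ∑ a, ∑ b, spectralSum S d a b ^ 2 = ∑ k, d k ^ 2 := by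
  have h1 : (spectralSum S d * spectralSum S d).trace = ∑ a, ∑ b, spectralSum S d a b ^ 2 := by
    simp only [trace, diag_apply, mul_apply]
    refine Finset.sum_congr rfl fun a _ => Finset.sum_congr rfl fun b _ => ?_
    rw [sq]
    congr 1
    conv_lhs => rw [← spectralSum_transpose, transpose_apply]
  rw [← h1, h.spectralSum_mul_spectralSum]
  simp only [spectralSum, trace_sum, trace_smul, h.trace_eigenProj, smul_eq_mul, mul_one, sq]

theorem quadWeight_le {S : Matrix (Fin r) (Fin r) ℝ} (h : IsSimpleSpectrum S) (d : Fin r → ℝ) :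
    quadWeight w S d ≤ (∑ a, (w a ^ 2)⁻¹) ^ 2 * ∑ k, d k ^ 2 := by
  rw [quadWeight_eq_sum, ← h.sum_sum_spectralSum_sq, Finset.mul_sum]
  refine Finset.sum_le_sum fun a _ => ?_
  rw [Finset.mul_sum]
  refine Finset.sum_le_sum fun b _ => mul_le_mul_of_nonneg_right ?_ (sq_nonneg _)
  have hs : ∀ c, (w c ^ 2)⁻¹ ≤ ∑ a, (w a ^ 2)⁻¹ := fun c =>
    Finset.single_le_sum (f := fun a => (w a ^ 2)⁻¹) (fun a _ => by positivity) (Finset.mem_univ c)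
  rw [sq (∑ a, _)]
  exact mul_le_mul (hs a) (hs b) (by positivity) (Finset.sum_nonneg fun a _ => by positivity)

theorem quadWeight_nonneg (w : Fin r → ℝ) (S : Matrix (Fin r) (Fin r) ℝ) (d : Fin r → ℝ) :
    0 ≤ quadWeight w S d := by
  rw [quadWeight_eq_sum]
  exact Finset.sum_nonneg fun a _ => Finset.sum_nonneg fun b _ => by positivity

/-- Coercivity: each weight w_a⁻² is at least (1 + ∑ w²)⁻¹. Through this bound the second identity
controls E ∑ ψ_k². -/
theorem exists_le_quadWeight (hw : ∀ a, w a ≠ 0) : ∃ c : ℝ, 0 < c ∧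
    ∀ S : Matrix (Fin r) (Fin r) ℝ, IsSimpleSpectrum S → ∀ d : Fin r → ℝ,
      c * ∑ k, d k ^ 2 ≤ quadWeight w S d := by
  have hs : 0 ≤ ∑ a, w a ^ 2 := Finset.sum_nonneg fun a _ => sq_nonneg _
  set s := ∑ a, w a ^ 2 with hs'
  refine ⟨(1 + s)⁻¹ * (1 + s)⁻¹, by positivity, fun S h d => ?_⟩
  rw [quadWeight_eq_sum, ← h.sum_sum_spectralSum_sq, Finset.mul_sum]
  refine Finset.sum_le_sum fun a _ => ?_
  rw [Finset.mul_sum]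
  refine Finset.sum_le_sum fun b _ => mul_le_mul_of_nonneg_right ?_ (sq_nonneg _)
  have h1 : ∀ c, (1 + s)⁻¹ ≤ (w c ^ 2)⁻¹ := fun c => by
    have h2 : w c ^ 2 ≤ s :=
      Finset.single_le_sum (f := fun a => w a ^ 2) (fun a _ => sq_nonneg _) (Finset.mem_univ c)
    have h3 : 0 < w c ^ 2 := by have := hw c; positivity
    exact inv_anti₀ h3 (by linarith)
  exact mul_le_mul (h1 a) (h1 b) (by positivity) (by positivity)

theorem aestronglyMeasurable_quadWeight (hrn : r ≤ n - 1) (hn : n ≠ 0) (hw : ∀ a, w a ≠ 0)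
    {ψ : Fin r → (Fin r → ℝ) → ℝ} (hψ : ∀ k, DifferentiableOn ℝ (ψ k) (strictChamber r)) :
    AEStronglyMeasurable
      (fun z => quadWeight w (scatter w z) fun k => ψ k (eigs (scatter w z)))
      (stdGaussianPi (Fin n × Fin r)) := by
  refine aestronglyMeasurable_of_continuousAt hrn hn hw fun z hz => ?_
  simp only [quadWeight_eq_sum]
  exact tendsto_finsetSum _ fun a _ => tendsto_finsetSum _ fun b _ =>
    (((differentiableAt_spectralSum_apply hψ hz a b).continuousAt).pow 2).const_mul _

end QuadWeight

/-! ### A cutoff away from zero and infinity that ignores coinciding eigenvalues -/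

section RadialCutoff

variable {r : ℕ}

/-- The sum of the eigenvalues and of their inverses. -/
def spread (l : Fin r → ℝ) : ℝ := ∑ k, (l k + (l k)⁻¹)

theorem hasFDerivAt_spread {l : Fin r → ℝ} (hl : l ∈ strictChamber r) :
    HasFDerivAt spread (∑ k, (coordProj k + (-(l k ^ 2)⁻¹) • coordProj k)) l := by
  have hp : ∀ k, HasFDerivAt (fun l : Fin r → ℝ => l k) (coordProj k) l := fun k =>
    hasFDerivAt_apply k l
  refine HasFDerivAt.fun_sum fun k _ => (hp k).add ?_
  exact HasDerivAt.comp_hasFDerivAt (h₂ := fun t : ℝ => t⁻¹) l (hasDerivAt_inv (hl.2 k).ne') (hp k)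

theorem partialDeriv_spread {l : Fin r → ℝ} (hl : l ∈ strictChamber r) (k : Fin r) :
    partialDeriv k spread l = 1 - (l k ^ 2)⁻¹ := by
  have h := hasFDerivAt_spread hl
  rw [partialDeriv_eq_fderiv h.differentiableAt, h.fderiv]
  simp only [_root_.sum_apply, _root_.add_apply, _root_.smul_apply, ContinuousLinearMap.proj_apply,
    smul_eq_mul]
  rw [Finset.sum_eq_single k (fun b _ hb => by simp [hb]) (by simp)]
  simp
  ring

/-- A cutoff function of the spread of the eigenvalues. -/
def spreadCutoff (R : ℝ) (l : Fin r → ℝ) : ℝ := plateau (spread l / R)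

theorem hasFDerivAt_spreadCutoff (R : ℝ) {l : Fin r → ℝ} (hl : l ∈ strictChamber r) :
    HasFDerivAt (spreadCutoff R) ((deriv plateau (spread l / R) / R) • fderiv ℝ spread l) l := by
  have h := HasDerivAt.comp_hasFDerivAt (h₂ := fun t => plateau (t / R)) l
    (differentiable_plateau_div R (spread l)).hasDerivAt
    (hasFDerivAt_spread hl).differentiableAt.hasFDerivAt
  rwa [deriv_plateau_div] at h

theorem differentiableOn_spreadCutoff (R : ℝ) :
    DifferentiableOn ℝ (spreadCutoff R) (strictChamber r) := fun _ hl =>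
  (hasFDerivAt_spreadCutoff R hl).differentiableAt.differentiableWithinAt

theorem partialDeriv_spreadCutoff (R : ℝ) {l : Fin r → ℝ} (hl : l ∈ strictChamber r) (k : Fin r) :
    partialDeriv k (spreadCutoff R) l =
      deriv plateau (spread l / R) / R * (1 - (l k ^ 2)⁻¹) := by
  have h := hasFDerivAt_spreadCutoff R hl
  rw [partialDeriv_eq_fderiv h.differentiableAt, h.fderiv, _root_.smul_apply,
    ← partialDeriv_eq_fderiv (hasFDerivAt_spread hl).differentiableAt, partialDeriv_spread hl,
    smul_eq_mul]

theorem spreadCutoff_nonneg (R : ℝ) (l : Fin r → ℝ) : 0 ≤ spreadCutoff R l := plateau_nonneg _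

theorem spreadCutoff_le_one (R : ℝ) (l : Fin r → ℝ) : spreadCutoff R l ≤ 1 := plateau_le_one _

theorem spreadCutoff_eq_zero {R : ℝ} (hR : 0 < R) {l : Fin r → ℝ} (h : 2 * R ≤ spread l) :
    spreadCutoff R l = 0 := plateau_eq_zero (by rwa [le_div_iff₀ hR])

theorem spreadCutoff_eq_one {R : ℝ} (hR : 0 < R) {l : Fin r → ℝ} (h : spread l ≤ R) :
    spreadCutoff R l = 1 := plateau_eq_one (by rwa [div_le_one hR])

theorem apply_le_spread {l : Fin r → ℝ} (hl : ∀ k, 0 < l k) (k : Fin r) :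
    l k ≤ spread l ∧ (l k)⁻¹ ≤ spread l := by
  have h : l k + (l k)⁻¹ ≤ spread l :=
    Finset.single_le_sum (f := fun k => l k + (l k)⁻¹)
      (fun b _ => (add_pos (hl b) (inv_pos.2 (hl b))).le) (Finset.mem_univ k)
  have h1 := hl k
  have h2 := inv_pos.2 (hl k)
  constructor <;> linarith

/-- Bounded spread confines l and 1/l, so the eigenvalues stay in a compact set of weakly ordered
tuples. Continuity of ψ at tuples with equal entries is used here: nothing keeps the eigenvalues
apart. -/
theorem exists_abs_le_of_spread_le {f : (Fin r → ℝ) → ℝ} (hf : ContinuousOn f (weakChamber r))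
    {R : ℝ} (hR : 0 < R) :
    ∃ B : ℝ, ∀ l ∈ strictChamber r, spread l ≤ R → |f l| ≤ B := by
  set K : Set (Fin r → ℝ) := {l | (∀ k, l k ∈ Set.Icc R⁻¹ R) ∧ ∀ k b, k ≤ b → l b ≤ l k} with hK
  have hKc : IsCompact K := by
    have h1 : IsCompact (Set.univ.pi fun _ : Fin r => Set.Icc R⁻¹ R) :=
      isCompact_univ_pi fun _ => isCompact_Icc
    have h2 : IsClosed {l : Fin r → ℝ | ∀ k b, k ≤ b → l b ≤ l k} := by
      simp only [Set.ofPred_forall]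
      exact isClosed_iInter fun k => isClosed_iInter fun b => isClosed_iInter fun _ =>
        isClosed_le (by fun_prop) (by fun_prop)
    convert! h1.inter_right h2 using 1
    ext l
    simp [K, Pi.le_def, forall_and]
  have hKs : K ⊆ weakChamber r := fun l hl =>
    ⟨fun k b hkb => hl.2 k b hkb, fun k => (inv_pos.2 hR).trans_le (hl.1 k).1⟩
  obtain ⟨B, hB⟩ := hKc.exists_bound_of_continuousOn (hf.mono hKs)
  refine ⟨B, fun l hl h => hB l ⟨fun k => ⟨?_, ?_⟩, fun k b hkb => hl.1.antitone hkb⟩⟩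
  · have h1 := (apply_le_spread hl.2 k).2.trans h
    exact (inv_le_comm₀ (hl.2 k) hR).1 h1
  · exact (apply_le_spread hl.2 k).1.trans h

end RadialCutoff

/-! ### The second Stein identity and square integrability of ψ -/

section SecondIdentity

variable {n r : ℕ} {w : Fin r → ℝ}

theorem aestronglyMeasurable_spreadCutoff (hrn : r ≤ n - 1) (hn : n ≠ 0) (hw : ∀ a, w a ≠ 0)
    (R : ℝ) : AEStronglyMeasurable (fun z => spreadCutoff R (eigs (scatter w z)))
      (stdGaussianPi (Fin n × Fin r)) :=
  ChamberMeasurable.aestronglyMeasurable hrn hn hw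
    (.of_continuousOn (differentiableOn_spreadCutoff R).continuousOn)

theorem integrable_spreadCutoff_mul (hrn : r ≤ n - 1) (hn : n ≠ 0) (hw : ∀ a, w a ≠ 0) (R : ℝ)
    {f : (Fin n × Fin r → ℝ) → ℝ} (hf : Integrable f (stdGaussianPi (Fin n × Fin r))) :
    Integrable (fun z => spreadCutoff R (eigs (scatter w z)) * f z)
      (stdGaussianPi (Fin n × Fin r)) := by
  refine hf.norm.mono' ((aestronglyMeasurable_spreadCutoff hrn hn hw R).mul hf.1)
    (.of_forall fun z => ?_)
  rw [norm_mul, Real.norm_of_nonneg (spreadCutoff_nonneg _ _)]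
  exact mul_le_of_le_one_left (norm_nonneg _) (spreadCutoff_le_one _ _)

theorem tendsto_integral_spreadCutoff_mul (hrn : r ≤ n - 1) (hn : n ≠ 0) (hw : ∀ a, w a ≠ 0)
    {f : (Fin n × Fin r → ℝ) → ℝ} (hf : Integrable f (stdGaussianPi (Fin n × Fin r))) :
    Tendsto (fun R => ∫ z, spreadCutoff R (eigs (scatter w z)) * f z
      ∂(stdGaussianPi (Fin n × Fin r))) atTop (𝓝 (∫ z, f z ∂(stdGaussianPi (Fin n × Fin r)))) := by
  refine tendsto_integral_filter_of_dominated_convergence (fun z => ‖f z‖)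
    (.of_forall fun R => (integrable_spreadCutoff_mul hrn hn hw R hf).1)
    (.of_forall fun R => .of_forall fun z => ?_) hf.norm (.of_forall fun z => ?_)
  · rw [norm_mul, Real.norm_of_nonneg (spreadCutoff_nonneg _ _)]
    exact mul_le_of_le_one_left (norm_nonneg _) (spreadCutoff_le_one _ _)
  · refine tendsto_const_nhds.congr' ?_
    filter_upwards [eventually_ge_atTop (spread (eigs (scatter w z))), eventually_gt_atTop 0]
      with R hR hR0
    rw [spreadCutoff_eq_one hR0 hR, one_mul]

/-- The error term produced by the cutoff of the spread. -/
def spreadError (w : Fin r → ℝ) (ψ : Fin r → (Fin r → ℝ) → ℝ) (R : ℝ) (z : Fin n × Fin r → ℝ) : ℝ :=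
  ∑ k, ψ k (eigs (scatter w z)) ^ 2 * invWeight w (scatter w z) k *
    partialDeriv k (spreadCutoff R) (eigs (scatter w z))

theorem aestronglyMeasurable_spreadError (hrn : r ≤ n - 1) (hn : n ≠ 0) (hw : ∀ a, w a ≠ 0)
    {ψ : Fin r → (Fin r → ℝ) → ℝ} (hψ : ∀ k, DifferentiableOn ℝ (ψ k) (strictChamber r)) (R : ℝ) :
    AEStronglyMeasurable (spreadError (n := n) w ψ R) (stdGaussianPi (Fin n × Fin r)) :=
  Finset.aestronglyMeasurable_fun_sum _ fun k _ => ((((ChamberMeasurable.of_continuousOn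
    (hψ k).continuousOn).aestronglyMeasurable hrn hn hw).pow 2).mul
      (aestronglyMeasurable_invWeight hrn hn hw k)).mul
      ((ChamberMeasurable.partialDeriv (differentiableOn_spreadCutoff R) k).aestronglyMeasurable
        hrn hn hw)

/-- The k-th derivative of the cutoff is O(1/R)(1 + l_k⁻²), supported where the spread is at most
2R; there the cutoff at 2R equals 1. The part 1 is charged to the truncated ∑ ψ_k², the part l_k⁻²
to ∑ (ψ_k/l_k)². -/
theorem abs_spreadError_le {B : ℝ} (hB : ∀ t, |deriv plateau t| ≤ B) {R : ℝ} (hR : 0 < R)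
    (ψ : Fin r → (Fin r → ℝ) → ℝ) {z : Fin n × Fin r → ℝ} (hz : IsSimpleSpectrum (scatter w z)) :
    |spreadError w ψ R z| ≤ B * (∑ a, (w a ^ 2)⁻¹) / R *
      (spreadCutoff (2 * R) (eigs (scatter w z)) * ∑ k, ψ k (eigs (scatter w z)) ^ 2 +
        ∑ k, (ψ k (eigs (scatter w z)) / eigs (scatter w z) k) ^ 2) := by
  have hl := hz.eigs_mem
  have hB0 : 0 ≤ B := (abs_nonneg _).trans (hB 0)
  unfold spreadError
  have hD : ∀ k, |invWeight w (scatter w z) k| ≤ ∑ a, (w a ^ 2)⁻¹ := fun k => by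
    rw [abs_of_nonneg (invWeight_nonneg _ _ _)]
    exact invWeight_le _ _ _
  have hD0 : 0 ≤ ∑ a, (w a ^ 2)⁻¹ := Finset.sum_nonneg fun a _ => by positivity
  set l := eigs (scatter w z)
  set D := ∑ a, (w a ^ 2)⁻¹
  have hpt : ∀ k, |partialDeriv k (spreadCutoff R) l| ≤
      B / R * (spreadCutoff (2 * R) l + (l k ^ 2)⁻¹) := by
    intro k
    have h0 := spreadCutoff_nonneg (2 * R) l
    rw [partialDeriv_spreadCutoff R hl]
    by_cases h : 2 ≤ spread l / R
    · rw [deriv_plateau_eq_zero_of_ge h]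
      simp only [zero_div, zero_mul, abs_zero]
      positivity
    · push Not at h
      rw [div_lt_iff₀ hR] at h
      rw [spreadCutoff_eq_one (by positivity) h.le, abs_mul, abs_div, abs_of_pos hR]
      have h2 : 0 ≤ (l k ^ 2)⁻¹ := by positivity
      have h3 : |1 - (l k ^ 2)⁻¹| ≤ 1 + (l k ^ 2)⁻¹ := by
        rw [abs_le]; constructor <;> linarith
      have h4 := hB (spread l / R)
      gcongr
  rw [Finset.mul_sum (f := fun k => ψ k l ^ 2), ← Finset.sum_add_distrib, Finset.mul_sum]
  refine (Finset.abs_sum_le_sum_abs _ _).trans (Finset.sum_le_sum fun k _ => ?_)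
  rw [abs_mul, abs_mul, abs_of_nonneg (sq_nonneg (ψ k l))]
  calc ψ k l ^ 2 * |invWeight w (scatter w z) k| * |partialDeriv k (spreadCutoff R) l|
      ≤ ψ k l ^ 2 * D * (B / R * (spreadCutoff (2 * R) l + (l k ^ 2)⁻¹)) := by
        gcongr
        · exact hD k
        · exact hpt k
    _ = _ := by
        have := (hl.2 k).ne'
        field_simp

/-- On the support l_k ≤ 2R. This gives an a priori growth O(R²) of the truncated second moments. -/
theorem spreadCutoff_mul_sq_le {ψ : Fin r → (Fin r → ℝ) → ℝ} {R : ℝ} (hR : 0 < R)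
    {l : Fin r → ℝ} (hl : l ∈ strictChamber r) :
    spreadCutoff R l * ∑ k, ψ k l ^ 2 ≤ 4 * R ^ 2 * ∑ k, (ψ k l / l k) ^ 2 := by
  by_cases h : 2 * R ≤ spread l
  · rw [spreadCutoff_eq_zero hR h, zero_mul]
    exact mul_nonneg (by positivity) (Finset.sum_nonneg fun _ _ => sq_nonneg _)
  · push Not at h
    refine (mul_le_of_le_one_left (Finset.sum_nonneg fun _ _ => sq_nonneg _)
      (spreadCutoff_le_one R l)).trans ?_
    rw [Finset.mul_sum]
    refine Finset.sum_le_sum fun k _ => ?_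
    have h1 := ((apply_le_spread hl.2 k).1.trans_lt h).le
    have h2 := hl.2 k
    have e : ψ k l ^ 2 = l k ^ 2 * (ψ k l / l k) ^ 2 := by field_simp
    rw [e]
    refine mul_le_mul_of_nonneg_right ?_ (sq_nonneg _)
    nlinarith

/-- The second Stein identity with a cutoff of the spread of the eigenvalues. -/
theorem integral_spreadCutoff_quadWeight [NeZero r] (hrn : r ≤ n - 1) (hn : n ≠ 0)
    (hw : ∀ a, w a ≠ 0) {ψ : Fin r → (Fin r → ℝ) → ℝ}
    (hψc : ∀ k, ContinuousOn (ψ k) (weakChamber r))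
    (hψ : ∀ k, DifferentiableOn ℝ (ψ k) (strictChamber r))
    (hsq : Integrable (fun z => ∑ k, (ψ k (eigs (scatter w z)) / eigs (scatter w z) k) ^ 2)
      (stdGaussianPi (Fin n × Fin r)))
    (hquad : ∀ k, Integrable (fun z => steinQuad n ψ k (eigs (scatter w z)))
      (stdGaussianPi (Fin n × Fin r))) {R : ℝ} (hR : 0 < R) :
    ∫ z, spreadCutoff R (eigs (scatter w z)) *
        (∑ k, steinQuad n ψ k (eigs (scatter w z)) * invWeight w (scatter w z) k)
        ∂(stdGaussianPi (Fin n × Fin r)) +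
      2 * ∫ z, spreadError w ψ R z ∂(stdGaussianPi (Fin n × Fin r)) =
    ∫ z, n * (spreadCutoff R (eigs (scatter w z)) *
      quadWeight w (scatter w z) fun k => ψ k (eigs (scatter w z)))
      ∂(stdGaussianPi (Fin n × Fin r)) := by
  obtain ⟨B, hB0, hB⟩ := exists_abs_deriv_plateau_le
  -- Cutoffs up to level 2R occur, and their supports reach spread 4R.
  choose b hb using fun k => exists_abs_le_of_spread_le (hψc k) (show 0 < 4 * R by positivity)
  have hsimple := ae_isSimpleSpectrum (n := n) hrn hn hw
  have hψm := fun k => ChamberMeasurable.of_continuousOn (hψ k).continuousOn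
  have hψb : ∀ l ∈ strictChamber r, ∀ R' : ℝ, 0 < R' → R' ≤ 2 * R →
      spreadCutoff R' l * ∑ k, ψ k l ^ 2 ≤ ∑ k, b k ^ 2 := by
    intro l hl R' h0 h1
    by_cases h : 2 * R' ≤ spread l
    · rw [spreadCutoff_eq_zero h0 h, zero_mul]
      exact Finset.sum_nonneg fun _ _ => sq_nonneg _
    · push Not at h
      refine (mul_le_of_le_one_left (Finset.sum_nonneg fun _ _ => sq_nonneg _)
        (spreadCutoff_le_one R' l)).trans (Finset.sum_le_sum fun k _ => ?_)
      exact sq_le_sq' (by linarith [(abs_le.1 (hb k l hl (by linarith))).1])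
        (abs_le.1 (hb k l hl (by linarith))).2
  have hθm := aestronglyMeasurable_spreadCutoff (n := n) hrn hn hw R
  have hquad' : Integrable (fun z => ∑ k, steinQuad n ψ k (eigs (scatter w z)) *
      invWeight w (scatter w z) k) (stdGaussianPi (Fin n × Fin r)) :=
    integrable_finsetSum _ fun k _ => integrable_mul_invWeight hrn hn hw (hquad k) k
  have hi1 := integrable_spreadCutoff_mul hrn hn hw R hquad'
  have hi2 : Integrable (spreadError (n := n) w ψ R) (stdGaussianPi (Fin n × Fin r)) := by
    refine (((integrable_const (∑ k, b k ^ 2)).add hsq).const_mul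
      (B * (∑ a, (w a ^ 2)⁻¹) / R)).mono' (aestronglyMeasurable_spreadError hrn hn hw hψ R)
      (hsimple.mono fun z hz => (abs_spreadError_le hB hR ψ hz).trans ?_)
    have h2 := hψb _ hz.eigs_mem (2 * R) (by positivity) le_rfl
    have h3 : 0 ≤ ∑ a, (w a ^ 2)⁻¹ := Finset.sum_nonneg fun a _ => by positivity
    simp only [Pi.add_apply]
    gcongr
  have hi3 : Integrable (fun z => spreadCutoff R (eigs (scatter w z)) *
      quadWeight w (scatter w z) fun k => ψ k (eigs (scatter w z)))
      (stdGaussianPi (Fin n × Fin r)) := by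
    refine (integrable_const ((∑ a, (w a ^ 2)⁻¹) ^ 2 * ∑ k, b k ^ 2)).mono'
      (hθm.mul (aestronglyMeasurable_quadWeight hrn hn hw hψ)) (hsimple.mono fun z hz => ?_)
    have h0 := spreadCutoff_nonneg R (eigs (scatter w z))
    rw [Real.norm_of_nonneg (mul_nonneg h0 (quadWeight_nonneg _ _ _))]
    refine (mul_le_mul_of_nonneg_left (quadWeight_le hz _) h0).trans ?_
    have h2 := hψb _ hz.eigs_mem R hR (by linarith)
    have h3 : 0 ≤ (∑ a, (w a ^ 2)⁻¹) ^ 2 := sq_nonneg _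
    calc _ = (∑ a, (w a ^ 2)⁻¹) ^ 2 * (spreadCutoff R (eigs (scatter w z)) *
          ∑ k, ψ k (eigs (scatter w z)) ^ 2) := by ring
      _ ≤ _ := mul_le_mul_of_nonneg_left h2 h3
  -- The energy cutoff produces the error ∑ f_k ∂_k(cutoff). Without the spread cutoff, f_k/l_k
  -- would behave like ψ_k²/l_k, which is not known to be square integrable; with it, f_k/l_k is
  -- bounded.
  set f : Fin r → (Fin n × Fin r → ℝ) → ℝ := fun k z =>
    spreadCutoff R (eigs (scatter w z)) * ψ k (eigs (scatter w z)) ^ 2 *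
      invWeight w (scatter w z) k with hf
  have hfm : ∀ k, AEStronglyMeasurable (f k) (stdGaussianPi (Fin n × Fin r)) := fun k =>
    (hθm.mul (((hψm k).aestronglyMeasurable hrn hn hw).pow 2)).mul
      (aestronglyMeasurable_invWeight hrn hn hw k)
  have hfsq : Integrable (fun z => ∑ k, (f k z / eigs (scatter w z) k) ^ 2)
      (stdGaussianPi (Fin n × Fin r)) := by
    refine integrable_finsetSum _ fun k _ => ?_
    set D := ∑ a, (w a ^ 2)⁻¹ with hD
    have hD0 : 0 ≤ D := Finset.sum_nonneg fun a _ => by positivity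
    refine (integrable_const (((∑ k, b k ^ 2) * D * (2 * R)) ^ 2)).mono'
      (((hfm k).aemeasurable.div ((ChamberMeasurable.eval k).aestronglyMeasurable
        hrn hn hw).aemeasurable).pow_const 2).aestronglyMeasurable
      (hsimple.mono fun z hz => ?_)
    have hl := hz.eigs_mem
    rw [Real.norm_of_nonneg (sq_nonneg _)]
    simp only [hf]
    have h1 := invWeight_nonneg w (scatter w z) k
    have h2 := invWeight_le w (scatter w z) k
    set l := eigs (scatter w z)
    have h0 := spreadCutoff_nonneg R l
    by_cases h : 2 * R ≤ spread l
    · rw [spreadCutoff_eq_zero hR h]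
      exact le_trans (le_of_eq (by simp)) (sq_nonneg _)
    · push Not at h
      have h3 := ((apply_le_spread hl.2 k).2.trans_lt h).le
      have h4 := inv_pos.2 (hl.2 k)
      have h5 : spreadCutoff R l * ψ k l ^ 2 ≤ ∑ k, b k ^ 2 :=
        (mul_le_mul_of_nonneg_left (Finset.single_le_sum (f := fun k => ψ k l ^ 2)
          (fun _ _ => sq_nonneg _) (Finset.mem_univ k)) h0).trans (hψb l hl R hR (by linarith))
      have h6 : 0 ≤ spreadCutoff R l * ψ k l ^ 2 := by positivity
      rw [div_eq_mul_inv]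
      gcongr
  have hid : ∀ M : ℝ, 0 < M →
      ∫ z, energyCutoff r M (eigs (scatter w z)) * (spreadCutoff R (eigs (scatter w z)) *
        (∑ k, steinQuad n ψ k (eigs (scatter w z)) * invWeight w (scatter w z) k) +
          2 * spreadError w ψ R z) ∂(stdGaussianPi (Fin n × Fin r)) +
        2 * ∫ z, ∑ k, f k z * partialDeriv k (energyCutoff r M) (eigs (scatter w z))
          ∂(stdGaussianPi (Fin n × Fin r)) =
      ∫ z, energyCutoff r M (eigs (scatter w z)) * (n * (spreadCutoff R (eigs (scatter w z)) *
        quadWeight w (scatter w z) fun k => ψ k (eigs (scatter w z))))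
        ∂(stdGaussianPi (Fin n × Fin r)) := by
    intro M hM
    have hj1 := integrable_energyCutoff_mul hrn hn hw M (hi1.add (hi2.const_mul 2))
    have hj2 := integrable_cutoff_error hrn hn hw hfm hfsq hM
    have he : ∀ᵐ z ∂(stdGaussianPi (Fin n × Fin r)), ∑ k, invWeight w (scatter w z) k *
        (energyCutoff r M (eigs (scatter w z)) * spreadCutoff R (eigs (scatter w z)) *
          steinQuad n ψ k (eigs (scatter w z)) +
        2 * ψ k (eigs (scatter w z)) ^ 2 * partialDeriv k
          (fun l => energyCutoff r M l * spreadCutoff R l) (eigs (scatter w z))) =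
        energyCutoff r M (eigs (scatter w z)) * (spreadCutoff R (eigs (scatter w z)) *
        (∑ k, steinQuad n ψ k (eigs (scatter w z)) * invWeight w (scatter w z) k) +
          2 * spreadError w ψ R z) +
        2 * ∑ k, f k z * partialDeriv k (energyCutoff r M) (eigs (scatter w z)) := by
      refine hsimple.mono fun z hz => ?_
      have hm := isOpen_strictChamber.mem_nhds hz.eigs_mem
      simp only [partialDeriv_mul ((differentiableOn_energyCutoff M).differentiableAt hm)
        ((differentiableOn_spreadCutoff R).differentiableAt hm), spreadError, hf]
      simp only [mul_add, Finset.mul_sum, ← Finset.sum_add_distrib]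
      exact Finset.sum_congr rfl fun k _ => by ring
    have key := integral_steinQuad_of_compact hrn hn hw (isCompact_chamberBox (2 * M))
      (chamberBox_subset (2 * M)) (ξ := fun l => energyCutoff r M l * spreadCutoff R l) (ψ := ψ)
      (fun l hl => by rw [energyCutoff_eq_zero hM hl, zero_mul])
      ((differentiableOn_energyCutoff M).fun_mul (differentiableOn_spreadCutoff R)) hψ
      ((hj1.add (hj2.const_mul 2)).congr (he.mono fun z hz => hz.symm))
    rw [integral_congr_ae he] at key
    have e2 := integral_add hj1 (hj2.const_mul 2)
    rw [integral_const_mul] at e2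
    refine (e2.symm.trans key).trans (integral_congr_ae (.of_forall fun z => ?_))
    simp only
    ring
  have h1 := tendsto_integral_energyCutoff_mul hrn hn hw (hi1.add (hi2.const_mul 2))
  have h2 := tendsto_integral_energyCutoff_mul hrn hn hw (hi3.const_mul (n : ℝ))
  have h3 := tendsto_cutoff_error hrn hn hw hfsq
  have h4 := h1.add (h3.const_mul 2)
  rw [mul_zero, add_zero] at h4
  have h5 := tendsto_nhds_unique (h4.congr' (by
    filter_upwards [eventually_gt_atTop 0] with M hM using hid M hM)) h2
  rw [← h5, ← integral_const_mul]
  exact (integral_add hi1 (hi2.const_mul 2)).symm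

/-- Fatou's lemma, which upgrades a uniform bound on truncated moments to integrability. -/
theorem integrable_of_tendsto_of_integral_le {α : Type*} [MeasurableSpace α] {μ : Measure α}
    {f : α → ℝ} {F : ℕ → α → ℝ} {G : ℝ} (hF : ∀ m, Integrable (F m) μ) (h0 : ∀ m x, 0 ≤ F m x)
    (hlim : ∀ x, Tendsto (fun m => F m x) atTop (𝓝 (f x))) (hG : ∀ m, ∫ x, F m x ∂μ ≤ G) :
    Integrable f μ := by
  refine ⟨aestronglyMeasurable_of_tendsto_ae atTop (fun m => (hF m).1) (.of_forall hlim), ?_⟩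
  have h1 : ∫⁻ x, ‖f x‖ₑ ∂μ ≤ liminf (fun m => ∫⁻ x, ‖F m x‖ₑ ∂μ) atTop := by
    refine le_trans (le_of_eq ?_) (lintegral_liminf_le' fun m => (hF m).1.enorm)
    exact lintegral_congr fun x => (((hlim x).enorm).liminf_eq).symm
  refine (h1.trans ?_).trans_lt (ENNReal.ofReal_lt_top (r := G))
  refine liminf_le_of_le (by isBoundedDefault) fun b hb => ?_
  obtain ⟨m, hm⟩ := hb.exists
  refine hm.trans ?_
  rw [← ofReal_integral_norm_eq_lintegral_enorm (hF m)]
  refine ENNReal.ofReal_le_ofReal (le_trans (le_of_eq ?_) (hG m))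
  exact integral_congr_ae (.of_forall fun x => Real.norm_of_nonneg (h0 m x))

/-- **Second Stein identity** for functions of the sample eigenvalues. -/
theorem integral_quadWeight [NeZero r] (hrn : r ≤ n - 1) (hn : n ≠ 0)
    (hw : ∀ a, w a ≠ 0) {ψ : Fin r → (Fin r → ℝ) → ℝ}
    (hψc : ∀ k, ContinuousOn (ψ k) (weakChamber r))
    (hψ : ∀ k, DifferentiableOn ℝ (ψ k) (strictChamber r))
    (hsq : Integrable (fun z => ∑ k, (ψ k (eigs (scatter w z)) / eigs (scatter w z) k) ^ 2)
      (stdGaussianPi (Fin n × Fin r)))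
    (hquad : ∀ k, Integrable (fun z => steinQuad n ψ k (eigs (scatter w z)))
      (stdGaussianPi (Fin n × Fin r))) :
    Integrable (fun z => quadWeight w (scatter w z) fun k => ψ k (eigs (scatter w z)))
      (stdGaussianPi (Fin n × Fin r)) ∧
    n * ∫ z, (quadWeight w (scatter w z) fun k => ψ k (eigs (scatter w z)))
      ∂(stdGaussianPi (Fin n × Fin r)) =
    ∫ z, ∑ k, steinQuad n ψ k (eigs (scatter w z)) * invWeight w (scatter w z) k
      ∂(stdGaussianPi (Fin n × Fin r)) := by
  obtain ⟨B, hB0, hB⟩ := exists_abs_deriv_plateau_le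
  obtain ⟨c, hc0, hc⟩ := exists_le_quadWeight (w := w) hw
  have hsimple := ae_isSimpleSpectrum (n := n) hrn hn hw
  have hψm := fun k => ChamberMeasurable.of_continuousOn (hψ k).continuousOn
  have hquad' : Integrable (fun z => ∑ k, steinQuad n ψ k (eigs (scatter w z)) *
      invWeight w (scatter w z) k) (stdGaussianPi (Fin n × Fin r)) :=
    integrable_finsetSum _ fun k _ => integrable_mul_invWeight hrn hn hw (hquad k) k
  set D := ∑ a, (w a ^ 2)⁻¹ with hD
  have hD0 : 0 ≤ D := Finset.sum_nonneg fun a _ => by positivity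
  have hn0 : (0 : ℝ) < n := by positivity
  set T := fun z : Fin n × Fin r → ℝ =>
    quadWeight w (scatter w z) fun k => ψ k (eigs (scatter w z)) with hT
  set V := fun z : Fin n × Fin r → ℝ => ∑ k, ψ k (eigs (scatter w z)) ^ 2 with hV
  set Y := fun z : Fin n × Fin r → ℝ =>
    ∑ k, (ψ k (eigs (scatter w z)) / eigs (scatter w z) k) ^ 2 with hY
  set Z := fun z : Fin n × Fin r → ℝ =>
    ∑ k, steinQuad n ψ k (eigs (scatter w z)) * invWeight w (scatter w z) k with hZ
  have hV0 : ∀ z, 0 ≤ V z := fun z => Finset.sum_nonneg fun _ _ => sq_nonneg _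
  have hY0 : ∀ z, 0 ≤ Y z := fun z => Finset.sum_nonneg fun _ _ => sq_nonneg _
  have hVm : AEStronglyMeasurable V (stdGaussianPi (Fin n × Fin r)) :=
    Finset.aestronglyMeasurable_fun_sum _ fun k _ =>
      ((hψm k).aestronglyMeasurable hrn hn hw).pow 2
  have hTm : AEStronglyMeasurable T (stdGaussianPi (Fin n × Fin r)) :=
    aestronglyMeasurable_quadWeight hrn hn hw hψ
  have hiV : ∀ R : ℝ, 0 < R → Integrable (fun z => spreadCutoff R (eigs (scatter w z)) * V z)
      (stdGaussianPi (Fin n × Fin r)) := fun R hR =>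
    (hsq.const_mul (4 * R ^ 2)).mono' ((aestronglyMeasurable_spreadCutoff hrn hn hw R).mul hVm)
      (hsimple.mono fun z hz => by
        rw [Real.norm_of_nonneg (mul_nonneg (spreadCutoff_nonneg _ _) (hV0 z))]
        exact spreadCutoff_mul_sq_le hR hz.eigs_mem)
  have hiT : ∀ R : ℝ, 0 < R → Integrable (fun z => spreadCutoff R (eigs (scatter w z)) * T z)
      (stdGaussianPi (Fin n × Fin r)) := fun R hR =>
    ((hiV R hR).const_mul (D ^ 2)).mono' ((aestronglyMeasurable_spreadCutoff hrn hn hw R).mul hTm)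
      (hsimple.mono fun z hz => by
        have h0 := spreadCutoff_nonneg R (eigs (scatter w z))
        rw [Real.norm_of_nonneg (mul_nonneg h0 (quadWeight_nonneg _ _ _))]
        calc _ ≤ spreadCutoff R (eigs (scatter w z)) * (D ^ 2 * V z) :=
              mul_le_mul_of_nonneg_left (quadWeight_le hz _) h0
          _ = _ := by ring)
  set g : ℝ → ℝ := fun R => ∫ z, spreadCutoff R (eigs (scatter w z)) * V z
    ∂(stdGaussianPi (Fin n × Fin r)) with hg
  set E := ∫ z, Y z ∂(stdGaussianPi (Fin n × Fin r)) with hE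
  have hE0 : 0 ≤ E := integral_nonneg hY0
  have herr : ∀ R : ℝ, 0 < R → |∫ z, spreadError w ψ R z ∂(stdGaussianPi (Fin n × Fin r))| ≤
      B * D / R * (g (2 * R) + E) := by
    intro R hR
    have h1 := norm_integral_le_of_norm_le (f := fun z => spreadError w ψ R z)
      (((hiV (2 * R) (by positivity)).add hsq).const_mul (B * D / R))
      (hsimple.mono fun z hz => abs_spreadError_le hB hR ψ hz)
    refine h1.trans (le_of_eq ?_)
    rw [integral_const_mul]
    congr 1
    exact integral_add (hiV (2 * R) (by positivity)) hsq
  have hmain := fun R (hR : 0 < R) =>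
    integral_spreadCutoff_quadWeight hrn hn hw hψc hψ hsq hquad hR
  set A := ∫ z, ‖Z z‖ ∂(stdGaussianPi (Fin n × Fin r)) with hA
  have hA0 : 0 ≤ A := integral_nonneg fun z => norm_nonneg _
  -- Coercivity bounds n c g(R) by the right side of the cut-off identity; its left side is an
  -- integrable quantity plus an error which involves g at 2R, but with a factor 1/R.
  have hstep : ∀ R : ℝ, 1 ≤ R →
      n * c * g R ≤ (A + 2 * (B * D) * E) + 2 * (B * D) / R * g (2 * R) := by
    intro R hR
    have hR0 : 0 < R := by linarith
    have h1 : n * c * g R ≤ ∫ z, n * (spreadCutoff R (eigs (scatter w z)) * T z)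
        ∂(stdGaussianPi (Fin n × Fin r)) := by
      rw [hg, ← integral_const_mul]
      refine integral_mono_ae ((hiV R hR0).const_mul _) ((hiT R hR0).const_mul _)
        (hsimple.mono fun z hz => ?_)
      have h0 := spreadCutoff_nonneg R (eigs (scatter w z))
      have h2 := mul_le_mul_of_nonneg_left (hc _ hz fun k => ψ k (eigs (scatter w z))) h0
      calc (n : ℝ) * c * (spreadCutoff R (eigs (scatter w z)) * V z) =
            n * (spreadCutoff R (eigs (scatter w z)) * (c * V z)) := by ring
        _ ≤ _ := mul_le_mul_of_nonneg_left h2 hn0.le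
    have h2 : ∫ z, spreadCutoff R (eigs (scatter w z)) * Z z ∂(stdGaussianPi (Fin n × Fin r)) ≤
        A := by
      refine integral_mono (integrable_spreadCutoff_mul hrn hn hw R hquad') hquad'.norm fun z => ?_
      refine (le_abs_self _).trans ?_
      rw [abs_mul, abs_of_nonneg (spreadCutoff_nonneg _ _)]
      exact mul_le_of_le_one_left (abs_nonneg _) (spreadCutoff_le_one _ _)
    have h3 := (abs_le.1 (herr R hR0)).2
    have h4 := hmain R hR0
    have h5 : B * D / R * E ≤ B * D * E := by
      have : B * D / R ≤ B * D := div_le_self (by positivity) hR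
      exact mul_le_mul_of_nonneg_right this hE0
    have h6 : 2 * (B * D) / R * g (2 * R) = 2 * (B * D / R * g (2 * R)) := by ring
    rw [h6]
    linarith
  have hgle : ∀ R : ℝ, 0 < R → g R ≤ 4 * R ^ 2 * E := by
    intro R hR
    rw [hg, hE, ← integral_const_mul]
    exact integral_mono_ae (hiV R hR) (hsq.const_mul _)
      (hsimple.mono fun z hz => spreadCutoff_mul_sq_le hR hz.eigs_mem)
  obtain ⟨G, hG⟩ : ∃ G, ∀ R : ℝ, 1 ≤ R → g R ≤ G := by
    set a := (A + 2 * (B * D) * E) / (n * c)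
    set b := 2 * (B * D) / (n * c)
    have ha0 : 0 ≤ a := by positivity
    have hb0 : 0 ≤ b := by positivity
    have hs : ∀ R : ℝ, 1 ≤ R → g R ≤ a + b / R * g (2 * R) := by
      intro R hR
      have h1 : g R ≤ ((A + 2 * (B * D) * E) + 2 * (B * D) / R * g (2 * R)) / (n * c) := by
        rw [le_div_iff₀ (by positivity)]
        linarith [hstep R hR]
      refine h1.trans (le_of_eq ?_)
      simp only [a, b]
      field_simp
    -- Substituting g(R) ≤ a + (b/R) g(2R) into itself and then using g(4R) ≤ 64 R² E gives a + ab/R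
    -- + 32 b² E. A single substitution would leave a term growing like R.
    refine ⟨a + b * a + 32 * b ^ 2 * E, fun R hR => ?_⟩
    have hR0 : 0 < R := by linarith
    have h1 := hs R hR
    have h2 := hs (2 * R) (by linarith)
    have h3 := hgle (2 * (2 * R)) (by positivity)
    have h4 : g (2 * R) ≤ a + b / (2 * R) * (4 * (2 * (2 * R)) ^ 2 * E) :=
      h2.trans (by gcongr)
    have h5 : b / (2 * R) * (4 * (2 * (2 * R)) ^ 2 * E) = 32 * b * E * R := by
      field_simp
      ring
    rw [h5] at h4
    have h6 : b / R * g (2 * R) ≤ b / R * (a + 32 * b * E * R) := by gcongr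
    have h7 : b / R * (a + 32 * b * E * R) = b * a / R + 32 * b ^ 2 * E := by
      field_simp
    have h8 : b * a / R ≤ b * a := div_le_self (by positivity) hR
    linarith
  have hVint : Integrable V (stdGaussianPi (Fin n × Fin r)) := by
    refine integrable_of_tendsto_of_integral_le (G := G)
      (F := fun m z => spreadCutoff ((m : ℝ) + 1) (eigs (scatter w z)) * V z)
      (fun m => hiV _ (by positivity))
      (fun m z => mul_nonneg (spreadCutoff_nonneg _ _) (hV0 z)) (fun z => ?_)
      fun m => hG _ (by linarith [Nat.cast_nonneg (α := ℝ) m])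
    refine tendsto_const_nhds.congr' ?_
    obtain ⟨N, hN⟩ := exists_nat_ge (spread (eigs (scatter w z)))
    filter_upwards [eventually_ge_atTop N] with m hm
    have : (N : ℝ) ≤ m := Nat.cast_le.2 hm
    rw [spreadCutoff_eq_one (by positivity) (by linarith), one_mul]
  have hTint : Integrable T (stdGaussianPi (Fin n × Fin r)) :=
    (hVint.const_mul (D ^ 2)).mono' hTm (hsimple.mono fun z hz => by
      rw [Real.norm_of_nonneg (quadWeight_nonneg _ _ _)]
      exact quadWeight_le hz _)
  refine ⟨hTint, ?_⟩
  have hgV : ∀ R, 0 < R → g R ≤ ∫ z, V z ∂(stdGaussianPi (Fin n × Fin r)) := fun R hR =>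
    integral_mono (hiV R hR) hVint fun z =>
      mul_le_of_le_one_left (hV0 z) (spreadCutoff_le_one _ _)
  -- Now that ∑ ψ_k² is integrable, the error of the spread cutoff is O(1/R) and the cutoff can be
  -- removed.
  have herr0 : Tendsto (fun R => ∫ z, spreadError w ψ R z ∂(stdGaussianPi (Fin n × Fin r))) atTop
      (𝓝 0) := by
    have h1 : Tendsto (fun R : ℝ => B * D * (∫ z, V z ∂(stdGaussianPi (Fin n × Fin r)) + E) / R)
        atTop (𝓝 0) := tendsto_const_nhds.div_atTop tendsto_id
    refine squeeze_zero_norm' ?_ h1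
    filter_upwards [eventually_gt_atTop 0] with R hR
    refine (herr R hR).trans ?_
    have := hgV (2 * R) (by positivity)
    calc B * D / R * (g (2 * R) + E) ≤
          B * D / R * (∫ z, V z ∂(stdGaussianPi (Fin n × Fin r)) + E) :=
          mul_le_mul_of_nonneg_left (by linarith) (by positivity)
      _ = _ := by ring
  have h1 := (tendsto_integral_spreadCutoff_mul hrn hn hw hquad').add (herr0.const_mul 2)
  rw [mul_zero, add_zero] at h1
  have h2 := (tendsto_integral_spreadCutoff_mul hrn hn hw hTint).const_mul (n : ℝ)
  refine (tendsto_nhds_unique (h1.congr' ?_) h2).symm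
  filter_upwards [eventually_gt_atTop 0] with R hR
  exact (hmain R hR).trans (integral_const_mul _ _)

end SecondIdentity

end

noncomputable section

open Filter Topology

/-! ### Reduction of the Gaussian sample to standard normal variables -/

section GaussianSample

variable {n p r : ℕ}

/-- Both sides have the same characteristic function, as tᵗΣt = |Aᵗt|²; Σ may be singular. -/
theorem multivariateGaussian_eq_map {Sig : Matrix (Fin p) (Fin p) ℝ} (hSig : Sig.PosSemidef)
    {A : Matrix (Fin p) (Fin r) ℝ} (hA : Sig = A * Aᵀ) (μ : EuclideanSpace ℝ (Fin p)) :
    multivariateGaussian μ Sig =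
      (stdGaussianPi (Fin r)).map fun x => μ + WithLp.toLp 2 (A *ᵥ x) := by
  have hm : Measurable fun x : Fin r → ℝ => μ + WithLp.toLp 2 (A *ᵥ x) := by fun_prop
  have hp : IsProbabilityMeasure ((stdGaussianPi (Fin r)).map fun x => μ + WithLp.toLp 2 (A *ᵥ x)) :=
    Measure.isProbabilityMeasure_map hm.aemeasurable
  refine Measure.ext_of_charFun (funext fun t => ?_)
  rw [charFun_multivariateGaussian hSig, charFun_apply, integral_map hm.aemeasurable
    (Measurable.aestronglyMeasurable (by fun_prop))]
  have h1 : ∀ x : Fin r → ℝ, inner ℝ (μ + WithLp.toLp 2 (A *ᵥ x)) t =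
      inner ℝ t μ + inner ℝ (WithLp.toLp 2 x : EuclideanSpace ℝ (Fin r))
        (WithLp.toLp 2 (Aᵀ *ᵥ t.ofLp)) := by
    intro x
    rw [inner_add_left, real_inner_comm μ t]
    congr 1
    simp only [EuclideanSpace.inner_eq_star_dotProduct, star_trivial]
    rw [mulVec_transpose, dotProduct_mulVec]
  have h2 : ∫ x, Complex.exp (((inner ℝ (WithLp.toLp 2 x : EuclideanSpace ℝ (Fin r))
        (WithLp.toLp 2 (Aᵀ *ᵥ t.ofLp)) : ℝ) : ℂ) * Complex.I) ∂(stdGaussianPi (Fin r)) =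
      Complex.exp (-(t.ofLp ⬝ᵥ Sig *ᵥ t.ofLp : ℝ) / 2) := by
    have h3 := charFun_stdGaussian (E := EuclideanSpace ℝ (Fin r)) (WithLp.toLp 2 (Aᵀ *ᵥ t.ofLp))
    rw [← map_pi_eq_stdGaussian, charFun_apply, integral_map (by fun_prop)
      (Measurable.aestronglyMeasurable (by fun_prop))] at h3
    refine h3.trans ?_
    have h4 : ‖(WithLp.toLp 2 (Aᵀ *ᵥ t.ofLp) : EuclideanSpace ℝ (Fin r))‖ ^ 2 =
        t.ofLp ⬝ᵥ Sig *ᵥ t.ofLp := by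
      have h5 : t.ofLp ⬝ᵥ Sig *ᵥ t.ofLp = (Aᵀ *ᵥ t.ofLp) ⬝ᵥ (Aᵀ *ᵥ t.ofLp) := by
        rw [hA, ← mulVec_mulVec, dotProduct_mulVec, mulVec_transpose]
      rw [← real_inner_self_eq_norm_sq, EuclideanSpace.inner_eq_star_dotProduct, star_trivial, h5]
    rw [← h4]
    push_cast
    rfl
  simp only [h1]
  push_cast
  simp only [add_mul, Complex.exp_add]
  rw [integral_const_mul, h2, ← Complex.exp_add]
  congr 1
  push_cast
  ring

theorem map_uncurry_pi_stdGaussianPi :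
    (Measure.pi fun _ : Fin n => stdGaussianPi (Fin r)).map
      (fun (x : Fin n → Fin r → ℝ) (q : Fin n × Fin r) => x q.1 q.2) =
      stdGaussianPi (Fin n × Fin r) := by
  refine (Measure.pi_eq fun s hs => ?_).symm
  rw [Measure.map_apply (by fun_prop) (MeasurableSet.univ_pi hs)]
  have e : (fun (x : Fin n → Fin r → ℝ) (q : Fin n × Fin r) => x q.1 q.2) ⁻¹' Set.univ.pi s =
      Set.univ.pi fun i => Set.univ.pi fun a => s (i, a) := by
    ext x
    simp [Set.mem_pi]
  rw [e, Measure.pi_pi]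
  simp only [stdGaussianPi, Measure.pi_pi]
  rw [Fintype.prod_prod_type]

/-- The columns of Q are the eigenvectors with nonzero eigenvalue, and their number is the rank. -/
theorem exists_eq_mul_diagonal_mul_transpose {Sig : Matrix (Fin p) (Fin p) ℝ}
    (hSig : Sig.PosSemidef) (hrank : Sig.rank = r) :
    ∃ (Q : Matrix (Fin p) (Fin r) ℝ) (w : Fin r → ℝ), Qᵀ * Q = 1 ∧ (∀ a, w a ≠ 0) ∧
      Sig = Q * diagonal (fun a => w a ^ 2) * Qᵀ := by
  have hA := hSig.isHermitian
  set U : Matrix (Fin p) (Fin p) ℝ := (hA.eigenvectorUnitary : Matrix (Fin p) (Fin p) ℝ)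
  set d := hA.eigenvalues with hd
  have hU : Uᵀ * U = 1 := by
    have h := (Matrix.mem_unitaryGroup_iff').1 hA.eigenvectorUnitary.2
    rwa [star_eq_conjTranspose, conjTranspose_eq_transpose_of_trivial] at h
  have hs : Sig = U * diagonal d * Uᵀ := by
    have h := hA.spectral_theorem
    rw [Unitary.conjStarAlgAut_apply, star_eq_conjTranspose,
      conjTranspose_eq_transpose_of_trivial] at h
    exact h
  rw [hA.rank_eq_card_non_zero_eigs] at hrank
  let e : Fin r ≃ {i // d i ≠ 0} := (Fintype.equivFinOfCardEq hrank).symm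
  have hinj : Function.Injective fun a => (e a : Fin p) := Subtype.val_injective.comp e.injective
  refine ⟨U.submatrix id fun a => (e a : Fin p), fun a => Real.sqrt (d (e a)), ?_, fun a => ?_, ?_⟩
  · ext a c
    have := congrFun (congrFun hU (e a)) (e c)
    rw [mul_apply] at this ⊢
    simp only [transpose_apply, submatrix_apply, id] at this ⊢
    rw [this, one_apply, one_apply]
    simp [Subtype.val_inj]
  · exact (Real.sqrt_pos.2 (lt_of_le_of_ne (hSig.eigenvalues_nonneg _) (e a).2.symm)).ne'
  · ext i j
    rw [mul_diagonal_mul_transpose_apply]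
    conv_lhs => rw [hs, mul_diagonal_mul_transpose_apply]
    have h1 : ∑ k, d k * (U i k * U j k) = ∑ k : {i // d i ≠ 0}, d k * (U i k * U j k) := by
      rw [← Finset.sum_subtype (Finset.univ.filter fun k => d k ≠ 0) (by simp)
        fun k => d k * (U i k * U j k)]
      refine (Finset.sum_filter_of_ne (p := fun k => d k ≠ 0) fun k _ hk hz => hk ?_).symm
      rw [hz, zero_mul]
    rw [h1, ← Equiv.sum_comp e]
    refine Finset.sum_congr rfl fun a _ => ?_
    rw [Real.sq_sqrt (hSig.eigenvalues_nonneg _)]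
    rfl

/-- A Gaussian sample is almost surely an affine image of independent standard normal variables. -/
theorem exists_standardization {Ω : Type*} [MeasurableSpace Ω] {P : Measure Ω}
    [IsProbabilityMeasure P] {Sig : Matrix (Fin p) (Fin p) ℝ} (hSig : Sig.PosSemidef)
    {Q : Matrix (Fin p) (Fin r) ℝ} {w : Fin r → ℝ} (hQ : Qᵀ * Q = 1) (hw : ∀ a, w a ≠ 0)
    (hS : Sig = Q * diagonal (fun a => w a ^ 2) * Qᵀ) {μ : EuclideanSpace ℝ (Fin p)}
    {X : Fin n → Ω → EuclideanSpace ℝ (Fin p)}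
    (hlaw : ∀ i, HasLaw (X i) (multivariateGaussian μ Sig) P) (hindep : iIndepFun X P) :
    ∃ Z : Ω → Fin n × Fin r → ℝ, HasLaw Z (stdGaussianPi (Fin n × Fin r)) P ∧
      ∀ᵐ ω ∂P, ∀ i j, X i ω j = μ j + ∑ a, Q j a * (w a * Z ω (i, a)) := by
  set A : Matrix (Fin p) (Fin r) ℝ := Q * diagonal w with hA
  have hAA : Sig = A * Aᵀ := by
    have e : diagonal (fun a => w a ^ 2) = diagonal w * diagonal w := by
      rw [diagonal_mul_diagonal]
      simp only [sq]
    rw [hS, hA, transpose_mul, diagonal_transpose, e]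
    simp only [Matrix.mul_assoc]
  set g : (Fin r → ℝ) → EuclideanSpace ℝ (Fin p) := fun x => μ + WithLp.toLp 2 (A *ᵥ x) with hg
  -- A left inverse of A. It recovers the standard normal variables from the sample on the same
  -- probability space.
  set B : Matrix (Fin r) (Fin p) ℝ := diagonal (fun a => (w a)⁻¹) * Qᵀ with hB
  set h : EuclideanSpace ℝ (Fin p) → (Fin r → ℝ) := fun y => B *ᵥ (y - μ).ofLp with hh
  have hgm : Measurable g := by fun_prop
  have hgc : Continuous g := by fun_prop
  have hhc : Continuous h := by
    refine Continuous.matrix_mulVec continuous_const ?_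
    fun_prop
  have hhm : Measurable h := hhc.measurable
  have hBA : B * A = 1 := by
    rw [hB, hA, Matrix.mul_assoc, ← Matrix.mul_assoc Qᵀ, hQ, Matrix.one_mul, diagonal_mul_diagonal]
    simp [hw]
  have hhg : ∀ x, h (g x) = x := by
    intro x
    simp only [hh, hg, add_sub_cancel_left]
    rw [mulVec_mulVec, hBA, one_mulVec]
  have hmap := multivariateGaussian_eq_map hSig hAA μ
  have hXm : ∀ i, AEMeasurable (X i) P := fun i => (hlaw i).aemeasurable
  have hpi : P.map (fun ω i => X i ω) =
      (Measure.pi fun _ : Fin n => stdGaussianPi (Fin r)).map fun x i => g (x i) := by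
    have hprob : IsProbabilityMeasure ((stdGaussianPi (Fin r)).map g) :=
      Measure.isProbabilityMeasure_map hgm.aemeasurable
    rw [(iIndepFun_iff_map_fun_eq_pi_map hXm).1 hindep,
      Measure.pi_map_pi (f := fun _ => g) fun _ => hgm.aemeasurable]
    congr 1
    funext i
    rw [(hlaw i).map_eq, hmap]
  refine ⟨fun ω q => h (X q.1 ω) q.2, ⟨?_, ?_⟩, ?_⟩
  · exact aemeasurable_pi_lambda _ fun q =>
      (measurable_pi_apply q.2).comp_aemeasurable (hhm.comp_aemeasurable (hXm q.1))
  · have hF : Measurable fun (y : Fin n → EuclideanSpace ℝ (Fin p)) (q : Fin n × Fin r) =>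
        h (y q.1) q.2 := measurable_pi_lambda _ fun q =>
      (measurable_pi_apply q.2).comp (hhm.comp (measurable_pi_apply q.1))
    have hG : Measurable fun (x : Fin n → Fin r → ℝ) i => g (x i) :=
      measurable_pi_lambda _ fun i => hgm.comp (measurable_pi_apply i)
    have e1 : P.map (fun ω q => h (X q.1 ω) q.2) = (P.map fun ω i => X i ω).map
        fun (y : Fin n → EuclideanSpace ℝ (Fin p)) (q : Fin n × Fin r) => h (y q.1) q.2 :=
      (AEMeasurable.map_map_of_aemeasurable hF.aemeasurable (aemeasurable_pi_lambda _ hXm)).symm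
    rw [e1, hpi, Measure.map_map hF hG, ← map_uncurry_pi_stdGaussianPi]
    congr 1
    funext x q
    simp [hhg]
  · rw [ae_all_iff]
    intro i
    have hcl : MeasurableSet {y | g (h y) = y} :=
      (isClosed_eq (hgc.comp hhc) continuous_id).measurableSet
    -- The Gaussian law is carried by the affine subspace μ + range A, where B inverts A from the
    -- other side too.
    have hae : ∀ᵐ y ∂(multivariateGaussian μ Sig), g (h y) = y := by
      rw [hmap, ae_map_iff hgm.aemeasurable hcl]
      exact .of_forall fun x => by rw [hhg]
    rw [← (hlaw i).map_eq, ae_map_iff (hXm i) hcl] at hae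
    filter_upwards [hae] with ω hω j
    conv_lhs => rw [← hω]
    simp only [hg, hA, PiLp.add_apply]
    rw [← mulVec_mulVec]
    simp [mulVec, dotProduct, diagonal_apply]

end GaussianSample

/-! ### Reduction of the sample covariance and of the loss to r × r matrices -/

section Algebra

variable {n p r : ℕ}

/-- Centring removes μ and commutes with the linear map Q diag(w). -/
theorem sampleCov_eq (hn : n ≠ 0) (Q : Matrix (Fin p) (Fin r) ℝ) (w : Fin r → ℝ) (μ : Fin p → ℝ)
    (z : Fin n × Fin r → ℝ) {X : Matrix (Fin n) (Fin p) ℝ}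
    (hX : ∀ i j, X i j = μ j + ∑ a, Q j a * (w a * z (i, a))) :
    sampleCov X = Q * scatter w z * Qᵀ := by
  have hn' : (n : ℝ) ≠ 0 := Nat.cast_ne_zero.2 hn
  have h1 : X - Matrix.of (fun _ j => sampleMean X j) = centered w z * Qᵀ := by
    ext i j
    rw [Matrix.sub_apply, of_apply, mul_apply, sampleMean]
    simp only [hX, Finset.sum_add_distrib, Finset.sum_const, Finset.card_univ, Fintype.card_fin,
      nsmul_eq_mul, transpose_apply, centered_apply]
    rw [Finset.sum_comm]
    have e : 1 / (n : ℝ) * (n * μ j + ∑ a, ∑ i, Q j a * (w a * z (i, a))) =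
        μ j + ∑ a, Q j a * (w a * ((n : ℝ)⁻¹ * ∑ i, z (i, a))) := by
      simp only [← Finset.mul_sum]
      rw [mul_add, Finset.mul_sum]
      congr 1
      · field_simp
      · exact Finset.sum_congr rfl fun a _ => by ring
    rw [e, add_sub_add_left_eq_sub, ← Finset.sum_sub_distrib]
    exact Finset.sum_congr rfl fun a _ => by ring
  rw [sampleCov, h1, scatter, one_div, transpose_mul, transpose_transpose, Matrix.mul_smul,
    Matrix.smul_mul]
  simp only [Matrix.mul_assoc]

theorem rank_mul_mul_transpose {Q : Matrix (Fin p) (Fin r) ℝ} (hQ : Qᵀ * Q = 1)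
    {S : Matrix (Fin r) (Fin r) ℝ} (hS : IsSimpleSpectrum S) : (Q * S * Qᵀ).rank = r := by
  obtain ⟨H, l, h⟩ := hS
  have hdet : S.det ≠ 0 := by
    rw [h.eq_mul, det_frame h.orth]
    exact Finset.prod_ne_zero_iff.2 fun k _ => (h.mem.2 k).ne'
  have h1 : S.rank = r := by
    rw [rank_of_isUnit _ ((isUnit_iff_isUnit_det _).2 (isUnit_iff_ne_zero.2 hdet)), Fintype.card_fin]
  refine le_antisymm ?_ ?_
  · calc _ ≤ (Q * S).rank := rank_mul_le_left _ _
      _ ≤ S.rank := rank_mul_le_right _ _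
      _ = r := h1
  · calc r = (Qᵀ * (Q * S * Qᵀ) * Q).rank := by
          rw [Matrix.mul_assoc Q, ← Matrix.mul_assoc, hQ, Matrix.one_mul, Matrix.mul_assoc, hQ,
            Matrix.mul_one, h1]
      _ ≤ (Qᵀ * (Q * S * Qᵀ)).rank := rank_mul_le_left _ _
      _ ≤ _ := rank_mul_le_right _ _

/-- The columns of O lie in the range of Q Qᵗ, so QQᵗO = O and QᵗO is orthogonal. The given
eigenvalues are only weakly ordered; simplicity of S makes the order strict. -/
theorem isSpectralFrame_of_isReducedSpectralDecomposition {Q O : Matrix (Fin p) (Fin r) ℝ}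
    (hQ : Qᵀ * Q = 1) {S : Matrix (Fin r) (Fin r) ℝ} (hS : IsSimpleSpectrum S) {l : Fin r → ℝ}
    (h : IsReducedSpectralDecomposition (Q * S * Qᵀ) O l) :
    IsSpectralFrame S (Qᵀ * O) l ∧ Q * (Qᵀ * O) = O := by
  have hQO : Q * (Qᵀ * O) = O := by
    have h1 : Q * Qᵀ * (O * diagonal l * Oᵀ) = O * diagonal l * Oᵀ := by
      rw [← h.eq_mul]
      calc Q * Qᵀ * (Q * S * Qᵀ) = Q * (Qᵀ * Q) * S * Qᵀ := by simp only [Matrix.mul_assoc]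
        _ = _ := by rw [hQ, Matrix.mul_one]
    have h2 : O * diagonal l * Oᵀ * (O * diagonal fun k => (l k)⁻¹) = O := by
      calc O * diagonal l * Oᵀ * (O * diagonal fun k => (l k)⁻¹) =
            O * diagonal l * (Oᵀ * O) * diagonal fun k => (l k)⁻¹ := by simp only [Matrix.mul_assoc]
        _ = O * (diagonal l * diagonal fun k => (l k)⁻¹) := by
            rw [h.semiorthogonal, Matrix.mul_one, Matrix.mul_assoc]
        _ = O := by
            rw [diagonal_mul_diagonal]
            simp [(h.pos _).ne']
    calc Q * (Qᵀ * O) = Q * Qᵀ * (O * diagonal l * Oᵀ) * (O * diagonal fun k => (l k)⁻¹) := by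
          rw [Matrix.mul_assoc (Q * Qᵀ), h2, Matrix.mul_assoc]
      _ = O := by rw [h1, h2]
  have horth : (Qᵀ * O)ᵀ * (Qᵀ * O) = 1 := by
    rw [transpose_mul, transpose_transpose, Matrix.mul_assoc, hQO, h.semiorthogonal]
  have hSe : S = Qᵀ * O * diagonal l * (Qᵀ * O)ᵀ := by
    calc S = Qᵀ * Q * S * (Qᵀ * Q) := by rw [hQ, Matrix.one_mul, Matrix.mul_one]
      _ = Qᵀ * (Q * S * Qᵀ) * Q := by simp only [Matrix.mul_assoc]
      _ = _ := by rw [h.eq_mul]; simp only [transpose_mul, transpose_transpose, Matrix.mul_assoc]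
  refine ⟨⟨horth, hSe, h.antitone.strictAnti_of_injective ?_, h.pos⟩, hQO⟩
  obtain ⟨H', l', h'⟩ := hS
  -- The discriminant is a function of S alone, so a nonzero value for one decomposition forces
  -- distinct entries of l.
  have e1 : (vandermonde l).det ^ 2 = (vandermonde l').det ^ 2 := by
    rw [← det_powerHankel_frame horth, ← det_powerHankel_frame h'.orth, ← hSe, ← h'.eq_mul]
  have e2 : (vandermonde l').det ≠ 0 := det_vandermonde_ne_zero_iff.2 h'.mem.1.injective
  refine det_vandermonde_ne_zero_iff.1 fun e3 => e2 ?_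
  rw [e3] at e1
  simpa using e1.symm

theorem moorePenroseInverse_eq {Q : Matrix (Fin p) (Fin r) ℝ} (hQ : Qᵀ * Q = 1) {d : Fin r → ℝ}
    (hd : ∀ a, d a ≠ 0) :
    moorePenroseInverse (Q * diagonal d * Qᵀ) = Q * diagonal (fun a => (d a)⁻¹) * Qᵀ := by
  have key : ∀ a b : Fin r → ℝ, (Q * diagonal a * Qᵀ) * (Q * diagonal b * Qᵀ) =
      Q * diagonal (fun i => a i * b i) * Qᵀ := by
    intro a b
    calc (Q * diagonal a * Qᵀ) * (Q * diagonal b * Qᵀ)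
        = Q * diagonal a * (Qᵀ * Q) * diagonal b * Qᵀ := by simp only [Matrix.mul_assoc]
      _ = _ := by rw [hQ, Matrix.mul_one, Matrix.mul_assoc Q, diagonal_mul_diagonal]
  have ksymm : ∀ a : Fin r → ℝ, (Q * diagonal a * Qᵀ)ᵀ = Q * diagonal a * Qᵀ := by
    intro a
    simp [transpose_mul, Matrix.mul_assoc]
  refine (moorePenroseInverse_spec _).unique ⟨?_, ?_, ?_, ?_⟩
  · rw [key, key]
    simp [hd]
  · rw [key, key]
    simp [hd]
  · rw [key, ksymm]
  · rw [key, ksymm]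

/-- Since QᵗQ = 1, all p × p traces reduce to r × r ones; only tr I_p still sees p. -/
theorem invariantLoss_eq {Q : Matrix (Fin p) (Fin r) ℝ} (hQ : Qᵀ * Q = 1) {w : Fin r → ℝ}
    (hw : ∀ a, w a ≠ 0) (S : Matrix (Fin r) (Fin r) ℝ) (d : Fin r → ℝ) :
    invariantLoss (Q * spectralSum S d * Qᵀ) (Q * diagonal (fun a => w a ^ 2) * Qᵀ) =
      quadWeight w S d - 2 * ∑ k, d k * invWeight w S k + p := by
  set K := spectralSum S d with hK
  set E : Matrix (Fin r) (Fin r) ℝ := diagonal fun a => (w a ^ 2)⁻¹ with hE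
  have h1 : Q * K * Qᵀ * (Q * E * Qᵀ) = Q * (K * E) * Qᵀ := by
    calc Q * K * Qᵀ * (Q * E * Qᵀ) = Q * K * (Qᵀ * Q) * E * Qᵀ := by simp only [Matrix.mul_assoc]
      _ = _ := by rw [hQ, Matrix.mul_one, Matrix.mul_assoc Q]
  have h2 : ∀ M : Matrix (Fin r) (Fin r) ℝ, (Q * M * Qᵀ).trace = M.trace := by
    intro M
    rw [Matrix.trace_mul_comm, ← Matrix.mul_assoc, hQ, Matrix.one_mul]
  have h3 : Q * (K * E) * Qᵀ * (Q * (K * E) * Qᵀ) = Q * (K * E * (K * E)) * Qᵀ := by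
    calc Q * (K * E) * Qᵀ * (Q * (K * E) * Qᵀ) = Q * (K * E) * (Qᵀ * Q) * (K * E) * Qᵀ := by
          simp only [Matrix.mul_assoc]
      _ = _ := by rw [hQ, Matrix.mul_one, Matrix.mul_assoc Q]
  have h4 : (K * E * (K * E)).trace = quadWeight w S d := by
    rw [quadWeight, Matrix.mul_assoc K, Matrix.trace_mul_comm K]
    simp only [Matrix.mul_assoc]
    rfl
  have h5 : (K * E).trace = ∑ k, d k * invWeight w S k := by
    rw [Matrix.trace_mul_comm, trace_mul_spectralSum]
    rfl
  rw [invariantLoss, moorePenroseInverse_eq hQ fun a => pow_ne_zero 2 (hw a), h1, sq, sub_mul, mul_sub,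
    h3, one_mul, mul_one, trace_sub, trace_sub, trace_sub, h2, h2, h4, h5, trace_one,
    Fintype.card_fin]
  ring

end Algebra

/-! ### The risk in the standardized sample -/

section Risk

variable {n r : ℕ} {w : Fin r → ℝ}

theorem differentiableOn_partialDeriv {f : (Fin r → ℝ) → ℝ}
    (hf : TwiceDifferentiableOn f (strictChamber r)) (k : Fin r) :
    DifferentiableOn ℝ (partialDeriv k f) (strictChamber r) := by
  have h : DifferentiableOn ℝ (fun l => fderiv ℝ f l (Pi.single k 1)) (strictChamber r) :=
    hf.2.clm_apply (differentiableOn_const _)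
  exact h.congr fun l hl =>
    partialDeriv_eq_fderiv (hf.1.differentiableAt (isOpen_strictChamber.mem_nhds hl)) k

/-- ψ* contains first derivatives of ψ, and the first identity is applied to ψ*; this is the use of
the second derivatives of ψ. -/
theorem differentiableOn_psiStar (n : ℕ) {ψ : Fin r → (Fin r → ℝ) → ℝ}
    (hψ : ∀ k, TwiceDifferentiableOn (ψ k) (strictChamber r)) (k : Fin r) :
    DifferentiableOn ℝ (psiStar n ψ k) (strictChamber r) := by
  unfold psiStar
  have hp : ∀ k, DifferentiableOn ℝ (fun l : Fin r → ℝ => l k) (strictChamber r) := fun k =>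
    (differentiable_apply k).differentiableOn
  refine DifferentiableOn.fun_mul (DifferentiableOn.fun_sub (DifferentiableOn.fun_add
    (DifferentiableOn.fun_add ((differentiableOn_div_apply (hψ k).1 k).const_mul _)
    ((differentiableOn_partialDeriv (hψ k) k).const_mul _)) (DifferentiableOn.const_mul
    (DifferentiableOn.fun_sum fun b hb => ?_) _)) (differentiableOn_const _)) (hψ k).1
  simp only [div_eq_mul_inv]
  exact ((hψ k).1.fun_sub (hψ b).1).fun_mul (((hp k).fun_sub (hp b)).fun_inv fun l hl =>
    sub_ne_zero.2 (strictChamber_ne hl (Finset.ne_of_mem_erase hb).symm))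

/-- The risk of the estimator, as a function of the standardized sample. -/
theorem integral_loss [NeZero r] (hrn : r ≤ n - 1) (hn : n ≠ 0) (hw : ∀ a, w a ≠ 0) (p : ℕ)
    {ψ : Fin r → (Fin r → ℝ) → ℝ} (hψc : ∀ k, ContinuousOn (ψ k) (weakChamber r))
    (hψd : ∀ k, TwiceDifferentiableOn (ψ k) (strictChamber r))
    (hrisk : Integrable (fun z => riskExpr n p (psiStar n ψ) (eigs (scatter w z)))
      (stdGaussianPi (Fin n × Fin r)))
    (hstar : Integrable (fun z => ∑ k, (psiStar n ψ k (eigs (scatter w z)) /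
      eigs (scatter w z) k) ^ 2) (stdGaussianPi (Fin n × Fin r)))
    (hsq : Integrable (fun z => ∑ k, (ψ k (eigs (scatter w z)) / eigs (scatter w z) k) ^ 2)
      (stdGaussianPi (Fin n × Fin r))) :
    Integrable (fun z => quadWeight w (scatter w z) (fun k => ψ k (eigs (scatter w z))) -
      2 * ∑ k, ψ k (eigs (scatter w z)) * invWeight w (scatter w z) k + p)
      (stdGaussianPi (Fin n × Fin r)) ∧
    ∫ z, (quadWeight w (scatter w z) (fun k => ψ k (eigs (scatter w z))) -
      2 * ∑ k, ψ k (eigs (scatter w z)) * invWeight w (scatter w z) k + p)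
      ∂(stdGaussianPi (Fin n × Fin r)) =
    ∫ z, riskExpr n p (psiStar n ψ) (eigs (scatter w z)) ∂(stdGaussianPi (Fin n × Fin r)) := by
  have hn' : (n : ℝ) ≠ 0 := Nat.cast_ne_zero.2 hn
  have hψ := fun k => (hψd k).1
  have hdstar := differentiableOn_psiStar n hψd
  have hi1 := integrable_apply_of_sq hrn hn hw
    (fun k => ChamberMeasurable.of_continuousOn (hψ k).continuousOn) hsq
  have hi2 := integrable_apply_of_sq hrn hn hw
    (fun k => ChamberMeasurable.of_continuousOn (hdstar k).continuousOn) hstar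
  have hquad : ∀ k, Integrable (fun z => steinQuad n ψ k (eigs (scatter w z)))
      (stdGaussianPi (Fin n × Fin r)) := fun k => by
    simp only [steinQuad_eq hn]
    exact ((hi2 k).add ((hi1 k).const_mul 2)).const_mul _
  obtain ⟨hT, hTeq⟩ := integral_quadWeight hrn hn hw hψc hψ hsq hquad
  have hst : Integrable (fun z => steinOp n (psiStar n ψ) (eigs (scatter w z)))
      (stdGaussianPi (Fin n × Fin r)) := by
    refine ((hrisk.sub (integrable_const (p : ℝ))).const_mul (n : ℝ)).congr (.of_forall fun z => ?_)
    simp only [Pi.sub_apply, riskExpr_eq]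
    field_simp
    ring
  have hfirst := integral_steinOp hrn hn hw hdstar hstar hst
  have hs1 : Integrable (fun z => ∑ k, ψ k (eigs (scatter w z)) * invWeight w (scatter w z) k)
      (stdGaussianPi (Fin n × Fin r)) :=
    integrable_finsetSum _ fun k _ => integrable_mul_invWeight hrn hn hw (hi1 k) k
  have hs2 : Integrable (fun z => ∑ k, psiStar n ψ k (eigs (scatter w z)) *
      invWeight w (scatter w z) k) (stdGaussianPi (Fin n × Fin r)) :=
    integrable_finsetSum _ fun k _ => integrable_mul_invWeight hrn hn hw (hi2 k) k
  have hT2 := hT.sub (hs1.const_mul 2)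
  refine ⟨hT2.add (integrable_const _), ?_⟩
  -- After division by n, the second identity expresses the quadratic term of the loss by ψ* + 2ψ.
  -- The part 2ψ is exactly the cross term, with opposite sign.
  have e1 : ∫ z, ∑ k, steinQuad n ψ k (eigs (scatter w z)) * invWeight w (scatter w z) k
      ∂(stdGaussianPi (Fin n × Fin r)) =
      n * (∫ z, ∑ k, psiStar n ψ k (eigs (scatter w z)) * invWeight w (scatter w z) k
        ∂(stdGaussianPi (Fin n × Fin r)) +
      2 * ∫ z, ∑ k, ψ k (eigs (scatter w z)) * invWeight w (scatter w z) k
        ∂(stdGaussianPi (Fin n × Fin r))) := by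
    rw [← integral_const_mul 2, ← integral_add hs2 (hs1.const_mul 2), ← integral_const_mul]
    refine integral_congr_ae (.of_forall fun z => ?_)
    simp only [steinQuad_eq hn, Finset.mul_sum, ← Finset.sum_add_distrib]
    exact Finset.sum_congr rfl fun k _ => by ring
  rw [e1] at hTeq
  have hTeq' := mul_left_cancel₀ hn' hTeq
  rw [integral_const_mul] at hfirst
  have e2 : ∫ z, riskExpr n p (psiStar n ψ) (eigs (scatter w z)) ∂(stdGaussianPi (Fin n × Fin r)) =
      p + ∫ z, ∑ k, psiStar n ψ k (eigs (scatter w z)) * invWeight w (scatter w z) k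
        ∂(stdGaussianPi (Fin n × Fin r)) := by
    simp only [riskExpr_eq]
    rw [integral_add (integrable_const _) (hst.const_mul _), integral_const_mul, hfirst,
      inv_mul_cancel_left₀ hn']
    simp
  have e3 := integral_add hT2 (integrable_const (p : ℝ))
  have e4 := integral_sub hT (hs1.const_mul 2)
  rw [integral_const_mul, hTeq'] at e4
  simp only [Pi.sub_apply] at e3
  rw [e3, e4, e2]
  simp
  ring

end Risk

end

theorem theorem1 {Ω : Type*} [MeasurableSpace Ω] (P : Measure Ω) [IsProbabilityMeasure P]
    (n p r : ℕ) (hr : 1 ≤ r) (hrn : r ≤ n - 1)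
    -- the sample: independent, with common law `N_p(μ, Sig)`, where `Sig` has rank `r`
    (μ : EuclideanSpace ℝ (Fin p)) (Sig : Matrix (Fin p) (Fin p) ℝ)
    (hSig : Sig.PosSemidef) (hrank : Sig.rank = r)
    (X : Fin n → Ω → EuclideanSpace ℝ (Fin p))
    (hlaw : ∀ i, HasLaw (X i) (multivariateGaussian μ Sig) P)
    (hindep : iIndepFun X P)
    -- the sample covariance matrix
    (S : Ω → Matrix (Fin p) (Fin p) ℝ)
    (hS : ∀ ω, S ω = sampleCov (Matrix.of fun i j => X i ω j))
    -- a reduced spectral decomposition `S = O₁ diag(l) O₁ᵗ`, wherever `S` has rank `r`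
    (O₁ : Ω → Matrix (Fin p) (Fin r) ℝ) (l : Ω → Fin r → ℝ)
    (hdec : ∀ ω, (S ω).rank = r → IsReducedSpectralDecomposition (S ω) (O₁ ω) (l ω))
    -- the functions of the eigenvalues
    (ψ : Fin r → (Fin r → ℝ) → ℝ)
    (hψc : ∀ k, ContinuousOn (ψ k) (weakChamber r))
    (hψd : ∀ k, TwiceDifferentiableOn (ψ k) (strictChamber r))
    -- the regularity conditions
    (hreg₁ : Integrable (fun ω => riskExpr n p (psiStar n ψ) (l ω)) P)
    (hreg₂ : Integrable (fun ω => riskExpr n p ψ (l ω)) P)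
    (hreg₃ : Integrable (fun ω => ∑ k, |psiStar n ψ k (l ω) / l ω k| ^ 2) P)
    (hreg₄ : Integrable (fun ω => ∑ k, |ψ k (l ω) / l ω k| ^ 2) P) :
    Integrable (fun ω => invariantLoss (invariantEstimator ψ (O₁ ω) (l ω)) Sig) P ∧
    ∫ ω, invariantLoss (invariantEstimator ψ (O₁ ω) (l ω)) Sig ∂P =
      ∫ ω, riskExpr n p (psiStar n ψ) (l ω) ∂P := by
  have : NeZero r := ⟨by omega⟩
  have hn : n ≠ 0 := by omega
  obtain ⟨Q, w, hQ, hw, hSQ⟩ := exists_eq_mul_diagonal_mul_transpose hSig hrank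
  obtain ⟨Z, hZ, hXZ⟩ := exists_standardization hSig hQ hw hSQ hlaw hindep
  have hZs : ∀ᵐ ω ∂P, IsSimpleSpectrum (scatter w (Z ω)) :=
    ae_of_ae_map hZ.aemeasurable (by rw [hZ.map_eq]; exact ae_isSimpleSpectrum hrn hn hw)
  have hframe : ∀ᵐ ω ∂P, IsSpectralFrame (scatter w (Z ω)) (Qᵀ * O₁ ω) (l ω) ∧
      Q * (Qᵀ * O₁ ω) = O₁ ω := by
    filter_upwards [hZs, hXZ] with ω h1 h2
    have h3 : S ω = Q * scatter w (Z ω) * Qᵀ := by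
      rw [hS]
      exact sampleCov_eq hn Q w μ.ofLp (Z ω) h2
    -- The decomposition is only given where S has rank r, which holds almost surely.
    have h4 := hdec ω (by rw [h3]; exact rank_mul_mul_transpose hQ h1)
    rw [h3] at h4
    exact isSpectralFrame_of_isReducedSpectralDecomposition hQ h1 h4
  have hl : ∀ᵐ ω ∂P, l ω = eigs (scatter w (Z ω)) := hframe.mono fun ω h => h.1.eigs_eq.symm
  have hloss : ∀ᵐ ω ∂P, invariantLoss (invariantEstimator ψ (O₁ ω) (l ω)) Sig =
      quadWeight w (scatter w (Z ω)) (fun k => ψ k (eigs (scatter w (Z ω)))) -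
      2 * ∑ k, ψ k (eigs (scatter w (Z ω))) * invWeight w (scatter w (Z ω)) k + p := by
    filter_upwards [hframe] with ω h
    rw [← invariantLoss_eq hQ hw, h.1.eigs_eq, h.1.spectralSum_eq, ← hSQ, invariantEstimator]
    congr 1
    conv_lhs => rw [← h.2]
    simp only [transpose_mul, transpose_transpose, Matrix.mul_assoc]
  have hdstar := differentiableOn_psiStar n hψd
  -- The eigenvalues l agree almost surely with those of the standardized scatter matrix, so the
  -- regularity conditions move to the Gaussian space.
  have transfer : ∀ f : (Fin r → ℝ) → ℝ, ChamberMeasurable f → Integrable (fun ω => f (l ω)) P →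
      Integrable (fun z => f (eigs (scatter w z))) (stdGaussianPi (Fin n × Fin r)) := by
    intro f hf hi
    rw [← hZ.map_eq, integrable_map_measure
      (by rw [hZ.map_eq]; exact hf.aestronglyMeasurable hrn hn hw) hZ.aemeasurable]
    exact hi.congr (hl.mono fun ω h => by simp only [Function.comp_apply]; rw [h])
  have msq : ∀ φ : Fin r → (Fin r → ℝ) → ℝ, (∀ k, DifferentiableOn ℝ (φ k) (strictChamber r)) →
      ChamberMeasurable fun l => ∑ k, (φ k l / l k) ^ 2 := fun φ hφ =>
    .of_continuousOn (continuousOn_finsetSum _ fun k _ =>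
      (differentiableOn_div_apply (hφ k) k).continuousOn.pow 2)
  simp only [sq_abs] at hreg₃ hreg₄
  have mrisk : ChamberMeasurable (riskExpr n p (psiStar n ψ)) := by
    have h := ChamberMeasurable.steinOp (n := n) hdstar
    unfold ChamberMeasurable at h ⊢
    simp only [riskExpr_eq]
    exact (h.const_mul _).const_add _
  obtain ⟨h1, h2⟩ := integral_loss hrn hn hw p hψc hψd (transfer _ mrisk hreg₁)
    (transfer _ (msq _ hdstar) hreg₃) (transfer _ (msq _ fun k => (hψd k).1) hreg₄)
  have h3 := h1
  rw [← hZ.map_eq] at h3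
  refine ⟨(h3.comp_aemeasurable hZ.aemeasurable).congr (hloss.mono fun ω h => h.symm), ?_⟩
  rw [integral_congr_ae hloss, integral_congr_ae (hl.mono fun ω h => congrArg _ h : (fun ω => riskExpr n p (psiStar n ψ) (l ω)) =ᵐ[P] fun ω =>
      riskExpr n p (psiStar n ψ) (eigs (scatter w (Z ω))))]
  have e1 := integral_map hZ.aemeasurable h3.1
  have e2 := integral_map hZ.aemeasurable (f := fun z => riskExpr n p (psiStar n ψ)
    (eigs (scatter w z))) (by rw [hZ.map_eq]; exact mrisk.aestronglyMeasurable hrn hn hw)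
  rw [hZ.map_eq] at e1 e2
  rw [← e1, ← e2, h2]
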